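/- Let $T$ be a (symmetric, coloured) operad with set of objects $I$: it has arrows $\alpha:(i_j)_{1\le j\le n}\to i$ $(n\ge 0,\ i_j,i\in I)$, arrows $\alpha\rho:(i_{\rho j})_j\to i$ for permutations $\rho$, identities $1_i:(i)\to i$ and composites $\alpha(\beta_j)_j:(i_{jk})_{jk}\to i$, subject to the usual unit, associativity and equivariance laws. Identify categories over the discrete category $I$ with families $(X_i)_{i\in I}$ of small categories, and write $\mathbf{Cat}/I$ for the 2-category of these. *The 2-monads $T$ and $T/\Sigma$.* Regard $T$ as the 2-monad on $\mathbf{Cat}/I$ for which $(TX)_i$ has objects $(\alpha,(x_j)_j)$, with $\alpha:(i_j)_j\to i$ in $T$ and $x_j\in X_{i_j}$, and morphisms $(\rho,(\gamma_j)_j):(\alpha\rho,(x_j)_j)\to(\alpha,(y_j)_j)$ with $\rho$ a permutation and $\gamma_j:x_j\to y_{\rho j}$; unit and multiplication come from the identities and composition of $T$. A morphism $(\rho,(\gamma_j)_j)$ is *permutative* if all $\gamma_j$ are identities. Let $q:T\to T/\Sigma$ be the universal morphism of 2-monads whose components send permutative morphisms to identities (computed fibrewise, as the universal functor out of $(TX)_i$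 doing so). *Operad morphisms into $\mathbf{Cat}$.* A lax morphism $H:T\to\underline{\mathbf{Cat}}$ is a family of small categories $(H_i)_{i\in I}$ with functors $H_\alpha:\prod_jH_{i_j}\to H_i$ (products), natural transformations $\xi_{\alpha,\rho}:H_{\alpha\rho}c_\rho\to H_\alpha$ (symmetries; $c_\rho$ permutes factors), $\nu_i:1_{H_i}\to H_{1_i}$ (units) and $\sigma_{\alpha,(\beta_j)_j}:H_\alpha(\prod_jH_{\beta_j})\to H_{\alpha(\beta_j)_j}$ (substitutions), such that $\xi_{\alpha,1}=\mathrm{id}$, $\xi_{\alpha,\rho_1\rho_2}=\xi_{\alpha,\rho_1}(\xi_{\alpha\rho_1,\rho_2}c_{\rho_1})$, the two unit laws and the associativity law for $(\nu,\sigma)$ hold, and $\sigma$ is compatible with $\xi$ (equivariance). It is *commutative* if all $\xi_{\alpha,\rho}$ are identities. For lax morphisms $H,K$ and a family of functors $f=(f_i:H_i\to K_i)_{i\in I}$, a *lax-natural transformation structure* on $f$ is a family of natural transformations $\overline f_\alpha:K_\alpha(\prod_jf_{i_j})\to f_iH_\alpha$ compatible with symmetries, units and substitutions; *colax-natural* structures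 have $\overline f_\alpha$ in the opposite direction; $f$ is *pseudo-natural*, resp. *natural*, if it is lax-natural with all $\overline f_\alpha$ invertible, resp. identities. A *modification* $(f,\overline f)\to(g,\overline g)$ between lax-natural transformations is a family of natural transformations $\psi_i:f_i\to g_i$ with $(\psi_iH_\alpha)\,\overline f_\alpha=\overline g_\alpha\,(K_\alpha\prod_j\psi_{i_j})$ for all $\alpha$; dually in the colax case. *Algebras.* For a 2-monad $S$, lax $S$-algebra structures $(a:SA\to A,\ \overline a_0:1\to a\eta_A,\ \overline a_2:aS(a)\to a\mu_A)$, lax morphism structures $\overline f:bS(f)\to fa$ on a 1-cell $f$, colax morphism structures (with $\overline f$ reversed), pseudo and strict morphism structures ($\overline f$ invertible, resp. an identity) and algebra 2-cells are understood in the usual sense. **Theorem.** Let $H,K$ be commutative lax morphisms $T\to\underline{\mathbf{Cat}}$. (0) There is exactly one lax $(T/\Sigma)$-algebra structure $(a,\overline a_0,\overline a_2)$ on $(H_i)_i$ corresponding to $H$, that is, such that $a\,q(\alpha,-)=H_\alpha$ as functors on $\prod_jH_{i_j}$, the components of $\overline a_0$ are those of the $\nu_i$, and the component of $\overline a_2$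 at the class of $(\alpha,(\beta_j,(x_{jk})_k)_j)$ is the component of $\sigma_{\alpha,(\beta_j)_j}$ at $(x_{jk})_{jk}$; likewise for $K$. Below, $H$ and $K$ carry these algebra structures. (1) Let $f:H\to K$ be a morphism of $\mathbf{Cat}/I$. Lax, colax, pseudo and strict $(T/\Sigma)$-algebra morphism structures $\overline f$ on $f$ are in bijection with lax-natural, colax-natural, pseudo-natural and natural transformation structures $(\overline f_\alpha)_\alpha$ on $f$ respectively; in each case the bijection is such that the component of $\overline f$ at $q(\alpha,(x_j)_j)$ is the component of $\overline f_\alpha$ at $(x_j)_j$. (2) Let $f,g:H\to K$ be morphisms of $\mathbf{Cat}/I$ with lax-natural (resp. colax-natural) transformation structures. A 2-cell $\psi:f\to g$ of $\mathbf{Cat}/I$ is a modification between these if and only if it is an algebra 2-cell between the corresponding lax (resp. colax) morphisms of $(T/\Sigma)$-algebras. -/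

import Mathlib

open CategoryTheory Bicategory

universe w v u

/-! ## 2-monads on strict 2-categories and their algebras -/

/-- A (strict) 2-monad on a strict 2-category: an endo-2-functor (`obj`, `map`, `map₂`) with
2-natural transformations `η`, `μ` satisfying the monad laws.  The `eqToHom`s are identity 2-cells
between 1-cells which are equal by the preceding laws. -/
structure TwoMonad (B : Type u) [Bicategory.{w, v} B] [Bicategory.Strict B] where
  obj : B → B
  map : ∀ {X Y : B}, (X ⟶ Y) → (obj X ⟶ obj Y)
  map₂ : ∀ {X Y : B} {f g : X ⟶ Y}, (f ⟶ g) → (map f ⟶ map g)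
  map_id : ∀ X : B, map (𝟙 X) = 𝟙 (obj X)
  map_comp : ∀ {X Y Z : B} (f : X ⟶ Y) (g : Y ⟶ Z), map (f ≫ g) = map f ≫ map g
  map₂_id : ∀ {X Y : B} (f : X ⟶ Y), map₂ (𝟙 f) = 𝟙 (map f)
  map₂_comp : ∀ {X Y : B} {f g h : X ⟶ Y} (θ : f ⟶ g) (κ : g ⟶ h),
    map₂ (θ ≫ κ) = map₂ θ ≫ map₂ κ
  map₂_whiskerLeft : ∀ {X Y Z : B} (f : X ⟶ Y) {g h : Y ⟶ Z} (θ : g ⟶ h),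
    map₂ (f ◁ θ) = eqToHom (map_comp f g) ≫ map f ◁ map₂ θ ≫ eqToHom (map_comp f h).symm
  map₂_whiskerRight : ∀ {X Y Z : B} {f g : X ⟶ Y} (θ : f ⟶ g) (h : Y ⟶ Z),
    map₂ (θ ▷ h) = eqToHom (map_comp f h) ≫ map₂ θ ▷ map h ≫ eqToHom (map_comp g h).symm
  η : ∀ X : B, X ⟶ obj X
  μ : ∀ X : B, obj (obj X) ⟶ obj X
  η_nat : ∀ {X Y : B} (f : X ⟶ Y), f ≫ η Y = η X ≫ map f
  η_nat₂ : ∀ {X Y : B} {f g : X ⟶ Y} (θ : f ⟶ g),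
    θ ▷ η Y = eqToHom (η_nat f) ≫ η X ◁ map₂ θ ≫ eqToHom (η_nat g).symm
  μ_nat : ∀ {X Y : B} (f : X ⟶ Y), map (map f) ≫ μ Y = μ X ≫ map f
  μ_nat₂ : ∀ {X Y : B} {f g : X ⟶ Y} (θ : f ⟶ g),
    map₂ (map₂ θ) ▷ μ Y = eqToHom (μ_nat f) ≫ μ X ◁ map₂ θ ≫ eqToHom (μ_nat g).symm
  left_unit : ∀ X : B, η (obj X) ≫ μ X = 𝟙 (obj X)
  right_unit : ∀ X : B, map (η X) ≫ μ X = 𝟙 (obj X)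
  assoc : ∀ X : B, map (μ X) ≫ μ X = μ (obj X) ≫ μ X

namespace TwoMonad

variable {B : Type u} [Bicategory.{w, v} B] [Bicategory.Strict B]

/-- A strict morphism of 2-monads on the same 2-category. -/
structure Hom (S T : TwoMonad B) where
  app : ∀ X : B, S.obj X ⟶ T.obj X
  nat : ∀ {X Y : B} (f : X ⟶ Y), S.map f ≫ app Y = app X ≫ T.map f
  nat₂ : ∀ {X Y : B} {f g : X ⟶ Y} (θ : f ⟶ g),
    S.map₂ θ ▷ app Y = eqToHom (nat f) ≫ app X ◁ T.map₂ θ ≫ eqToHom (nat g).symm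
  unit : ∀ X : B, S.η X ≫ app X = T.η X
  mul : ∀ X : B, S.μ X ≫ app X = S.map (app X) ≫ app (T.obj X) ≫ T.μ X

section cells

variable (T : TwoMonad B)

lemma unit_cell_eq {A : B} (a : T.obj A ⟶ A) :
    a ≫ T.η A ≫ a = T.η (T.obj A) ≫ T.map a ≫ a := by
  rw [← Bicategory.Strict.assoc, T.η_nat, Bicategory.Strict.assoc]

lemma left_unit_eq {A X : B} (a : T.obj A ⟶ X) : T.η (T.obj A) ≫ T.μ A ≫ a = a := by
  rw [← Bicategory.Strict.assoc, T.left_unit, Bicategory.Strict.id_comp]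

lemma right_unit_eq {A X : B} (a : T.obj A ⟶ X) : T.map (T.η A) ≫ T.μ A ≫ a = a := by
  rw [← Bicategory.Strict.assoc, T.right_unit, Bicategory.Strict.id_comp]

lemma map_id_comp_eq {A X : B} (a : T.obj A ⟶ X) : T.map (𝟙 A) ≫ a = a := by
  rw [T.map_id, Bicategory.Strict.id_comp]

lemma map_comp_comp_eq {X Y Z W : B} (f : X ⟶ Y) (g : Y ⟶ Z) (a : T.obj Z ⟶ W) :
    T.map (f ≫ g) ≫ a = T.map f ≫ T.map g ≫ a := by
  rw [T.map_comp, Bicategory.Strict.assoc]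

lemma μ_nat_comp_eq {X Y Z : B} (f : X ⟶ Y) (a : T.obj Y ⟶ Z) :
    T.map (T.map f) ≫ T.μ Y ≫ a = T.μ X ≫ T.map f ≫ a := by
  rw [← Bicategory.Strict.assoc, T.μ_nat, Bicategory.Strict.assoc]

lemma η_nat_comp_eq {X Y Z : B} (f : X ⟶ Y) (a : T.obj Y ⟶ Z) :
    f ≫ T.η Y ≫ a = T.η X ≫ T.map f ≫ a := by
  rw [← Bicategory.Strict.assoc, T.η_nat, Bicategory.Strict.assoc]

lemma assoc_comp_eq {A X : B} (a : T.obj A ⟶ X) :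
    T.map (T.μ A) ≫ T.μ A ≫ a = T.μ (T.obj A) ≫ T.μ A ≫ a := by
  rw [← Bicategory.Strict.assoc, T.assoc, Bicategory.Strict.assoc]

lemma η_map_comp_comp_eq {X Y Z : B} (f : T.obj X ⟶ Y) (g : Y ⟶ Z) :
    (T.η X ≫ f) ≫ g = T.η X ≫ f ≫ g := Bicategory.Strict.assoc _ _ _

end cells

/-- A lax `T`-algebra structure on `A`: an action `act : T A ⟶ A` (called `a` below) with
coherence 2-cells `unit : 1 ⟶ a η` and `mul : a T(a) ⟶ a μ` subject to the two unit laws and the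
associativity law.  Composites of 1-cells are written in diagrammatic order. -/
@[ext]
structure LaxAlg (T : TwoMonad B) (A : B) where
  act : T.obj A ⟶ A
  unit : 𝟙 A ⟶ T.η A ≫ act
  mul : T.map act ≫ act ⟶ T.μ A ≫ act
  unit_mul : act ◁ unit ≫ eqToHom (T.unit_cell_eq act) ≫ T.η (T.obj A) ◁ mul =
    eqToHom ((Bicategory.Strict.comp_id act).trans (T.left_unit_eq act).symm)
  map_unit_mul :
    T.map₂ unit ▷ act ≫ eqToHom (T.map_comp_comp_eq (T.η A) act act) ≫ T.map (T.η A) ◁ mul =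
    eqToHom ((T.map_id_comp_eq act).trans (T.right_unit_eq act).symm)
  mul_mul :
    T.map (T.map act) ◁ mul ≫ eqToHom (T.μ_nat_comp_eq act act) ≫ T.μ (T.obj A) ◁ mul =
    eqToHom (T.map_comp_comp_eq (T.map act) act act).symm ≫ T.map₂ mul ▷ act ≫
      eqToHom (T.map_comp_comp_eq (T.μ A) act act) ≫ T.map (T.μ A) ◁ mul ≫
      eqToHom (T.assoc_comp_eq act)

variable {T : TwoMonad B} {A C : B}

/-- A lax morphism structure on `f : A ⟶ C` between lax algebras: a 2-cell
`c T(f) ⟶ f a` compatible with the units and multiplications of the algebras. -/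
@[ext]
structure LaxMor (𝒜 : LaxAlg T A) (𝒞 : LaxAlg T C) (f : A ⟶ C) where
  cell : T.map f ≫ 𝒞.act ⟶ 𝒜.act ≫ f
  unit_cell :
    f ◁ 𝒞.unit ≫ eqToHom (T.η_nat_comp_eq f 𝒞.act) ≫ T.η A ◁ cell =
    eqToHom ((Bicategory.Strict.comp_id f).trans (Bicategory.Strict.id_comp f).symm) ≫
      𝒜.unit ▷ f ≫ eqToHom (Bicategory.Strict.assoc _ _ _)
  mul_cell :
    T.map (T.map f) ◁ 𝒞.mul ≫ eqToHom (T.μ_nat_comp_eq f 𝒞.act) ≫ T.μ A ◁ cell =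
    eqToHom (T.map_comp_comp_eq (T.map f) 𝒞.act 𝒞.act).symm ≫ T.map₂ cell ▷ 𝒞.act ≫
      eqToHom (T.map_comp_comp_eq 𝒜.act f 𝒞.act) ≫ T.map 𝒜.act ◁ cell ≫
      eqToHom (Bicategory.Strict.assoc _ _ _).symm ≫ 𝒜.mul ▷ f ≫
      eqToHom (Bicategory.Strict.assoc _ _ _)

/-- A colax morphism structure on `f`: a 2-cell `f a ⟶ c T(f)` in the other direction. -/
@[ext]
structure ColaxMor (𝒜 : LaxAlg T A) (𝒞 : LaxAlg T C) (f : A ⟶ C) where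
  cell : 𝒜.act ≫ f ⟶ T.map f ≫ 𝒞.act
  unit_cell :
    f ◁ 𝒞.unit =
    eqToHom ((Bicategory.Strict.comp_id f).trans (Bicategory.Strict.id_comp f).symm) ≫
      𝒜.unit ▷ f ≫ eqToHom (Bicategory.Strict.assoc _ _ _) ≫ T.η A ◁ cell ≫
      eqToHom (T.η_nat_comp_eq f 𝒞.act).symm
  mul_cell :
    eqToHom (Bicategory.Strict.assoc _ _ _).symm ≫ 𝒜.mul ▷ f ≫
      eqToHom (Bicategory.Strict.assoc _ _ _) ≫ T.μ A ◁ cell =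
    T.map 𝒜.act ◁ cell ≫ eqToHom (T.map_comp_comp_eq 𝒜.act f 𝒞.act).symm ≫
      T.map₂ cell ▷ 𝒞.act ≫ eqToHom (T.map_comp_comp_eq (T.map f) 𝒞.act 𝒞.act) ≫
      T.map (T.map f) ◁ 𝒞.mul ≫ eqToHom (T.μ_nat_comp_eq f 𝒞.act)

/-- A pseudo morphism structure: a lax one whose 2-cell is invertible. -/
def PseudoMor (𝒜 : LaxAlg T A) (𝒞 : LaxAlg T C) (f : A ⟶ C) :=
  {φ : LaxMor 𝒜 𝒞 f // IsIso φ.cell}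

/-- A strict morphism structure: a lax one whose 2-cell is an identity. -/
def StrictMor (𝒜 : LaxAlg T A) (𝒞 : LaxAlg T C) (f : A ⟶ C) :=
  {φ : LaxMor 𝒜 𝒞 f // ∃ h : T.map f ≫ 𝒞.act = 𝒜.act ≫ f, φ.cell = eqToHom h}

/-- The 2-cell `θ : f ⟶ g` is an algebra 2-cell between lax morphisms. -/
def IsAlgTwoCell {𝒜 : LaxAlg T A} {𝒞 : LaxAlg T C} {f g : A ⟶ C}
    (φ : LaxMor 𝒜 𝒞 f) (γ : LaxMor 𝒜 𝒞 g) (θ : f ⟶ g) : Prop :=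
  φ.cell ≫ 𝒜.act ◁ θ = T.map₂ θ ▷ 𝒞.act ≫ γ.cell

/-- The 2-cell `θ : f ⟶ g` is an algebra 2-cell between colax morphisms. -/
def IsColaxAlgTwoCell {𝒜 : LaxAlg T A} {𝒞 : LaxAlg T C} {f g : A ⟶ C}
    (φ : ColaxMor 𝒜 𝒞 f) (γ : ColaxMor 𝒜 𝒞 g) (θ : f ⟶ g) : Prop :=
  φ.cell ≫ T.map₂ θ ▷ 𝒞.act = 𝒜.act ◁ θ ≫ γ.cell

end TwoMonad

/-! ## The 2-category of categories over a set -/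

/-- A small category over the set `I` (regarded as a discrete category), given as the family of
its fibres. -/
structure CatOver (I : Type u) where
  fib : I → Type u
  [cat : ∀ i, SmallCategory (fib i)]

attribute [instance] CatOver.cat

namespace CatOver

variable {I : Type u}

instance : CategoryStruct (CatOver I) where
  Hom X Y := ∀ i, X.fib i ⥤ Y.fib i
  id X := fun i => 𝟭 (X.fib i)
  comp f g := fun i => f i ⋙ g i

/-- The 2-category structure: 1-cells are functors over `I`, 2-cells are natural transformations,
both given fibrewise. -/
instance : Bicategory (CatOver I) where
  homCategory X Y := inferInstanceAs (Category (∀ i, X.fib i ⥤ Y.fib i))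
  whiskerLeft f _ _ θ := fun i => Functor.whiskerLeft (f i) (θ i)
  whiskerRight θ h := fun i => Functor.whiskerRight (θ i) (h i)
  associator f g h := Pi.isoMk fun i => Functor.associator (f i) (g i) (h i)
  leftUnitor f := Pi.isoMk fun i => Functor.leftUnitor (f i)
  rightUnitor f := Pi.isoMk fun i => Functor.rightUnitor (f i)
  whiskerLeft_id f g := by funext i; ext x; rfl
  whiskerLeft_comp _ _ _ _ _ _ := by funext i; ext x; rfl
  id_whiskerLeft θ := by funext i; ext x; exact (by simp : (θ i).app x = 𝟙 _ ≫ (θ i).app x ≫ 𝟙 _)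
  comp_whiskerLeft f g _ _ θ := by
    funext i; ext x
    exact (by simp : (θ i).app ((g i).obj ((f i).obj x)) = 𝟙 _ ≫ (θ i).app _ ≫ 𝟙 _)
  id_whiskerRight f g := by funext i; ext x; exact (g i).map_id _
  comp_whiskerRight _ _ h := by funext i; ext x; exact (h i).map_comp _ _
  whiskerRight_id θ := by funext i; ext x; exact (by simp : (θ i).app x = 𝟙 _ ≫ (θ i).app x ≫ 𝟙 _)
  whiskerRight_comp θ g h := by
    funext i; ext x
    exact (by simp : (h i).map ((g i).map ((θ i).app x)) =
      𝟙 _ ≫ (h i).map ((g i).map ((θ i).app x)) ≫ 𝟙 _)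
  whisker_assoc f _ _ θ h := by
    funext i; ext x
    exact (by simp : (h i).map ((θ i).app ((f i).obj x)) =
      𝟙 _ ≫ (h i).map ((θ i).app ((f i).obj x)) ≫ 𝟙 _)
  whisker_exchange θ κ := by funext i; ext x; exact (κ i).naturality _ |>.symm
  pentagon f g h k := by
    funext i; ext x
    exact (by simp : (k i).map (𝟙 ((h i).obj ((g i).obj ((f i).obj x)))) ≫ 𝟙 _ ≫ 𝟙 _ = 𝟙 _ ≫ 𝟙 _)
  triangle f g := by
    funext i; ext x
    exact (by simp : 𝟙 _ ≫ 𝟙 _ = (g i).map (𝟙 ((f i).obj x)))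

instance : Bicategory.Strict (CatOver I) where
  id_comp _ := rfl
  comp_id _ := rfl
  assoc _ _ _ := rfl
  leftUnitor_eqToIso _ := rfl
  rightUnitor_eqToIso _ := rfl
  associator_eqToIso _ _ _ := rfl


end CatOver

section arrows

universe v₁ v₂ u₁ u₂

variable {C : Type u₁} [Category.{v₁} C] {D : Type u₂} [Category.{v₂} D]

lemma arrow_mk_map_congr (F : C ⥤ D) {x y x' y' : C} {f : x ⟶ y} {g : x' ⟶ y'}
    (h : Arrow.mk f = Arrow.mk g) : Arrow.mk (F.map f) = Arrow.mk (F.map g) :=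
  congrArg F.mapArrow.obj h

lemma arrow_mk_comp_congr {x y z x' y' z' : C} {f : x ⟶ y} {g : y ⟶ z} {f' : x' ⟶ y'}
    {g' : y' ⟶ z'} (h : Arrow.mk f = Arrow.mk f') (h' : Arrow.mk g = Arrow.mk g') :
    Arrow.mk (f ≫ g) = Arrow.mk (f' ≫ g') := by
  obtain ⟨h₁, h₂, rfl⟩ := (Arrow.mk_eq_mk_iff _ _).1 h
  obtain ⟨h₃, h₄, rfl⟩ := (Arrow.mk_eq_mk_iff _ _).1 h'
  subst h₁ h₂ h₄
  simp

lemma arrow_mk_inj {x y : C} {f g : x ⟶ y} (h : Arrow.mk f = Arrow.mk g) : f = g := by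
  obtain ⟨h₁, h₂, h₃⟩ := (Arrow.mk_eq_mk_iff _ _).1 h
  simpa using h₃

/-- A morphism which is an identity (up to a propositional equality between its source and its
target). -/
def IsId {x y : C} (f : x ⟶ y) : Prop := ∃ h : x = y, f = eqToHom h

lemma isId_refl (x : C) : IsId (𝟙 x) := ⟨rfl, rfl⟩

lemma IsId.map {x y : C} {f : x ⟶ y} (hf : IsId f) (F : C ⥤ D) : IsId (F.map f) := by
  obtain ⟨rfl, rfl⟩ := hf
  exact ⟨rfl, F.map_id x⟩

lemma IsId.comp {x y z : C} {f : x ⟶ y} {g : y ⟶ z} (hf : IsId f) (hg : IsId g) :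
    IsId (f ≫ g) := by
  obtain ⟨rfl, rfl⟩ := hf
  obtain ⟨rfl, rfl⟩ := hg
  exact ⟨rfl, Category.id_comp _⟩

lemma isId_eqToHom {x y : C} (h : x = y) : IsId (eqToHom h) := ⟨h, rfl⟩

lemma IsId.congr {x y x' y' : C} {f : x ⟶ y} {g : x' ⟶ y'} (hf : IsId f)
    (h : Arrow.mk f = Arrow.mk g) : IsId g := by
  obtain ⟨h₁, h₂, rfl⟩ := (Arrow.mk_eq_mk_iff _ _).1 h
  subst h₁ h₂
  simpa using hf

lemma IsId.eq {x y : C} {f g : x ⟶ y} (hf : IsId f) (hg : IsId g) : f = g := by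
  obtain ⟨rfl, rfl⟩ := hf
  obtain ⟨_, rfl⟩ := hg
  rfl

lemma IsId.arrow_comp {x y z : C} {f : x ⟶ y} (hf : IsId f) (g : y ⟶ z) :
    Arrow.mk (f ≫ g) = Arrow.mk g := by
  obtain ⟨rfl, rfl⟩ := hf
  simp

lemma IsId.arrow_comp' {x y z : C} {g : y ⟶ z} (hg : IsId g) (f : x ⟶ y) :
    Arrow.mk (f ≫ g) = Arrow.mk f := by
  obtain ⟨rfl, rfl⟩ := hg
  simp

lemma IsId.arrow_eq {x y x' y' : C} {f : x ⟶ y} {g : x' ⟶ y'} (hf : IsId f) (hg : IsId g)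
    (h : x = x') : Arrow.mk f = Arrow.mk g := by
  obtain ⟨rfl, rfl⟩ := hf
  obtain ⟨rfl, rfl⟩ := hg
  subst h
  rfl

end arrows

/-! ## Operads -/

/-- Decoding of a position in a concatenation of sequences of lengths `m 0, …, m (n-1)`: the
position `l` is the `k`-th position of the `j`-th sequence, where `⟨j, k⟩ = dec l`. -/
abbrev dec {n : ℕ} {m : Fin n → ℕ} (l : Fin (∑ j, m j)) : Σ j, Fin (m j) :=
  finSigmaFinEquiv.symm l

/-- Concatenation of sequences. -/
def concat {n : ℕ} {m : Fin n → ℕ} {X : Type u} (t : ∀ j, Fin (m j) → X) : Fin (∑ j, m j) → X :=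
  fun l => t (dec l).1 (dec l).2

/-- The block permutation `ρ(τ_j)_j`: it permutes the blocks using `ρ` and maps the `j`-th block to
the `ρ j`-th block using `τ_j`. -/
def blockPerm {n n' : ℕ} {m : Fin n → ℕ} {m' : Fin n' → ℕ} (ρ : Fin n ≃ Fin n')
    (τ : ∀ j, Fin (m j) ≃ Fin (m' (ρ j))) : Fin (∑ j, m j) ≃ Fin (∑ j, m' j) :=
  finSigmaFinEquiv.symm.trans ((Equiv.sigmaCongr ρ τ).trans finSigmaFinEquiv)

/-- A collection with set of objects (colours) `I`: arrows `α : (s_j)_j → i`, and arrows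
`αρ : (s_{ρ j})_j → i` for permutations `ρ`, functorially.  Permutations are bijections
`ρ : Fin m ≃ Fin n`; such a `ρ` exists only when `m = n`, so that this amounts to actions of the
symmetric groups `Σ_n`. -/
structure Collection (I : Type u) where
  Arr : ∀ {n : ℕ}, (Fin n → I) → I → Type u
  act : ∀ {m n : ℕ} {s : Fin n → I} {i : I}, Arr s i → ∀ ρ : Fin m ≃ Fin n,
    Arr (fun j => s (ρ j)) i
  act_refl : ∀ {n : ℕ} {s : Fin n → I} {i : I} (α : Arr s i), act α (Equiv.refl _) = α
  act_act : ∀ {l m n : ℕ} {s : Fin n → I} {i : I} (α : Arr s i) (ρ₁ : Fin m ≃ Fin n)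
    (ρ₂ : Fin l ≃ Fin m), act (act α ρ₁) ρ₂ = act α (ρ₂.trans ρ₁)

/-- An arrow of the collection `T` with target `i` and arbitrary source. -/
@[ext]
structure Collection.Op {I : Type u} (T : Collection I) (i : I) where
  n : ℕ
  src : Fin n → I
  arr : T.Arr src i

/-- The arrow `αρ`. -/
def Collection.Op.act {I : Type u} {T : Collection I} {i : I} (a : T.Op i) {m : ℕ}
    (ρ : Fin m ≃ Fin a.n) : T.Op i :=
  ⟨m, fun j => a.src (ρ j), T.act a.arr ρ⟩

/-- A (symmetric, coloured) operad with set of objects `I`.  The axioms are equations between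
arrows with the same target, including the equality of the sources. -/
structure Operad (I : Type u) extends Collection I where
  one : ∀ i : I, Arr (fun _ : Fin 1 => i) i
  comp : ∀ {n : ℕ} {s : Fin n → I} {i : I} (_ : Arr s i) {m : Fin n → ℕ}
    {t : ∀ j, Fin (m j) → I} (_ : ∀ j, Arr (t j) (s j)), Arr (concat t) i
  one_comp : ∀ {n : ℕ} {s : Fin n → I} {i : I} (α : Arr s i),
    (⟨_, _, comp (one i) (fun _ => α)⟩ : toCollection.Op i) = ⟨_, _, α⟩
  comp_one : ∀ {n : ℕ} {s : Fin n → I} {i : I} (α : Arr s i),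
    (⟨_, _, comp α (fun j => one (s j))⟩ : toCollection.Op i) = ⟨_, _, α⟩
  comp_comp : ∀ {n : ℕ} {s : Fin n → I} {i : I} (α : Arr s i) {m : Fin n → ℕ}
    {t : ∀ j, Fin (m j) → I} (β : ∀ j, Arr (t j) (s j)) {p : ∀ j, Fin (m j) → ℕ}
    {r : ∀ j k, Fin (p j k) → I} (γ : ∀ j k, Arr (r j k) (t j k)),
    (⟨_, _, comp α (fun j => comp (β j) (γ j))⟩ : toCollection.Op i) =
      ⟨_, _, comp (comp α β) (fun l => γ (dec l).1 (dec l).2)⟩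
  comp_act : ∀ {n n' : ℕ} {s : Fin n → I} {i : I} (α : Arr s i) {m : Fin n → ℕ}
    {t : ∀ j, Fin (m j) → I} (β : ∀ j, Arr (t j) (s j)) (ρ : Fin n' ≃ Fin n) {m' : Fin n' → ℕ}
    (τ : ∀ j, Fin (m' j) ≃ Fin (m (ρ j))),
    (⟨_, _, comp (act α ρ) (fun j => act (β (ρ j)) (τ j))⟩ : toCollection.Op i) =
      (⟨_, _, comp α β⟩ : toCollection.Op i).act (blockPerm ρ τ)

section index

lemma enc_lt {n : ℕ} {m : Fin n → ℕ} {a b : Σ j, Fin (m j)}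
    (h : a.1 < b.1 ∨ ∃ _ : a.1 = b.1, (a.2 : ℕ) < b.2) :
    finSigmaFinEquiv a < finSigmaFinEquiv b := by
  rw [Fin.lt_def, finSigmaFinEquiv_apply, finSigmaFinEquiv_apply]
  obtain ⟨j, k⟩ := a
  obtain ⟨j', k'⟩ := b
  rcases h with h | ⟨h, h'⟩
  · dsimp only at h ⊢
    have h1 : ∑ i : Fin j, m (Fin.castLE j.2.le i) + m j ≤
        ∑ i : Fin j', m (Fin.castLE j'.2.le i) := by
      have e1 : ∀ (q : ℕ) (hq : q ≤ n), ∑ i : Fin q, m (Fin.castLE hq i) =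
          ∑ i ∈ Finset.range q, (if hi : i < n then m ⟨i, hi⟩ else 0) := by
        intro q hq
        rw [← Fin.sum_univ_eq_sum_range]
        refine Finset.sum_congr rfl fun i _ => ?_
        have : (i : ℕ) < n := lt_of_lt_of_le i.2 hq
        simp [this, Fin.castLE]
      rw [e1, e1]
      have : m j = (if hi : (j : ℕ) < n then m ⟨j, hi⟩ else 0) := by simp
      rw [this, ← Finset.sum_range_succ]
      exact Finset.sum_le_sum_of_subset (Finset.range_mono h)
    have := k.2
    omega
  · dsimp only at h h' ⊢
    subst h
    omega

lemma dec_lt {n : ℕ} {m : Fin n → ℕ} {a b : Fin (∑ j, m j)} (hab : a < b) :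
    (dec a).1 < (dec b).1 ∨ ∃ _ : (dec a).1 = (dec b).1, ((dec a).2 : ℕ) < (dec b).2 := by
  by_contra hcon
  have h2 : dec a = dec b ∨ ((dec b).1 < (dec a).1 ∨
      ∃ _ : (dec b).1 = (dec a).1, ((dec b).2 : ℕ) < (dec a).2) := by
    revert hcon
    generalize dec a = a'
    generalize dec b = b'
    obtain ⟨j, k⟩ := a'
    obtain ⟨j', k'⟩ := b'
    intro hcon
    rcases lt_trichotomy j j' with h | h | h
    · exact absurd (Or.inl h) hcon
    · subst h
      rcases lt_trichotomy k k' with h | h | h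
      · exact absurd (Or.inr ⟨rfl, h⟩) hcon
      · subst h; exact Or.inl rfl
      · exact Or.inr (Or.inr ⟨rfl, h⟩)
    · exact Or.inr (Or.inl h)
  rcases h2 with h | h
  · exact absurd (finSigmaFinEquiv.symm.injective h) hab.ne
  · have := enc_lt h
    simp only [dec, Equiv.apply_symm_apply] at this
    exact absurd hab this.asymm

lemma sum_assoc {n : ℕ} {m : Fin n → ℕ} (p : ∀ j, Fin (m j) → ℕ) :
    ∑ j, ∑ k, p j k = ∑ i : Fin (∑ j, m j), p (dec i).1 (dec i).2 := by
  rw [← Fintype.sum_equiv finSigmaFinEquiv.symm.symm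
    (fun x : Σ j, Fin (m j) => p x.1 x.2) (fun i => p (dec i).1 (dec i).2)]
  · rw [Fintype.sum_sigma]
  · intro x
    have : dec (finSigmaFinEquiv x) = x := finSigmaFinEquiv.symm_apply_apply x
    dsimp only [Equiv.symm_symm]
    rw [this]

/-- Concatenation of positions is associative. -/
lemma dec_assoc {n : ℕ} {m : Fin n → ℕ} {p : ∀ j, Fin (m j) → ℕ}
    (l : Fin (∑ j, ∑ k, p j k)) (l' : Fin (∑ i : Fin (∑ j, m j), p (dec i).1 (dec i).2))
    (h : (l : ℕ) = l') :
    (⟨⟨(dec l).1, (dec (dec l).2).1⟩, (dec (dec l).2).2⟩ :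
      Σ q : (Σ j, Fin (m j)), Fin (p q.1 q.2)) = ⟨dec (dec l').1, (dec l').2⟩ := by
  have hN := sum_assoc p
  let G : Fin (∑ i : Fin (∑ j, m j), p (dec i).1 (dec i).2) → Fin (∑ j, ∑ k, p j k) := fun x =>
    finSigmaFinEquiv (n := fun j => ∑ k, p j k)
      ⟨(dec (dec x).1).1, finSigmaFinEquiv ⟨(dec (dec x).1).2, (dec x).2⟩⟩
  have hG : StrictMono G := by
    intro a b hab
    apply enc_lt
    rcases dec_lt hab with h1 | ⟨h1, h2⟩
    · rcases dec_lt h1 with h3 | ⟨h3, h4⟩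
      · exact Or.inl h3
      · refine Or.inr ⟨h3, ?_⟩
        revert h3 h4
        generalize dec b = b
        generalize dec a = a
        obtain ⟨a, ka⟩ := a
        obtain ⟨b, kb⟩ := b
        dsimp only
        revert ka kb
        suffices ∀ (a b : Σ j, Fin (m j)) (ka : Fin (p a.1 a.2)) (kb : Fin (p b.1 b.2)),
            a.1 = b.1 → (a.2 : ℕ) < b.2 →
            (finSigmaFinEquiv ⟨a.2, ka⟩ : ℕ) < finSigmaFinEquiv ⟨b.2, kb⟩ from this _ _
        rintro ⟨a, la⟩ ⟨b, lb⟩ ka kb h3 h4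
        dsimp only at h3
        subst h3
        exact Fin.lt_def.1 (enc_lt (Or.inl h4))
    · refine Or.inr ?_
      revert h1 h2
      generalize dec b = b
      generalize dec a = a
      obtain ⟨a, ka⟩ := a
      obtain ⟨b, kb⟩ := b
      intro h1
      dsimp only at h1
      subst h1
      intro h2
      exact ⟨rfl, Fin.lt_def.1 (enc_lt (Or.inr ⟨rfl, h2⟩))⟩
  have hcast : StrictMono (Fin.cast hN.symm) := fun a b hab => hab
  have key : G = Fin.cast hN.symm := by
    refine (StrictMono.range_inj hG hcast).1 ?_
    rw [Set.range_eq_univ.2, Set.range_eq_univ.2]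
    · intro x
      exact ⟨Fin.cast hN x, by ext; rfl⟩
    · have hb : Function.Bijective G := by
        rw [Fintype.bijective_iff_injective_and_card]
        exact ⟨hG.injective, by simp [hN]⟩
      exact hb.2
  have hl : l = G l' := by rw [key]; ext; exact h
  have h1 : dec l = ⟨(dec (dec l').1).1, finSigmaFinEquiv ⟨(dec (dec l').1).2, (dec l').2⟩⟩ := by
    rw [hl]; exact finSigmaFinEquiv.symm_apply_apply _
  rw [h1]
  dsimp only [dec]
  rw [finSigmaFinEquiv.symm_apply_apply]

lemma dec_assoc_inj {n : ℕ} {m : Fin n → ℕ} {p : ∀ j, Fin (m j) → ℕ}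
    (l : Fin (∑ j, ∑ k, p j k)) (l' : Fin (∑ i : Fin (∑ j, m j), p (dec i).1 (dec i).2))
    (h : (⟨⟨(dec l).1, (dec (dec l).2).1⟩, (dec (dec l).2).2⟩ :
      Σ q : (Σ j, Fin (m j)), Fin (p q.1 q.2)) = ⟨dec (dec l').1, (dec l').2⟩) :
    (l : ℕ) = l' := by
  have h1 := (dec_assoc l (Fin.cast (sum_assoc p) l) rfl).symm.trans h
  have h2 : dec (Fin.cast (sum_assoc p) l) = dec l' := by
    obtain ⟨h3, h4⟩ := Sigma.mk.inj h1
    exact Sigma.ext (finSigmaFinEquiv.symm.injective h3) h4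
  have h5 := finSigmaFinEquiv.symm.injective h2
  rw [← h5]
  rfl

lemma dec_one {m : Fin 1 → ℕ} (l : Fin (∑ j, m j)) : ((dec l).2 : ℕ) = l := by
  conv_rhs => rw [← finSigmaFinEquiv.apply_symm_apply l]
  rw [finSigmaFinEquiv_one]

lemma dec_ones {n : ℕ} (l : Fin (∑ _j : Fin n, 1)) : ((dec l).1 : ℕ) = l := by
  conv_rhs => rw [← finSigmaFinEquiv.apply_symm_apply l]
  rw [finSigmaFinEquiv_apply]
  have : ((dec l).2 : ℕ) = 0 := by omega
  simp [dec] at this ⊢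

end index

section operads

/-! ## Labelled operations and the 2-monad of an operad -/

variable {I : Type u}

/-- An operation `(α, (x_j)_j)` of `T` labelled in `X`, with target `i`. -/
structure LOp (T : Collection I) (X : CatOver I) (i : I) where
  op : T.Op i
  lab : ∀ j : Fin op.n, X.fib (op.src j)

lemma Collection.Op.act_trans {T : Collection I} {i : I} {n : ℕ} {s : Fin n → I}
    {β : T.Arr s i} {c : T.Op i} (q : Fin n ≃ Fin c.n) (e : (⟨n, s, β⟩ : T.Op i) = c.act q)
    {m : ℕ} (p : Fin m ≃ Fin n) : (⟨n, s, β⟩ : T.Op i).act p = c.act (p.trans q) := by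
  obtain ⟨-, h₁, h₂⟩ := Collection.Op.mk.inj e
  obtain rfl := eq_of_heq h₁
  obtain rfl := eq_of_heq h₂
  exact congrArg (Collection.Op.mk _ _) (T.act_act c.arr q p)

namespace LOp

variable {T : Collection I} {X Y Z : CatOver I} {i : I}

/-- The `j`-th label, as an object of the total category of `X`. -/
abbrev pt (A : LOp T X i) (j : Fin A.op.n) : Σ i, X.fib i := ⟨A.op.src j, A.lab j⟩

/-- A morphism `(α, x) ⟶ (β, y)`: a permutation `ρ` with `α = βρ` and morphisms
`x_j ⟶ y_{ρ j}` of `X` over `I`. -/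
structure Hom (A B : LOp T X i) where
  perm : Fin A.op.n ≃ Fin B.op.n
  op_eq : A.op = B.op.act perm
  map : ∀ j, A.pt j ⟶ B.pt (perm j)

lemma Hom.ext' {A B : LOp T X i} {f g : Hom A B} (h : ∀ j, f.perm j = g.perm j)
    (h' : ∀ j, Arrow.mk (f.map j) = Arrow.mk (g.map j)) : f = g := by
  obtain ⟨p, e, m⟩ := f
  obtain ⟨p', e', m'⟩ := g
  obtain rfl : p = p' := Equiv.ext h
  congr 1
  funext j
  exact arrow_mk_inj (h' j)

instance : SmallCategory (LOp T X i) where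
  Hom := Hom
  id A := ⟨Equiv.refl _, by
    obtain ⟨⟨n, s, α⟩, x⟩ := A
    exact congrArg (Collection.Op.mk n s) (T.act_refl α).symm, fun j => 𝟙 (A.pt j)⟩
  comp {A B C} f g := ⟨f.perm.trans g.perm,
    f.op_eq.trans (Collection.Op.act_trans g.perm g.op_eq f.perm),
    fun j => f.map j ≫ g.map (f.perm j)⟩
  id_comp f := Hom.ext' (fun _ => rfl) fun j => congrArg Arrow.mk (Category.id_comp (f.map j))
  comp_id f := Hom.ext' (fun _ => rfl) fun j => congrArg Arrow.mk (Category.comp_id (f.map j))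
  assoc f g h := Hom.ext' (fun _ => rfl) fun j => congrArg Arrow.mk (Category.assoc _ _ _)

@[simp] lemma id_perm (A : LOp T X i) : (𝟙 A : A ⟶ A).perm = Equiv.refl _ := rfl
@[simp] lemma id_map (A : LOp T X i) (j) : (𝟙 A : A ⟶ A).map j = 𝟙 (A.pt j) := rfl
@[simp] lemma comp_perm {A B C : LOp T X i} (f : A ⟶ B) (g : B ⟶ C) :
    (f ≫ g).perm = f.perm.trans g.perm := rfl
@[simp] lemma comp_map {A B C : LOp T X i} (f : A ⟶ B) (g : B ⟶ C) (j) :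
    (f ≫ g).map j = f.map j ≫ g.map (f.perm j) := rfl

lemma ext' {A B : LOp T X i} (h : A.op = B.op)
    (h' : ∀ (j : Fin A.op.n) (j' : Fin B.op.n), (j : ℕ) = j' → A.pt j = B.pt j') : A = B := by
  obtain ⟨a, x⟩ := A
  obtain ⟨b, y⟩ := B
  dsimp only at h
  subst h
  congr 1
  funext j
  exact eq_of_heq (Sigma.mk.inj (h' j j rfl)).2

lemma arrow_ext {A B A' B' : LOp T X i} (f : A ⟶ B) (g : A' ⟶ B') (hA : A = A') (hB : B = B')
    (hp : ∀ (j : Fin A.op.n) (j' : Fin A'.op.n), (j : ℕ) = j' → (f.perm j : ℕ) = g.perm j')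
    (hm : ∀ (j : Fin A.op.n) (j' : Fin A'.op.n), (j : ℕ) = j' → Arrow.mk (f.map j) = Arrow.mk (g.map j')) :
    Arrow.mk f = Arrow.mk g := by
  subst hA hB
  congr 1
  exact Hom.ext' (fun j => Fin.ext (hp j j rfl)) fun j => hm j j rfl

/-- A morphism of labelled operations is permutative when all its label morphisms are
identities. -/
def permutative (T : Collection I) (X : CatOver I) (i : I) : MorphismProperty (LOp T X i) :=
  fun _ _ f => ∀ j, IsId (f.map j)

/-- A morphism in the total category of `TX`, decomposed. -/
def sperm : ∀ {a b : Σ i, LOp T X i}, (a ⟶ b) → (Fin a.2.op.n ≃ Fin b.2.op.n)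
  | _, _, .mk f => f.perm

/-- The label morphisms of a morphism in the total category of `TX`. -/
def smap : ∀ {a b : Σ i, LOp T X i} (f : a ⟶ b) (k : Fin a.2.op.n),
    (a.2.pt k ⟶ b.2.pt (sperm f k))
  | _, _, .mk f => f.map

lemma sop : ∀ {a b : Σ i, LOp T X i} (f : a ⟶ b),
    (⟨a.1, a.2.op⟩ : Σ i, T.Op i) = ⟨b.1, b.2.op.act (sperm f)⟩
  | _, _, .mk f => congrArg (Sigma.mk _) f.op_eq

lemma sperm_id (a : Σ i, LOp T X i) (k) : sperm (𝟙 a) k = k := rfl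

lemma smap_id (a : Σ i, LOp T X i) (k) : smap (𝟙 a) k = 𝟙 _ := rfl

lemma sperm_comp : ∀ {a b c : Σ i, LOp T X i} (f : a ⟶ b) (g : b ⟶ c) (k),
    sperm (f ≫ g) k = sperm g (sperm f k)
  | _, _, _, .mk _, .mk _, _ => rfl

lemma smap_comp : ∀ {a b c : Σ i, LOp T X i} (f : a ⟶ b) (g : b ⟶ c) (k),
    Arrow.mk (smap (f ≫ g) k) = Arrow.mk (smap f k ≫ smap g (sperm f k))
  | _, _, _, .mk _, .mk _, _ => rfl

end LOp

/-- The functor between total categories induced by a 1-cell over `I`. -/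
abbrev tot {X Y : CatOver I} (f : X ⟶ Y) : (Σ i, X.fib i) ⥤ Σ i, Y.fib i :=
  Sigma.Functor.sigma f

lemma tot_id (X : CatOver I) : tot (𝟙 X) = 𝟭 _ := by
  refine Arrow.functor_ext ?_
  rintro ⟨i, x⟩ ⟨_, y⟩ ⟨f⟩
  rfl

lemma tot_comp {X Y Z : CatOver I} (f : X ⟶ Y) (g : Y ⟶ Z) : tot (f ≫ g) = tot f ⋙ tot g := by
  refine Arrow.functor_ext ?_
  rintro ⟨i, x⟩ ⟨_, y⟩ ⟨h⟩
  rfl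

namespace Collection

variable (T : Collection I)

/-- The category over `I` of operations of `T` labelled in `X`. -/
abbrev obj (X : CatOver I) : CatOver I where
  fib := LOp T X

/-- `(Tf)(α, (x_j)_j) = (α, (f x_j)_j)`, and `(Tf)(ρ, (γ_j)_j) = (ρ, (f γ_j)_j)`. -/
def map {X Y : CatOver I} (f : X ⟶ Y) : T.obj X ⟶ T.obj Y := fun _ =>
  { obj := fun A => ⟨A.op, fun j => (f _).obj (A.lab j)⟩
    map := fun g => ⟨g.perm, g.op_eq, fun j => (tot f).map (g.map j)⟩
    map_id := fun A => LOp.Hom.ext' (fun _ => rfl) fun j =>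
      congrArg Arrow.mk ((tot f).map_id (A.pt j))
    map_comp := fun _ _ => LOp.Hom.ext' (fun _ => rfl) fun _ =>
      congrArg Arrow.mk ((tot f).map_comp _ _) }

/-- The component of `Tθ` at `(α, (x_j)_j)` is `(1, (θ_{x_j})_j)`. -/
def map₂ {X Y : CatOver I} {f g : X ⟶ Y} (θ : f ⟶ g) : T.map f ⟶ T.map g := fun _ =>
  { app := fun A => ⟨Equiv.refl _, by
      obtain ⟨⟨n, s, α⟩, x⟩ := A
      exact congrArg (Collection.Op.mk n s) (T.act_refl α).symm,
      fun j => Sigma.SigmaHom.mk ((θ _).app (A.lab j))⟩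
    naturality := fun A B h => LOp.Hom.ext' (fun _ => rfl) fun j =>
      congrArg Arrow.mk ((Sigma.natTrans.sigma θ).naturality (h.map j)) }

end Collection

namespace Operad

variable (T : Operad I)

/-- Composition, on arrows with arbitrary sources. -/
def opComp {i : I} (a : T.Op i) (b : ∀ j, T.Op (a.src j)) : T.Op i :=
  ⟨_, _, T.comp a.arr fun j => (b j).arr⟩

lemma opComp_act {i : I} (a : T.Op i) (b : ∀ j, T.Op (a.src j)) {n' : ℕ} (ρ : Fin n' ≃ Fin a.n)
    {m' : Fin n' → ℕ} (τ : ∀ j, Fin (m' j) ≃ Fin (b (ρ j)).n) :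
    T.opComp (a.act ρ) (fun j => (b (ρ j)).act (τ j)) =
      (T.opComp a b).act (blockPerm (m' := fun j => (b j).n) ρ τ) :=
  T.comp_act a.arr (fun j => (b j).arr) ρ τ

/-- The unit of the 2-monad: `x ↦ (1_i, (x))`. -/
def η (X : CatOver I) : X ⟶ T.obj X := fun i =>
  { obj := fun x => ⟨⟨1, fun _ => i, T.one i⟩, fun _ => x⟩
    map := fun f => ⟨Equiv.refl _, congrArg (Collection.Op.mk 1 _) (T.act_refl _).symm,
      fun _ => Sigma.SigmaHom.mk f⟩
    map_id := fun _ => rfl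
    map_comp := fun _ _ => rfl }

/-- The multiplication on objects: `(α, (α_j, (x_{jk})_k)_j) ↦ (α(α_j)_j, (x_{jk})_{jk})`. -/
def μObj {X : CatOver I} {i : I} (A : LOp T.toCollection (T.obj X) i) :
    LOp T.toCollection X i :=
  ⟨T.opComp A.op fun j => (A.lab j).op, fun l => (A.lab (dec l).1).lab (dec l).2⟩

lemma μ_op_eq_aux {X : CatOver I} {i : I} {n : ℕ} {s : Fin n → I} {α : T.Arr s i} {b : T.Op i}
    (ρ : Fin n ≃ Fin b.n) (e : (⟨n, s, α⟩ : T.Op i) = b.act ρ)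
    (x : ∀ j, (T.obj X).fib (s j)) (y : ∀ j, (T.obj X).fib (b.src j))
    (m : ∀ j, (⟨s j, x j⟩ : Σ i, (T.obj X).fib i) ⟶ ⟨b.src (ρ j), y (ρ j)⟩) :
    T.opComp (⟨n, s, α⟩ : T.Op i) (fun j => (x j).op) = (T.opComp b fun j => (y j).op).act
      (blockPerm (m := fun j => (x j).op.n) (m' := fun j => (y j).op.n) ρ
        fun j => LOp.sperm (m j)) := by
  obtain ⟨-, h₁, h₂⟩ := Collection.Op.mk.inj e
  obtain rfl := eq_of_heq h₁
  obtain rfl := eq_of_heq h₂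
  have key : ∀ j, (x j).op = (y (ρ j)).op.act (LOp.sperm (m j)) := fun j =>
    eq_of_heq (Sigma.mk.inj (LOp.sop (m j))).2
  rw [← T.opComp_act b (fun j => (y j).op) ρ (fun j => LOp.sperm (m j))]
  exact congrArg (T.opComp _) (funext key)

lemma μ_op_eq {X : CatOver I} {i : I} {A B : LOp T.toCollection (T.obj X) i} (f : A ⟶ B) :
    T.opComp A.op (fun j => (A.lab j).op) = (T.opComp B.op fun j => (B.lab j).op).act
      (blockPerm (m := fun j => (A.lab j).op.n) (m' := fun j => (B.lab j).op.n) f.perm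
        fun j => LOp.sperm (f.map j)) :=
  T.μ_op_eq_aux f.perm f.op_eq A.lab B.lab f.map

lemma dec_blockPerm {n n' : ℕ} {m : Fin n → ℕ} {m' : Fin n' → ℕ} (ρ : Fin n ≃ Fin n')
    (τ : ∀ j, Fin (m j) ≃ Fin (m' (ρ j))) (l : Fin (∑ j, m j)) :
    dec (blockPerm ρ τ l) = ⟨ρ (dec l).1, τ (dec l).1 (dec l).2⟩ :=
  finSigmaFinEquiv.symm_apply_apply _

/-- The multiplication on morphisms:
`(ρ, (ρ_j, (β_{jk})_k)_j) ↦ (ρ(ρ_j)_j, (β_{jk})_{jk})`. -/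
def μMap {X : CatOver I} {i : I} {A B : LOp T.toCollection (T.obj X) i} (f : A ⟶ B) :
    T.μObj A ⟶ T.μObj B :=
  ⟨_, T.μ_op_eq f, fun l => LOp.smap (f.map (dec l).1) (dec l).2 ≫ eqToHom
    (congrArg (fun p : Σ j, Fin (B.lab j).op.n => (B.lab p.1).pt p.2)
      (dec_blockPerm (m := fun j => (A.lab j).op.n) (m' := fun j => (B.lab j).op.n)
        f.perm (fun j => LOp.sperm (f.map j)) l).symm)⟩

lemma μMap_map {X : CatOver I} {i : I} {A B : LOp T.toCollection (T.obj X) i} (f : A ⟶ B)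
    (l : Fin (∑ j, (A.lab j).op.n)) :
    Arrow.mk ((T.μMap f).map l) = Arrow.mk (LOp.smap (f.map (dec l).1) (dec l).2) :=
  Arrow.arrow_mk_comp_eqToHom _ _

lemma dec_μMap_perm {X : CatOver I} {i : I} {A B : LOp T.toCollection (T.obj X) i} (f : A ⟶ B)
    (l : Fin (∑ j, (A.lab j).op.n)) :
    dec (m := fun j => (B.lab j).op.n) ((T.μMap f).perm l) =
      ⟨f.perm (dec l).1, LOp.sperm (f.map (dec l).1) (dec l).2⟩ :=
  dec_blockPerm (m := fun j => (A.lab j).op.n) (m' := fun j => (B.lab j).op.n) _ _ _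

lemma μMap_perm {X : CatOver I} {i : I} {A B : LOp T.toCollection (T.obj X) i} (f : A ⟶ B)
    (l : Fin (∑ j, (A.lab j).op.n)) :
    (T.μMap f).perm l = finSigmaFinEquiv (n := fun j => (B.lab j).op.n)
      ⟨f.perm (dec l).1, LOp.sperm (f.map (dec l).1) (dec l).2⟩ := by
  rw [← T.dec_μMap_perm f l]
  exact (finSigmaFinEquiv.apply_symm_apply _).symm

/-- The multiplication of the 2-monad. -/
def μ (X : CatOver I) : T.obj (T.obj X) ⟶ T.obj X := fun i =>
  { obj := fun A => T.μObj A
    map := fun f => T.μMap f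
    map_id := fun A => by
      refine LOp.Hom.ext' (fun l => ?_) fun l => ?_
      · exact (T.μMap_perm _ _).trans (finSigmaFinEquiv.apply_symm_apply l)
      · exact T.μMap_map (𝟙 A) l
    map_comp := fun {A B C} f g => by
      refine LOp.Hom.ext' (fun l => ?_) fun l => ?_
      · refine (T.μMap_perm _ _).trans (Eq.trans ?_ (T.μMap_perm g ((T.μMap f).perm l)).symm)
        refine congrArg finSigmaFinEquiv ?_
        refine Eq.trans ?_ (congrArg (fun p : Σ j, Fin (B.lab j).op.n =>
          (⟨g.perm p.1, LOp.sperm (g.map p.1) p.2⟩ : Σ j, Fin (C.lab j).op.n))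
            (T.dec_μMap_perm f l).symm)
        refine Sigma.ext rfl (heq_of_eq ?_)
        exact LOp.sperm_comp _ _ _
      · refine (T.μMap_map (f ≫ g) l).trans ?_
        refine (LOp.smap_comp _ _ _).trans ?_
        refine arrow_mk_comp_congr (T.μMap_map f l).symm ?_
        refine Eq.trans ?_ (T.μMap_map g ((T.μMap f).perm l)).symm
        exact congrArg (fun p : Σ j, Fin (B.lab j).op.n =>
          Arrow.mk (LOp.smap (g.map p.1) p.2)) (T.dec_μMap_perm f l).symm }

end Operad

namespace CatOver

lemma eqToHom_app {X Y : CatOver I} {f g : X ⟶ Y} (h : f = g) (i : I) (x : X.fib i) :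
    (eqToHom h i).app x = eqToHom (congrArg (fun k : X ⟶ Y => (k i).obj x) h) := by
  subst h; rfl

lemma arrow_map_of_eq {C D : Type u} [Category.{u} C] [Category.{u} D] {F G : C ⥤ D} (h : F = G)
    {x y : C} (f : x ⟶ y) : Arrow.mk (F.map f) = Arrow.mk (G.map f) := by
  subst h; rfl

lemma cell_ext {X Y : CatOver I} {f g f' g' : X ⟶ Y} {θ : f ⟶ g} {κ : f' ⟶ g'} (h : f = f')
    (h' : g' = g) (H : ∀ i x, Arrow.mk ((θ i).app x) = Arrow.mk ((κ i).app x)) :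
    θ = eqToHom h ≫ κ ≫ eqToHom h' := by
  subst h h'
  rw [eqToHom_refl, eqToHom_refl, Category.id_comp, Category.comp_id]
  funext i
  ext x
  exact arrow_mk_inj (H i x)

lemma one_cell_ext {X Y : CatOver I} {f g : X ⟶ Y}
    (H : ∀ i {x y : X.fib i} (k : x ⟶ y), Arrow.mk ((f i).map k) = Arrow.mk ((g i).map k)) :
    f = g := by
  funext i
  exact Arrow.functor_ext fun x y k => H i k

end CatOver

namespace LOp

variable {X Y : CatOver I}

lemma sperm_tot_map {T : Collection I} (f : X ⟶ Y) : ∀ {a b : Σ i, (T.obj X).fib i} (g : a ⟶ b),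
    sperm ((tot (T.map f)).map g) = sperm g
  | _, _, .mk _ => rfl

lemma smap_tot_map {T : Collection I} (f : X ⟶ Y) : ∀ {a b : Σ i, (T.obj X).fib i} (g : a ⟶ b) (k),
    Arrow.mk (smap ((tot (T.map f)).map g) k) = Arrow.mk ((tot f).map (smap g k))
  | _, _, .mk _, _ => rfl

lemma dec_sperm_tot_μ (T : Operad I) : ∀ {a b : Σ i, (T.obj (T.obj X)).fib i} (g : a ⟶ b)
    (q : Fin (∑ k, (a.2.lab k).op.n)),
    dec (m := fun k => (b.2.lab k).op.n) (sperm ((tot (T.μ X)).map g) q) =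
      ⟨sperm g (dec q).1, sperm (smap g (dec q).1) (dec q).2⟩
  | _, _, .mk g, q => T.dec_μMap_perm g q

lemma smap_tot_μ (T : Operad I) : ∀ {a b : Σ i, (T.obj (T.obj X)).fib i} (g : a ⟶ b)
    (q : Fin (∑ k, (a.2.lab k).op.n)),
    Arrow.mk (smap ((tot (T.μ X)).map g) q) = Arrow.mk (smap (smap g (dec q).1) (dec q).2)
  | _, _, .mk g, q => T.μMap_map g q

lemma fin_sigma_ext {α : Type*} {m : α → ℕ} {a b : Σ x, Fin (m x)} (h : a.1 = b.1)
    (h' : (a.2 : ℕ) = b.2) : a = b := by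
  obtain ⟨a, k⟩ := a
  obtain ⟨b, k'⟩ := b
  dsimp only at h
  subst h
  exact congrArg _ (Fin.ext h')

lemma smap_arrow {T : Collection I} {a b a' b' : Σ i, LOp T X i} {g : a ⟶ b} {g' : a' ⟶ b'}
    (h : Arrow.mk g = Arrow.mk g') {r : Fin a.2.op.n} {r' : Fin a'.2.op.n} (hr : (r : ℕ) = r') :
    (sperm g r : ℕ) = sperm g' r' ∧ Arrow.mk (smap g r) = Arrow.mk (smap g' r') := by
  obtain ⟨h₁, h₂, h₃⟩ := (Arrow.mk_eq_mk_iff _ _).1 h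
  subst h₁ h₂
  obtain rfl : g = g' := by simpa using h₃
  obtain rfl := Fin.ext hr
  exact ⟨rfl, rfl⟩

end LOp

namespace Operad

variable (T : Operad I)

/-- The 2-monad on categories over `I` associated to an operad `T` with set of objects `I`. -/
def twoMonad : TwoMonad (CatOver I) where
  obj := T.obj
  map := T.map
  map₂ := T.map₂
  map_id X := CatOver.one_cell_ext fun i A B f => LOp.arrow_ext _ _ rfl rfl
    (fun j j' h => by obtain rfl := Fin.ext h; rfl)
    (fun j j' h => by
      obtain rfl := Fin.ext h
      exact CatOver.arrow_map_of_eq (tot_id X) (f.map j))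
  map_comp f g := CatOver.one_cell_ext fun i A B k => LOp.arrow_ext _ _ rfl rfl
    (fun j j' h => by obtain rfl := Fin.ext h; rfl)
    (fun j j' h => by
      obtain rfl := Fin.ext h
      exact CatOver.arrow_map_of_eq (tot_comp f g) (k.map j))
  map₂_id f := by
    funext i
    ext A
    exact LOp.Hom.ext' (fun _ => rfl) fun _ => rfl
  map₂_comp θ κ := by
    funext i
    ext A
    exact LOp.Hom.ext' (fun _ => rfl) fun _ => rfl
  map₂_whiskerLeft f _ _ θ := CatOver.cell_ext _ _ fun i A => rfl
  map₂_whiskerRight θ h := CatOver.cell_ext _ _ fun i A => rfl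
  η := T.η
  μ := T.μ
  η_nat f := CatOver.one_cell_ext fun i x y k => rfl
  η_nat₂ θ := CatOver.cell_ext _ _ fun i x => rfl
  μ_nat {X Y} f := CatOver.one_cell_ext fun i A B k => LOp.arrow_ext _ _ rfl rfl
    (fun j j' h => by
      obtain rfl := Fin.ext h
      refine congrArg Fin.val ((T.μMap_perm (((T.map (T.map f)) i).map k) j).trans
        (Eq.trans ?_ (T.μMap_perm k j).symm))
      refine congrArg finSigmaFinEquiv (Sigma.ext rfl (heq_of_eq ?_))
      exact congrArg (fun e => e (dec j).2) (LOp.sperm_tot_map f (k.map (dec j).1)))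
    (fun j j' h => by
      obtain rfl := Fin.ext h
      refine (T.μMap_map (((T.map (T.map f)) i).map k) j).trans ?_
      refine (LOp.smap_tot_map f (k.map (dec j).1) (dec j).2).trans ?_
      exact arrow_mk_map_congr (tot f) (T.μMap_map k j).symm)
  μ_nat₂ {X Y f g} θ := CatOver.cell_ext _ _ fun i A => LOp.arrow_ext _ _ rfl rfl
    (fun j j' h => by
      obtain rfl := Fin.ext h
      refine congrArg Fin.val ((T.μMap_perm (((T.map₂ (T.map₂ θ)) i).app A) j).trans ?_)
      exact finSigmaFinEquiv.apply_symm_apply j)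
    (fun j j' h => by
      obtain rfl := Fin.ext h
      exact T.μMap_map (((T.map₂ (T.map₂ θ)) i).app A) j)
  left_unit X := by
    have ho : ∀ i (A : (T.obj X).fib i), T.μObj ((T.η (T.obj X) i).obj A) = A := fun i A =>
      LOp.ext' (T.one_comp A.op.arr) fun j j' h => by
        have : (dec (m := fun _ : Fin 1 => A.op.n) j).2 = j' := Fin.ext ((dec_one (m := fun _ => A.op.n) j).trans h)
        exact congrArg A.pt this
    refine CatOver.one_cell_ext fun i A B f => LOp.arrow_ext _ _ (ho i A) (ho i B)
      (fun j j' h => ?_) fun j j' h => ?_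
    · have hj : (dec (m := fun _ : Fin 1 => A.op.n) j).2 = j' := Fin.ext ((dec_one (m := fun _ => A.op.n) j).trans h)
      refine (congrArg Fin.val (T.μMap_perm ((T.η (T.obj X) i).map f) j)).trans ?_
      refine (finSigmaFinEquiv_one _).trans ?_
      exact congrArg (fun k => (f.perm k : ℕ)) hj
    · have hj : (dec (m := fun _ : Fin 1 => A.op.n) j).2 = j' := Fin.ext ((dec_one (m := fun _ => A.op.n) j).trans h)
      refine (T.μMap_map ((T.η (T.obj X) i).map f) j).trans ?_
      exact congrArg (fun k => Arrow.mk (f.map k)) hj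
  right_unit X := by
    have ho : ∀ i (A : (T.obj X).fib i), T.μObj ((T.map (T.η X) i).obj A) = A := fun i A =>
      LOp.ext' (T.comp_one A.op.arr) fun j j' h => by
        have : (dec j).1 = j' := Fin.ext ((dec_ones j).trans h)
        exact congrArg A.pt this
    have key : ∀ {a b : Σ i, X.fib i} (g : a ⟶ b) (k),
        Arrow.mk (LOp.smap ((tot (T.η X)).map g) k) = Arrow.mk g := by
      rintro _ _ ⟨g⟩ k
      rfl
    refine CatOver.one_cell_ext fun i A B f => LOp.arrow_ext _ _ (ho i A) (ho i B)
      (fun j j' h => ?_) fun j j' h => ?_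
    · have hj : (dec j).1 = j' := Fin.ext ((dec_ones j).trans h)
      rw [← hj]
      have h1 := T.dec_μMap_perm ((T.map (T.η X) i).map f) j
      exact (dec_ones _).symm.trans (congrArg (fun p => (p.1 : ℕ)) h1)
    · have hj : (dec j).1 = j' := Fin.ext ((dec_ones j).trans h)
      refine (T.μMap_map ((T.map (T.η X) i).map f) j).trans ?_
      refine (key (f.map (dec j).1) (dec j).2).trans ?_
      exact congrArg (fun k => Arrow.mk (f.map k)) hj
  assoc X := by
    have ho : ∀ i (A : (T.obj (T.obj (T.obj X))).fib i),
        T.μObj ((T.map (T.μ X) i).obj A) = T.μObj (T.μObj A) := fun i A =>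
      LOp.ext' (T.comp_comp A.op.arr (fun j => (A.lab j).op.arr)
          fun j k => ((A.lab j).lab k).op.arr) fun j j' h =>
        congrArg (fun q : Σ q : (Σ j, Fin (A.lab j).op.n), Fin ((A.lab q.1).lab q.2).op.n =>
          ((A.lab q.1.1).lab q.1.2).pt q.2)
          (dec_assoc (p := fun j k => ((A.lab j).lab k).op.n) j j' h)
    refine CatOver.one_cell_ext fun i A B f => LOp.arrow_ext _ _ (ho i A) (ho i B)
      (fun l l' h => ?_) fun l l' h => ?_
    · have hd := dec_assoc (p := fun j k => ((A.lab j).lab k).op.n) l l' h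
      refine dec_assoc_inj (p := fun j k => ((B.lab j).lab k).op.n) _ _ ?_
      have h1 := T.dec_μMap_perm ((T.map (T.μ X) i).map f) l
      have h2 := LOp.dec_sperm_tot_μ T (f.map (dec l).1) (dec l).2
      have h3 := T.dec_μMap_perm (T.μMap f) l'
      have h4 := T.dec_μMap_perm f (dec l').1
      have h5 := (LOp.smap_arrow (T.μMap_map f (dec l').1) (r := (dec l').2) (r' := (dec l').2)
        rfl).1
      refine (congrArg (fun p : Σ j, Fin (∑ k, ((B.lab j).lab k).op.n) =>
        (⟨⟨p.1, (dec p.2).1⟩, (dec p.2).2⟩ :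
          Σ q : (Σ j, Fin (B.lab j).op.n), Fin ((B.lab q.1).lab q.2).op.n)) h1).trans ?_
      refine (congrArg (fun q : Σ k, Fin ((B.lab (f.perm (dec l).1)).lab k).op.n =>
        (⟨⟨f.perm (dec l).1, q.1⟩, q.2⟩ :
          Σ q : (Σ j, Fin (B.lab j).op.n), Fin ((B.lab q.1).lab q.2).op.n)) h2).trans ?_
      refine Eq.trans ?_ (congrArg (fun p : Σ x : Fin (∑ j, (B.lab j).op.n),
          Fin ((B.lab (dec x).1).lab (dec x).2).op.n =>
        (⟨dec p.1, p.2⟩ :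
          Σ q : (Σ j, Fin (B.lab j).op.n), Fin ((B.lab q.1).lab q.2).op.n)) h3).symm
      refine (congrArg (fun q : Σ q : (Σ j, Fin (A.lab j).op.n), Fin ((A.lab q.1).lab q.2).op.n =>
        (⟨⟨f.perm q.1.1, LOp.sperm (f.map q.1.1) q.1.2⟩,
          LOp.sperm (LOp.smap (f.map q.1.1) q.1.2) q.2⟩ :
          Σ q : (Σ j, Fin (B.lab j).op.n), Fin ((B.lab q.1).lab q.2).op.n)) hd).trans ?_
      exact LOp.fin_sigma_ext h4.symm h5.symm
    · have hd := dec_assoc (p := fun j k => ((A.lab j).lab k).op.n) l l' h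
      refine (T.μMap_map ((T.map (T.μ X) i).map f) l).trans ?_
      refine (LOp.smap_tot_μ T (f.map (dec l).1) (dec l).2).trans ?_
      refine Eq.trans ?_ (T.μMap_map (T.μMap f) l').symm
      refine Eq.trans ?_ (LOp.smap_arrow (T.μMap_map f (dec l').1) rfl).2.symm
      exact congrArg (fun q : Σ q : (Σ j, Fin (A.lab j).op.n), Fin ((A.lab q.1).lab q.2).op.n =>
        Arrow.mk (LOp.smap (LOp.smap (f.map q.1.1) q.1.2) q.2)) hd

end Operad

/-! ## Coidentifiers -/

section quotients

universe v₁ v₂ v₃ u₁ u₂ u₃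

variable {C : Type u₁} [Category.{v₁} C] {D : Type u₂} [Category.{v₂} D]
  {E : Type u₃} [Category.{v₃} E]

/-- A full functor which is surjective on objects. -/
structure FullSurj (P : C ⥤ D) : Prop where
  surj : ∀ d : D, ∃ x : C, P.obj x = d
  full : ∀ {x y : C} (g : P.obj x ⟶ P.obj y), ∃ f : x ⟶ y, P.map f = g

namespace FullSurj

variable {P : C ⥤ D}

lemma comp (hP : FullSurj P) {R : D ⥤ E} (hR : FullSurj R) : FullSurj (P ⋙ R) where
  surj e := by
    obtain ⟨d, rfl⟩ := hR.surj e
    obtain ⟨x, rfl⟩ := hP.surj d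
    exact ⟨x, rfl⟩
  full g := by
    obtain ⟨h, rfl⟩ := hR.full g
    obtain ⟨f, rfl⟩ := hP.full h
    exact ⟨f, rfl⟩

lemma cancel (hP : FullSurj P) {F G : D ⥤ E} (h : P ⋙ F = P ⋙ G) : F = G := by
  refine Arrow.functor_ext ?_
  intro d d' g
  obtain ⟨x, rfl⟩ := hP.surj d
  obtain ⟨y, rfl⟩ := hP.surj d'
  obtain ⟨f, rfl⟩ := hP.full g
  exact congrArg (fun H : C ⥤ E => Arrow.mk (H.map f)) h

/-- A functor on the source of `P` descends along `P` when it is compatible with the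
identifications made by `P`. -/
structure Desc (P : C ⥤ D) (F : C ⥤ E) : Prop where
  hobj : ∀ {x x' : C}, P.obj x = P.obj x' → ∃ w : x ⟶ x', IsId (P.map w) ∧ IsId (F.map w)
  hmap : ∀ {x y : C} {f f' : x ⟶ y}, P.map f = P.map f' → F.map f = F.map f'

noncomputable section

/-- A chosen preimage of an object. -/
def sec (hP : FullSurj P) (d : D) : C := (hP.surj d).choose

lemma sec_eq (hP : FullSurj P) (d : D) : P.obj (hP.sec d) = d := (hP.surj d).choose_spec

/-- A chosen preimage of a morphism. -/
def pre (hP : FullSurj P) {d d' : D} (g : d ⟶ d') : hP.sec d ⟶ hP.sec d' :=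
  (hP.full (eqToHom (hP.sec_eq d) ≫ g ≫ eqToHom (hP.sec_eq d').symm)).choose

lemma pre_eq (hP : FullSurj P) {d d' : D} (g : d ⟶ d') :
    P.map (hP.pre g) = eqToHom (hP.sec_eq d) ≫ g ≫ eqToHom (hP.sec_eq d').symm :=
  (hP.full _).choose_spec

/-- The induced functor on the target of `P`. -/
def desc (hP : FullSurj P) {F : C ⥤ E} (hF : Desc P F) : D ⥤ E where
  obj d := F.obj (hP.sec d)
  map g := F.map (hP.pre g)
  map_id d := by
    rw [← F.map_id]
    refine hF.hmap ?_
    rw [hP.pre_eq, P.map_id]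
    simp
  map_comp g h := by
    rw [← F.map_comp]
    refine hF.hmap ?_
    rw [hP.pre_eq, P.map_comp, hP.pre_eq, hP.pre_eq]
    simp

lemma fac (hP : FullSurj P) {F : C ⥤ E} (hF : Desc P F) : P ⋙ hP.desc hF = F := by
  refine Arrow.functor_ext ?_
  intro x y f
  obtain ⟨w, hw, hw'⟩ := hF.hobj (hP.sec_eq (P.obj x))
  obtain ⟨t, ht, ht'⟩ := hF.hobj (hP.sec_eq (P.obj y))
  have e : F.map (hP.pre (P.map f)) ≫ F.map t = F.map w ≫ F.map f := by
    rw [← F.map_comp, ← F.map_comp]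
    refine hF.hmap ?_
    rw [P.map_comp, P.map_comp, hP.pre_eq, hw.eq (isId_eqToHom (hP.sec_eq _)),
      ht.eq (isId_eqToHom (hP.sec_eq _))]
    simp
  refine (ht'.arrow_comp' (F.map (hP.pre (P.map f)))).symm.trans ?_
  rw [e]
  exact hw'.arrow_comp _

/-- A natural transformation between restrictions along `P` descends. -/
def desc₂ (hP : FullSurj P) {F G : D ⥤ E} (θ : P ⋙ F ⟶ P ⋙ G) : F ⟶ G where
  app d := eqToHom (congrArg F.obj (hP.sec_eq d).symm) ≫ θ.app (hP.sec d) ≫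
    eqToHom (congrArg G.obj (hP.sec_eq d))
  naturality d d' g := by
    have h := θ.naturality (hP.pre g)
    dsimp only [Functor.comp_map, Functor.comp_obj] at h
    rw [hP.pre_eq, F.map_comp, F.map_comp, G.map_comp, G.map_comp, eqToHom_map, eqToHom_map,
      eqToHom_map, eqToHom_map] at h
    have h2 : F.map g ≫ eqToHom (congrArg F.obj (hP.sec_eq d').symm) ≫ θ.app (hP.sec d') =
        eqToHom (congrArg F.obj (hP.sec_eq d).symm) ≫ θ.app (hP.sec d) ≫
          eqToHom (congrArg G.obj (hP.sec_eq d)) ≫ G.map g ≫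
            eqToHom (congrArg G.obj (hP.sec_eq d').symm) := by
      rw [← h]
      simp
    have h3 := congrArg (fun k => k ≫ eqToHom (congrArg G.obj (hP.sec_eq d'))) h2
    simpa using h3

lemma desc₂_app (hP : FullSurj P) {F G : D ⥤ E} (θ : P ⋙ F ⟶ P ⋙ G) (x : C) :
    (hP.desc₂ θ).app (P.obj x) = θ.app x := by
  obtain ⟨w, hw⟩ := hP.full (eqToHom (hP.sec_eq (P.obj x)))
  have h := θ.naturality w
  dsimp only [Functor.comp_map, Functor.comp_obj] at h
  rw [hw, eqToHom_map, eqToHom_map] at h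
  change eqToHom _ ≫ θ.app (hP.sec (P.obj x)) ≫ eqToHom _ = θ.app x
  rw [← h]
  simp

end

end FullSurj

/-- A class of morphisms which contains the identities and is closed under composition and
inverses. -/
structure IsSubgroupoid (W : MorphismProperty C) : Prop where
  id : ∀ x : C, W (𝟙 x)
  comp : ∀ {x y z : C} {f : x ⟶ y} {g : y ⟶ z}, W f → W g → W (f ≫ g)
  inv : ∀ {x y : C} {f : x ⟶ y}, W f → ∃ g : y ⟶ x, W g ∧ f ≫ g = 𝟙 x ∧ g ≫ f = 𝟙 y

namespace IsSubgroupoid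

variable {W : MorphismProperty C}

/-- Objects connected by a morphism in `W`. -/
def setoid (hW : IsSubgroupoid W) : Setoid C where
  r x y := ∃ f : x ⟶ y, W f
  iseqv :=
    { refl := fun x => ⟨𝟙 x, hW.id x⟩
      symm := fun ⟨_, hf⟩ => (hW.inv hf).elim fun g hg => ⟨g, hg.1⟩
      trans := fun ⟨f, hf⟩ ⟨g, hg⟩ => ⟨f ≫ g, hW.comp hf hg⟩ }

/-- The relation between parallel morphisms in `W`. -/
def rel (_ : IsSubgroupoid W) : HomRel C := fun _ _ f g => W f ∧ W g

/-- The coidentifier of a subgroupoid `W` of `C`: the universal category obtained from `C` by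
turning the morphisms in `W` into identities (see `IsSubgroupoid.existsUnique_lift`).  Its objects
are the classes of objects modulo `W`; its morphisms are morphisms of `C` between chosen
representatives, modulo the congruence identifying any two parallel morphisms in `W`. -/
def Coid (hW : IsSubgroupoid W) : Type u₁ := _root_.Quotient hW.setoid

noncomputable section

/-- The chosen representative. -/
def Coid.rep {hW : IsSubgroupoid W} (ξ : hW.Coid) : C :=
  _root_.Quotient.out (s := hW.setoid) ξ

/-- The chosen representative, as an object of the quotient of `C`. -/
abbrev Coid.rep' {hW : IsSubgroupoid W} (ξ : hW.Coid) : CategoryTheory.Quotient hW.rel :=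
  ⟨ξ.rep⟩

instance (hW : IsSubgroupoid W) : Category.{v₁} hW.Coid where
  Hom ξ ξ' := ξ.rep' ⟶ ξ'.rep'
  id ξ := 𝟙 ξ.rep'
  comp f g := CategoryStruct.comp (obj := CategoryTheory.Quotient hW.rel) f g
  id_comp f := Category.id_comp (obj := CategoryTheory.Quotient hW.rel) f
  comp_id f := Category.comp_id (obj := CategoryTheory.Quotient hW.rel) f
  assoc f g h := Category.assoc (obj := CategoryTheory.Quotient hW.rel) f g h

variable (hW : IsSubgroupoid W)

/-- The class of an object. -/
def cls (x : C) : hW.Coid := _root_.Quotient.mk hW.setoid x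

lemma cls_rep (x : C) : ∃ f : (hW.cls x).rep ⟶ x, W f :=
  _root_.Quotient.exact (_root_.Quotient.out_eq (s := hW.setoid) (hW.cls x))

/-- A chosen morphism in `W` from the representative. -/
def can (x : C) : (hW.cls x).rep ⟶ x := (hW.cls_rep x).choose

lemma can_mem (x : C) : W (hW.can x) := (hW.cls_rep x).choose_spec

/-- A chosen morphism in `W` to the representative. -/
def canInv (x : C) : x ⟶ (hW.cls x).rep := (hW.inv (hW.can_mem x)).choose

lemma canInv_mem (x : C) : W (hW.canInv x) := (hW.inv (hW.can_mem x)).choose_spec.1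

lemma can_canInv (x : C) : hW.can x ≫ hW.canInv x = 𝟙 _ :=
  (hW.inv (hW.can_mem x)).choose_spec.2.1

lemma canInv_can (x : C) : hW.canInv x ≫ hW.can x = 𝟙 _ :=
  (hW.inv (hW.can_mem x)).choose_spec.2.2

/-- The projection to the coidentifier. -/
def q : C ⥤ hW.Coid where
  obj x := hW.cls x
  map {x y} f := (CategoryTheory.Quotient.functor hW.rel).map (hW.can x ≫ f ≫ hW.canInv y)
  map_id x := by
    have h : hW.can x ≫ 𝟙 x ≫ hW.canInv x = 𝟙 _ := by rw [Category.id_comp, hW.can_canInv]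
    exact (congrArg (CategoryTheory.Quotient.functor hW.rel).map h).trans
      ((CategoryTheory.Quotient.functor hW.rel).map_id _)
  map_comp {x y z} f g := by
    have h : hW.can x ≫ (f ≫ g) ≫ hW.canInv z =
        (hW.can x ≫ f ≫ hW.canInv y) ≫ hW.can y ≫ g ≫ hW.canInv z := by
      simp only [Category.assoc]
      rw [← Category.assoc (hW.canInv y), hW.canInv_can, Category.id_comp]
    exact (congrArg (CategoryTheory.Quotient.functor hW.rel).map h).trans
      ((CategoryTheory.Quotient.functor hW.rel).map_comp _ _)

lemma q_isId {x y : C} {f : x ⟶ y} (hf : W f) : IsId (hW.q.map f) := by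
  have h : hW.cls x = hW.cls y := _root_.Quotient.sound (s := hW.setoid) ⟨f, hf⟩
  have key : ∀ {ξ ξ' : hW.Coid} (h : ξ = ξ') (g : ξ.rep ⟶ ξ'.rep), W g →
      (CategoryTheory.Quotient.functor hW.rel).map g = (eqToHom h : ξ ⟶ ξ') := by
    rintro ξ _ rfl g hg
    refine (CategoryTheory.Quotient.sound hW.rel ⟨hg, hW.id _⟩).trans ?_
    exact (CategoryTheory.Quotient.functor hW.rel).map_id _
  exact ⟨h, key h _ (hW.comp (hW.can_mem x) (hW.comp hf (hW.canInv_mem y)))⟩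

lemma q_fullSurj : FullSurj hW.q where
  surj ξ := _root_.Quotient.exists_rep (s := hW.setoid) ξ
  full {x y} g := by
    obtain ⟨k, hk⟩ := (CategoryTheory.Quotient.functor hW.rel).map_surjective
      (X := (hW.cls x).rep) (Y := (hW.cls y).rep) g
    refine ⟨hW.canInv x ≫ k ≫ hW.can y, Eq.trans ?_ hk⟩
    refine congrArg (CategoryTheory.Quotient.functor hW.rel).map ?_
    simp only [Category.assoc]
    rw [hW.can_canInv, Category.comp_id, ← Category.assoc, hW.can_canInv, Category.id_comp]

lemma q_obj_eq {x y : C} (h : hW.q.obj x = hW.q.obj y) : ∃ f : x ⟶ y, W f :=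
  _root_.Quotient.exact (s := hW.setoid) h

/-- Elementary identifications between parallel morphisms. -/
def step (W : MorphismProperty C) {x y : C} (f f' : x ⟶ y) : Prop :=
  ∃ (u v : C) (a : x ⟶ u) (w w' : u ⟶ v) (b : v ⟶ y), W w ∧ W w' ∧ f = a ≫ w ≫ b ∧
    f' = a ≫ w' ≫ b

lemma q_map_eq {x y : C} {f f' : x ⟶ y} (h : hW.q.map f = hW.q.map f') :
    Relation.EqvGen (step W) f f' := by
  have h1 := (CategoryTheory.Quotient.functor_homRel_eq_compClosure_eqvGen hW.rel _ _).1 h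
  have key : ∀ {g g' : (hW.cls x).rep ⟶ (hW.cls y).rep},
      Relation.EqvGen (@HomRel.CompClosure C _ hW.rel _ _) g g' →
      Relation.EqvGen (step W) (hW.canInv x ≫ g ≫ hW.can y) (hW.canInv x ≫ g' ≫ hW.can y) := by
    intro g g' hg
    induction hg with
    | rel g g' hg =>
      cases hg with
      | intro u v a w w' b hw =>
        exact .rel _ _ ⟨_, _, hW.canInv x ≫ a, w, w', b ≫ hW.can y, hw.1, hw.2,
          by simp, by simp⟩
    | refl g => exact .refl _
    | symm g g' _ ih => exact .symm _ _ ih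
    | trans g g' g'' _ _ ih ih' => exact .trans _ _ _ ih ih'
  have h2 := key h1
  have e : ∀ f : x ⟶ y, hW.canInv x ≫ (hW.can x ≫ f ≫ hW.canInv y) ≫ hW.can y = f := by
    intro f
    simp only [Category.assoc]
    rw [hW.canInv_can, Category.comp_id, ← Category.assoc, hW.canInv_can, Category.id_comp]
  rwa [e, e] at h2

lemma q_desc (F : C ⥤ E) (hF : ∀ {x y : C} {f : x ⟶ y}, W f → IsId (F.map f)) :
    FullSurj.Desc hW.q F where
  hobj h := (hW.q_obj_eq h).elim fun w hw => ⟨w, hW.q_isId hw, hF hw⟩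
  hmap h := by
    have key := hW.q_map_eq h
    clear h
    induction key with
    | rel f f' h =>
      obtain ⟨u, v, a, w, w', b, hw, hw', rfl, rfl⟩ := h
      simp only [F.map_comp]
      rw [(hF hw).eq (hF hw')]
    | refl _ => rfl
    | symm _ _ _ ih => exact ih.symm
    | trans _ _ _ _ _ ih ih' => exact ih.trans ih'

/-- The universal property of the coidentifier. -/
theorem existsUnique_lift (F : C ⥤ E) (hF : ∀ {x y : C} {f : x ⟶ y}, W f → IsId (F.map f)) :
    ∃! G : hW.Coid ⥤ E, hW.q ⋙ G = F :=
  ⟨hW.q_fullSurj.desc (hW.q_desc F hF), hW.q_fullSurj.fac _, fun _ hG =>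
    hW.q_fullSurj.cancel (hG.trans (hW.q_fullSurj.fac _).symm)⟩

end

end IsSubgroupoid

end quotients

/-! ## The 2-monad `T/Σ` -/

namespace CatOver

/-- A 1-cell which is fibrewise full and surjective on objects. -/
def FullSurj {X Y : CatOver I} (f : X ⟶ Y) : Prop := ∀ i, _root_.FullSurj (f i)

lemma FullSurj.comp {X Y Z : CatOver I} {f : X ⟶ Y} {g : Y ⟶ Z} (hf : FullSurj f)
    (hg : FullSurj g) : FullSurj (f ≫ g) := fun i => (hf i).comp (hg i)

lemma FullSurj.cancel {X Y Z : CatOver I} {f : X ⟶ Y} (hf : FullSurj f) {g h : Y ⟶ Z}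
    (e : f ≫ g = f ≫ h) : g = h :=
  funext fun i => (hf i).cancel (congrFun e i)

lemma FullSurj.tot {X Y : CatOver I} {f : X ⟶ Y} (hf : FullSurj f) :
    _root_.FullSurj (tot f) where
  surj := by
    rintro ⟨i, y⟩
    obtain ⟨x, rfl⟩ := (hf i).surj y
    exact ⟨⟨i, x⟩, rfl⟩
  full {x y} g := by
    suffices ∀ {a b : Σ i, Y.fib i} (g : a ⟶ b) (hx : (_root_.tot f).obj x = a)
        (hy : (_root_.tot f).obj y = b),
        ∃ k : x ⟶ y, (_root_.tot f).map k = eqToHom hx ≫ g ≫ eqToHom hy.symm by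
      obtain ⟨k, hk⟩ := this g rfl rfl
      exact ⟨k, by simpa using hk⟩
    rintro _ _ ⟨g⟩ hx hy
    obtain ⟨i, x⟩ := x
    obtain ⟨i', y⟩ := y
    cases hx
    cases hy
    obtain ⟨k, rfl⟩ := (hf i).full g
    exact ⟨.mk k, arrow_mk_inj (((isId_eqToHom _).arrow_comp _).trans
      ((isId_eqToHom _).arrow_comp' _)).symm⟩

lemma FullSurj.map {X Y : CatOver I} {f : X ⟶ Y} (hf : FullSurj f) (T : Collection I) :
    FullSurj (T.map f) := fun i =>
  { surj := by
      rintro ⟨a, y⟩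
      choose x hx using fun j => (hf (a.src j)).surj (y j)
      exact ⟨⟨a, x⟩, congrArg (LOp.mk a) (funext hx)⟩
    full := by
      rintro A B ⟨p, e, m⟩
      choose k hk using fun j => hf.tot.full (x := A.pt j) (y := B.pt (p j)) (m j)
      exact ⟨⟨p, e, k⟩, LOp.Hom.ext' (fun _ => rfl) fun j => congrArg Arrow.mk (hk j)⟩ }

end CatOver

lemma isId_sigma_mk {X : CatOver I} {i : I} {x y : X.fib i} {f : x ⟶ y} (hf : IsId f) :
    IsId (C := Σ i, X.fib i) (x := ⟨i, x⟩) (y := ⟨i, y⟩) (Sigma.SigmaHom.mk f) := by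
  obtain ⟨rfl, rfl⟩ := hf
  exact ⟨rfl, rfl⟩

namespace LOp

variable {T : Collection I} {X Y : CatOver I} {i : I}

lemma permutative_isSubgroupoid : IsSubgroupoid (permutative T X i) where
  id A j := isId_refl _
  comp hf hg j := (hf j).comp (hg _)
  inv {A B f} hf := by
    have h1 : ∀ j, B.pt j = A.pt (f.perm.symm j) := fun j => by
      refine Eq.trans ?_ (hf (f.perm.symm j)).choose.symm
      rw [f.perm.apply_symm_apply]
    have h2 : B.op = A.op.act f.perm.symm := by
      have h := Collection.Op.act_trans f.perm f.op_eq f.perm.symm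
      refine Eq.trans ?_ h.symm
      rw [Equiv.symm_trans_self]
      exact congrArg (Collection.Op.mk _ _) (T.act_refl _).symm
    refine ⟨⟨f.perm.symm, h2, fun j => eqToHom (h1 j)⟩, fun j => isId_eqToHom (h1 j), ?_, ?_⟩
    · refine Hom.ext' (fun j => f.perm.symm_apply_apply j) fun j => ?_
      exact ((hf j).comp (isId_eqToHom (h1 (f.perm j)))).arrow_eq (isId_refl (A.pt j)) rfl
    · refine Hom.ext' (fun j => f.perm.apply_symm_apply j) fun j => ?_
      exact ((isId_eqToHom (h1 j)).comp (hf (f.perm.symm j))).arrow_eq (isId_refl (B.pt j)) rfl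

/-- The morphism with identity permutation. -/
def lev (a : T.Op i) {u v : ∀ j, X.fib (a.src j)} (w : ∀ j, u j ⟶ v j) :
    (⟨a, u⟩ : LOp T X i) ⟶ ⟨a, v⟩ :=
  ⟨Equiv.refl _, by
    obtain ⟨n, s, α⟩ := a
    exact congrArg (Collection.Op.mk n s) (T.act_refl α).symm, fun j => Sigma.SigmaHom.mk (w j)⟩

lemma smap_isId {a b : Σ i, LOp T X i} {g : a ⟶ b} (hg : IsId g) (k) : IsId (smap g k) := by
  obtain ⟨rfl, rfl⟩ := hg
  exact isId_refl _

lemma isId_smap_congr {a b a' b' : Σ i, LOp T X i} {g : a ⟶ b} {g' : a' ⟶ b'}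
    (h : Arrow.mk g = Arrow.mk g') (hg : ∀ k, IsId (smap g k)) (k) : IsId (smap g' k) := by
  obtain ⟨h₁, h₂, h₃⟩ := (Arrow.mk_eq_mk_iff _ _).1 h
  subst h₁ h₂
  obtain rfl : g = g' := by simpa using h₃
  exact hg k

/-- Changing a dependent finite family one member at a time. -/
lemma pi_invariant {n : ℕ} {α : Fin n → Type*} {β : Type*} (r : ∀ j, α j → α j → Prop)
    (hr : ∀ j x, r j x x) (Φ : (∀ j, α j) → β)
    (h : ∀ f g : ∀ j, α j, (∀ j, r j (f j) (g j)) → Φ f = Φ g) {f g : ∀ j, α j}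
    (hfg : ∀ j, Relation.EqvGen (r j) (f j) (g j)) : Φ f = Φ g := by
  classical
  have h1 : ∀ j (x y : α j), Relation.EqvGen (r j) x y → ∀ f : ∀ j, α j,
      Φ (Function.update f j x) = Φ (Function.update f j y) := by
    intro j x y hxy
    induction hxy with
    | rel x y hxy =>
      intro f
      refine h _ _ fun k => ?_
      by_cases hk : k = j
      · subst hk
        simpa using hxy
      · rw [Function.update_of_ne hk, Function.update_of_ne hk]
        exact hr _ _
    | refl x => exact fun _ => rfl
    | symm x y _ ih => exact fun f => (ih f).symm
    | trans x y z _ _ ih ih' => exact fun f => (ih f).trans (ih' f)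
  have h2 : ∀ s : Finset (Fin n), Φ (fun j => if j ∈ s then g j else f j) = Φ f := by
    intro s
    induction s using Finset.induction_on with
    | empty => simp
    | insert a s ha ih =>
      rw [← ih]
      have e1 : (fun j => if j ∈ insert a s then g j else f j) =
          Function.update (fun j => if j ∈ s then g j else f j) a (g a) := by
        funext j
        by_cases hj : j = a
        · subst hj; simp
        · simp [hj]
      have e2 : (fun j => if j ∈ s then g j else f j) =
          Function.update (fun j => if j ∈ s then g j else f j) a (f a) := by
        funext j
        by_cases hj : j = a
        · subst hj; simp [ha]
        · simp [hj]
      rw [e1]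
      refine Eq.trans ?_ (congrArg Φ e2).symm
      exact h1 a _ _ (.symm _ _ (hfg a)) _
  rw [← h2 Finset.univ]
  simp

end LOp

namespace Operad

variable (T : Operad I)

noncomputable section

/-- `(T/Σ) X`: the coidentifier of the class of permutative maps in `TX`. -/
abbrev quotObj (X : CatOver I) : CatOver I where
  fib i := (LOp.permutative_isSubgroupoid (T := T.toCollection) (X := X) (i := i)).Coid

/-- The projection `TX ⟶ (T/Σ) X`. -/
def q (X : CatOver I) : T.obj X ⟶ T.quotObj X := fun i =>
  (LOp.permutative_isSubgroupoid (T := T.toCollection) (X := X) (i := i)).q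

variable {T} {X Y Z : CatOver I}

lemma q_fullSurj : CatOver.FullSurj (T.q X) := fun _ => IsSubgroupoid.q_fullSurj _

lemma q_isId {i : I} {A B : (T.obj X).fib i} {f : A ⟶ B}
    (hf : LOp.permutative T.toCollection X i f) : IsId ((T.q X i).map f) :=
  IsSubgroupoid.q_isId _ hf

/-- 1-cells out of `TX` which send permutative maps to identities. -/
def Killing (f : T.obj X ⟶ Y) : Prop :=
  ∀ {i : I} {A B : (T.obj X).fib i} {k : A ⟶ B}, LOp.permutative T.toCollection X i k →
    IsId ((f i).map k)

/-- The 1-cell induced on `(T/Σ) X`. -/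
def lift {f : T.obj X ⟶ Y} (hf : Killing f) : T.quotObj X ⟶ Y := fun i =>
  (q_fullSurj i).desc (IsSubgroupoid.q_desc _ (f i) hf)

lemma q_lift {f : T.obj X ⟶ Y} (hf : Killing f) : T.q X ≫ lift hf = f :=
  funext fun i => (q_fullSurj i).fac (IsSubgroupoid.q_desc _ (f i) hf)

lemma killing_map_q (f : X ⟶ Y) : Killing (T.map f ≫ T.q Y) :=
  fun hk => q_isId fun j => (hk j).map (tot f)

/-- `(T/Σ) f`. -/
def quotMap₁ (f : X ⟶ Y) : T.quotObj X ⟶ T.quotObj Y := lift (killing_map_q f)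

lemma q_quotMap₁ (f : X ⟶ Y) : T.q X ≫ quotMap₁ f = T.map f ≫ T.q Y := q_lift _

/-- `(T/Σ) θ`. -/
def quotMap₂ {f g : X ⟶ Y} (θ : f ⟶ g) : quotMap₁ (T := T) f ⟶ quotMap₁ g := fun i =>
  (q_fullSurj i).desc₂
    ((eqToHom (q_quotMap₁ f) ≫ T.map₂ θ ▷ T.q Y ≫ eqToHom (q_quotMap₁ g).symm :
      T.q X ≫ quotMap₁ f ⟶ T.q X ≫ quotMap₁ g) i)

lemma arrow_conj {f g f' g' : X ⟶ Y} (θ : f ⟶ g) (h : f' = f) (h' : g = g') (i) (x : X.fib i) :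
    Arrow.mk ((eqToHom h ≫ θ ≫ eqToHom h') i |>.app x) = Arrow.mk ((θ i).app x) := by
  subst h h'
  simp

lemma arrow_app_congr {f g : X ⟶ Y} (θ : f ⟶ g) {i} {x y : X.fib i} (h : x = y) :
    Arrow.mk ((θ i).app x) = Arrow.mk ((θ i).app y) := by
  subst h; rfl

lemma obj_congr {f g : X ⟶ Y} (h : f = g) {i} (x : X.fib i) : (f i).obj x = (g i).obj x := by
  subst h; rfl

lemma arrow_congr {f g : X ⟶ Y} (h : f = g) {i} {x y : X.fib i} (k : x ⟶ y) :
    Arrow.mk ((f i).map k) = Arrow.mk ((g i).map k) := by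
  subst h; rfl

lemma quotMap₂_app {f g : X ⟶ Y} (θ : f ⟶ g) {i : I} (A : (T.obj X).fib i) :
    Arrow.mk ((quotMap₂ (T := T) θ i).app ((T.q X i).obj A)) =
      Arrow.mk ((T.q Y i).map ((T.map₂ θ i).app A)) := by
  refine (congrArg Arrow.mk ((q_fullSurj i).desc₂_app _ A)).trans ?_
  exact arrow_conj (T.map₂ θ ▷ T.q Y) _ _ i A

lemma cell_ext_q {P : X ⟶ Y} (hP : CatOver.FullSurj P) {f g f' g' : Y ⟶ Z} {θ : f ⟶ g}
    {κ : f' ⟶ g'} (h : f = f') (h' : g' = g)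
    (H : ∀ i x, Arrow.mk ((θ i).app ((P i).obj x)) = Arrow.mk ((κ i).app ((P i).obj x))) :
    θ = eqToHom h ≫ κ ≫ eqToHom h' := by
  refine CatOver.cell_ext h h' fun i y => ?_
  obtain ⟨x, rfl⟩ := (hP i).surj y
  exact H i x

lemma μ_isId {i : I} {A B : (T.obj (T.obj X)).fib i} {f : A ⟶ B}
    (hf : ∀ j k, IsId (LOp.smap (f.map j) k)) :
    IsId ((T.μ X ≫ T.q X) i |>.map f) :=
  q_isId fun l => (hf _ _).congr (T.μMap_map f l).symm

lemma smap_tot_q {a b : Σ i, (T.obj X).fib i} {f f' : a ⟶ b}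
    (h : (tot (T.q X)).map f = (tot (T.q X)).map f') :
    Relation.EqvGen (fun g g' : a ⟶ b => ∃ (u v : (T.obj X).fib a.1) (c : a.2 ⟶ u) (w w' : u ⟶ v)
      (d : (⟨a.1, v⟩ : Σ i, (T.obj X).fib i) ⟶ b), LOp.permutative _ X a.1 w ∧
      LOp.permutative _ X a.1 w' ∧ g = Sigma.SigmaHom.mk (c ≫ w) ≫ d ∧
      g' = Sigma.SigmaHom.mk (c ≫ w') ≫ d) f f' := by
  obtain ⟨f⟩ := f
  obtain ⟨f'⟩ := f'
  rename_i i x y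
  have h1 : (T.q X i).map f = (T.q X i).map f' := by
    injection h
  have h2 := IsSubgroupoid.q_map_eq _ h1
  clear h h1
  induction h2 with
  | rel f f' h =>
    obtain ⟨u, v, c, w, w', d, hw, hw', rfl, rfl⟩ := h
    exact .rel _ _ ⟨u, v, c, w, w', Sigma.SigmaHom.mk d, hw, hw',
      congrArg Sigma.SigmaHom.mk (Category.assoc _ _ _).symm,
      congrArg Sigma.SigmaHom.mk (Category.assoc _ _ _).symm⟩
  | refl _ => exact .refl _
  | symm _ _ _ ih => exact .symm _ _ ih
  | trans _ _ _ _ _ ih ih' => exact .trans _ _ _ ih ih'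

lemma isId_smap_lift {a b : Σ i, (T.obj X).fib i} {w : a ⟶ b}
    (h : IsId ((tot (T.q X)).map w)) : ∃ w' : a ⟶ b, (tot (T.q X)).map w' = (tot (T.q X)).map w ∧
      ∀ k, IsId (LOp.smap w' k) := by
  obtain ⟨w⟩ := w
  rename_i i x y
  obtain ⟨e, he⟩ := h
  have e1 : (T.q X i).obj x = (T.q X i).obj y := by
    injection e
  obtain ⟨w', hw'⟩ := IsSubgroupoid.q_obj_eq _ e1
  exact ⟨.mk w', (isId_sigma_mk (q_isId hw')).eq ⟨e, he⟩, hw'⟩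

/-- Lifting permutative maps along `Tq`. -/
lemma permutative_lift {i : I} {A B : (T.obj (T.obj X)).fib i}
    {w : (T.map (T.q X) i).obj A ⟶ (T.map (T.q X) i).obj B}
    (hw : LOp.permutative T.toCollection (T.quotObj X) i w) :
    ∃ w' : A ⟶ B, (T.map (T.q X) i).map w' = w ∧ ∀ j k, IsId (LOp.smap (w'.map j) k) := by
  have h : ∀ j, ∃ m : A.pt j ⟶ B.pt (w.perm j), (tot (T.q X)).map m = w.map j ∧
      ∀ k, IsId (LOp.smap m k) := by
    intro j
    obtain ⟨m, hm⟩ := (q_fullSurj (T := T) (X := X)).tot.full (x := A.pt j) (y := B.pt (w.perm j))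
      (w.map j)
    obtain ⟨m', h1, h2⟩ := isId_smap_lift (w := m) (by rw [hm]; exact hw j)
    exact ⟨m', h1.trans hm, h2⟩
  choose m hm hm' using h
  exact ⟨⟨w.perm, w.op_eq, m⟩, LOp.Hom.ext' (fun _ => rfl) fun j => congrArg Arrow.mk (hm j), hm'⟩

lemma μ_desc (X : CatOver I) (i : I) :
    FullSurj.Desc (T.map (T.q X) i) ((T.μ X ≫ T.q X) i) where
  hobj {A B} h := by
    obtain ⟨w, hw, hw'⟩ := permutative_lift (A := A) (B := B) (w := eqToHom h)
      (by
        have : ∀ {A B : (T.obj (T.quotObj X)).fib i} (h : A = B),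
            LOp.permutative T.toCollection (T.quotObj X) i (eqToHom h) := by
          rintro A _ rfl
          exact LOp.permutative_isSubgroupoid.id A
        exact this h)
    exact ⟨w, hw ▸ isId_eqToHom h, μ_isId hw'⟩
  hmap {A B f f'} h := by
    obtain ⟨p, e, m⟩ := f
    obtain ⟨p', e', m'⟩ := f'
    have hp : p = p' := congrArg LOp.Hom.perm h
    subst hp
    have hm : ∀ j, (tot (T.q X)).map (m j) = (tot (T.q X)).map (m' j) := fun j =>
      congrFun (eq_of_heq (LOp.Hom.mk.inj h).2) j
    refine LOp.pi_invariant _ ?_ (fun m => ((T.μ X ≫ T.q X) i).map (⟨p, e, m⟩ : A ⟶ B)) ?_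
      fun j => smap_tot_q (hm j)
    · intro j x
      exact ⟨_, _, 𝟙 _, 𝟙 _, 𝟙 _, x, LOp.permutative_isSubgroupoid.id _,
        LOp.permutative_isSubgroupoid.id _, by rw [Category.id_comp]; exact (Category.id_comp x).symm,
        by rw [Category.id_comp]; exact (Category.id_comp x).symm⟩
    · intro f g hfg
      choose u v c w w' d hw hw' hf hg using hfg
      have key : ∀ w : ∀ j, u j ⟶ v j, (⟨p, e, fun j => Sigma.SigmaHom.mk (c j ≫ w j) ≫ d j⟩ :
          A ⟶ B) = LOp.lev A.op c ≫ LOp.lev A.op w ≫ ⟨p, e, d⟩ := fun w =>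
        LOp.Hom.ext' (fun _ => rfl) fun j =>
          congrArg Arrow.mk (Category.assoc (Sigma.SigmaHom.mk (c j)) (Sigma.SigmaHom.mk (w j)) (d j))
      dsimp only
      rw [funext hf, funext hg, key, key, Functor.map_comp, Functor.map_comp, Functor.map_comp,
        Functor.map_comp]
      rw [(μ_isId (f := LOp.lev A.op w) hw).eq (μ_isId (f := LOp.lev A.op w') hw')]

/-- The 1-cell `T((T/Σ)X) ⟶ (T/Σ)X` induced by the multiplication of `T`. -/
def quotAct (X : CatOver I) : T.obj (T.quotObj X) ⟶ T.quotObj X := fun i =>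
  (q_fullSurj.map T.toCollection i).desc (μ_desc X i)

lemma map_q_quotAct : T.map (T.q X) ≫ quotAct X = T.μ X ≫ T.q X :=
  funext fun i => (q_fullSurj.map T.toCollection i).fac (μ_desc X i)

lemma killing_quotAct : Killing (T := T) (quotAct X) := by
  intro i A B k hk
  obtain ⟨A, rfl⟩ := (q_fullSurj.map T.toCollection i).surj A
  obtain ⟨B, rfl⟩ := (q_fullSurj.map T.toCollection i).surj B
  obtain ⟨k, rfl, hk'⟩ := permutative_lift hk
  exact (μ_isId hk').congr (arrow_congr map_q_quotAct k).symm

/-- The multiplication of `T/Σ`. -/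
def quotμ (X : CatOver I) : T.quotObj (T.quotObj X) ⟶ T.quotObj X := lift killing_quotAct

variable (T) in
/-- The projection `TTX ⟶ (T/Σ)(T/Σ)X`. -/
def qq (X : CatOver I) : T.obj (T.obj X) ⟶ T.quotObj (T.quotObj X) :=
  T.map (T.q X) ≫ T.q (T.quotObj X)

lemma qq_fullSurj : CatOver.FullSurj (T.qq X) := (q_fullSurj.map T.toCollection).comp q_fullSurj

lemma qq_quotμ : T.qq X ≫ quotμ X = T.μ X ≫ T.q X :=
  (congrArg (fun k => T.map (T.q X) ≫ k) (q_lift killing_quotAct)).trans map_q_quotAct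

lemma tmap_comp (f : X ⟶ Y) (g : Y ⟶ Z) : T.map (f ≫ g) = T.map f ≫ T.map g :=
  T.twoMonad.map_comp f g

lemma qq_quotMap₁ (f : X ⟶ Y) : T.qq X ≫ quotMap₁ (quotMap₁ f) = T.map (T.map f) ≫ T.qq Y :=
  calc T.qq X ≫ quotMap₁ (quotMap₁ f)
      = T.map (T.q X) ≫ T.map (quotMap₁ f) ≫ T.q _ :=
        congrArg (fun k => T.map (T.q X) ≫ k) (q_quotMap₁ (quotMap₁ f))
    _ = T.map (T.q X ≫ quotMap₁ f) ≫ T.q _ :=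
        congrArg (fun k => k ≫ T.q _) (tmap_comp (T.q X) (quotMap₁ f)).symm
    _ = T.map (T.map f ≫ T.q Y) ≫ T.q _ := by rw [q_quotMap₁]
    _ = T.map (T.map f) ≫ T.qq Y :=
        congrArg (fun k => k ≫ T.q _) (tmap_comp (T.map f) (T.q Y))

lemma qq_quotMap₂ {f g : X ⟶ Y} (θ : f ⟶ g) {i : I} (A : (T.obj (T.obj X)).fib i) :
    Arrow.mk ((quotMap₂ (T := T) (quotMap₂ (T := T) θ) i).app ((T.qq X i).obj A)) =
      Arrow.mk ((T.qq Y i).map ((T.map₂ (T.map₂ θ) i).app A)) := by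
  refine (quotMap₂_app (T := T) (quotMap₂ (T := T) θ) ((T.map (T.q X) i).obj A)).trans ?_
  refine arrow_mk_map_congr (T.q _ i) ?_
  refine LOp.arrow_ext _ _ ?_ ?_ ?_ ?_
  · refine (obj_congr (tmap_comp (T.q X) (quotMap₁ f)).symm A).trans ?_
    rw [q_quotMap₁]
    exact obj_congr (tmap_comp (T.map f) (T.q Y)) A
  · refine (obj_congr (tmap_comp (T.q X) (quotMap₁ g)).symm A).trans ?_
    rw [q_quotMap₁]
    exact obj_congr (tmap_comp (T.map g) (T.q Y)) A
  · intro j j' h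
    exact h
  · intro j j' h
    obtain rfl := Fin.ext h
    exact arrow_mk_map_congr (Sigma.incl (C := (T.quotObj Y).fib) _)
      (quotMap₂_app (T := T) θ (A.lab j))

lemma η_nat' (f : X ⟶ Y) : f ≫ T.η Y = T.η X ≫ T.map f := T.twoMonad.η_nat f

lemma left_unit' (X : CatOver I) : T.η (T.obj X) ≫ T.μ X = 𝟙 (T.obj X) := T.twoMonad.left_unit X

lemma quot_left_unit (X : CatOver I) :
    (T.η (T.quotObj X) ≫ T.q (T.quotObj X)) ≫ quotμ X = 𝟙 (T.quotObj X) := by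
  refine q_fullSurj.cancel (?_ : T.q X ≫ _ = T.q X ≫ _)
  calc T.q X ≫ (T.η (T.quotObj X) ≫ T.q (T.quotObj X)) ≫ quotμ X
      = (T.q X ≫ T.η (T.quotObj X)) ≫ T.q (T.quotObj X) ≫ quotμ X := rfl
    _ = T.η (T.obj X) ≫ T.qq X ≫ quotμ X := by rw [η_nat']; rfl
    _ = (T.η (T.obj X) ≫ T.μ X) ≫ T.q X := by rw [qq_quotμ]; rfl
    _ = T.q X ≫ 𝟙 _ := by rw [left_unit']; rfl

lemma right_unit' (X : CatOver I) : T.map (T.η X) ≫ T.μ X = 𝟙 (T.obj X) :=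
  T.twoMonad.right_unit X

lemma assoc' (X : CatOver I) : T.map (T.μ X) ≫ T.μ X = T.μ (T.obj X) ≫ T.μ X :=
  T.twoMonad.assoc X

lemma μ_nat' (f : X ⟶ Y) : T.map (T.map f) ≫ T.μ Y = T.μ X ≫ T.map f := T.twoMonad.μ_nat f

lemma quotμ_nat (f : X ⟶ Y) :
    quotMap₁ (quotMap₁ (T := T) f) ≫ quotμ Y = quotμ X ≫ quotMap₁ f := by
  refine qq_fullSurj.cancel (?_ : T.qq X ≫ _ = T.qq X ≫ _)
  calc T.qq X ≫ quotMap₁ (quotMap₁ f) ≫ quotμ Y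
      = (T.qq X ≫ quotMap₁ (quotMap₁ f)) ≫ quotμ Y := rfl
    _ = T.map (T.map f) ≫ T.qq Y ≫ quotμ Y := by rw [qq_quotMap₁]; rfl
    _ = (T.map (T.map f) ≫ T.μ Y) ≫ T.q Y := by rw [qq_quotμ]; rfl
    _ = T.μ X ≫ T.map f ≫ T.q Y := by rw [μ_nat']; rfl
    _ = (T.μ X ≫ T.q X) ≫ quotMap₁ f := by rw [← q_quotMap₁]; rfl
    _ = T.qq X ≫ quotμ X ≫ quotMap₁ f := by rw [← qq_quotμ]; rfl

lemma quot_right_unit (X : CatOver I) :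
    quotMap₁ (T.η X ≫ T.q X) ≫ quotμ X = 𝟙 (T.quotObj X) := by
  refine q_fullSurj.cancel (?_ : T.q X ≫ _ = T.q X ≫ _)
  calc T.q X ≫ quotMap₁ (T.η X ≫ T.q X) ≫ quotμ X
      = (T.q X ≫ quotMap₁ (T.η X ≫ T.q X)) ≫ quotμ X := rfl
    _ = T.map (T.η X) ≫ T.qq X ≫ quotμ X := by rw [q_quotMap₁, tmap_comp]; rfl
    _ = (T.map (T.η X) ≫ T.μ X) ≫ T.q X := by rw [qq_quotμ]; rfl
    _ = T.q X ≫ 𝟙 _ := by rw [right_unit']; rfl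

lemma quot_assoc (X : CatOver I) :
    quotMap₁ (quotμ (T := T) X) ≫ quotμ X = quotμ (T.quotObj X) ≫ quotμ X := by
  have hP := ((q_fullSurj (T := T) (X := X)).map T.toCollection).map T.toCollection
  refine (hP.comp qq_fullSurj).cancel
    (?_ : (T.map (T.map (T.q X)) ≫ T.qq (T.quotObj X)) ≫ _ =
      (T.map (T.map (T.q X)) ≫ T.qq (T.quotObj X)) ≫ _)
  calc (T.map (T.map (T.q X)) ≫ T.qq (T.quotObj X)) ≫ quotMap₁ (quotμ X) ≫ quotμ X
      = T.map (T.map (T.q X)) ≫ T.map (T.q (T.quotObj X)) ≫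
          (T.q _ ≫ quotMap₁ (quotμ X)) ≫ quotμ X := rfl
    _ = ((T.map (T.map (T.q X)) ≫ T.map (T.q (T.quotObj X))) ≫ T.map (quotμ X)) ≫
          T.q _ ≫ quotμ X := by rw [q_quotMap₁]; rfl
    _ = T.map (T.qq X ≫ quotμ X) ≫ T.q _ ≫ quotμ X := by rw [← tmap_comp, ← tmap_comp]; rfl
    _ = T.map (T.μ X ≫ T.q X) ≫ T.q _ ≫ quotμ X := by rw [qq_quotμ]
    _ = T.map (T.μ X) ≫ T.qq X ≫ quotμ X := by rw [tmap_comp]; rfl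
    _ = (T.map (T.μ X) ≫ T.μ X) ≫ T.q X := by rw [qq_quotμ]; rfl
    _ = T.μ (T.obj X) ≫ T.μ X ≫ T.q X := by rw [assoc']; rfl
    _ = (T.μ (T.obj X) ≫ T.map (T.q X)) ≫ T.q _ ≫ quotμ X := by rw [← qq_quotμ]; rfl
    _ = T.map (T.map (T.q X)) ≫ (T.μ (T.quotObj X) ≫ T.q _) ≫ quotμ X := by rw [← μ_nat']; rfl
    _ = (T.map (T.map (T.q X)) ≫ T.qq (T.quotObj X)) ≫ quotμ (T.quotObj X) ≫ quotμ X := by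
        rw [← qq_quotμ]; rfl

lemma map₂_id' (f : X ⟶ Y) : T.map₂ (𝟙 f) = 𝟙 (T.map f) := T.twoMonad.map₂_id f

lemma map₂_comp' {f g h : X ⟶ Y} (θ : f ⟶ g) (κ : g ⟶ h) :
    T.map₂ (θ ≫ κ) = T.map₂ θ ≫ T.map₂ κ := T.twoMonad.map₂_comp θ κ

lemma μ_nat₂' {f g : X ⟶ Y} (θ : f ⟶ g) {i : I} (A : (T.obj (T.obj X)).fib i) :
    Arrow.mk ((T.μ Y i).map ((T.map₂ (T.map₂ θ) i).app A)) =
      Arrow.mk ((T.map₂ θ i).app ((T.μ X i).obj A)) := by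
  have h := T.twoMonad.μ_nat₂ θ
  refine (congrArg (fun κ => Arrow.mk ((κ i).app A)) h).trans ?_
  exact arrow_conj (T.μ X ◁ T.map₂ θ) _ _ i A

/-- The 2-monad `T/Σ`: the coidentifier, in 2-monads and computed fibrewise, of the permutative
maps of the 2-monad of `T`. -/
def quotMonad (T : Operad I) : TwoMonad (CatOver I) where
  obj := T.quotObj
  map := quotMap₁
  map₂ := quotMap₂
  map_id X := q_fullSurj.cancel ((q_quotMap₁ (T := T) (𝟙 X)).trans
    (congrArg (fun k => k ≫ T.q X) (T.twoMonad.map_id X)))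
  map_comp {X Y Z} f g := q_fullSurj.cancel (
    calc T.q X ≫ quotMap₁ (f ≫ g)
        = T.map (f ≫ g) ≫ T.q Z := q_quotMap₁ _
      _ = T.map f ≫ T.map g ≫ T.q Z := congrArg (fun k => k ≫ T.q Z) (tmap_comp f g)
      _ = T.map f ≫ T.q Y ≫ quotMap₁ g := by rw [q_quotMap₁]
      _ = T.q X ≫ quotMap₁ f ≫ quotMap₁ g :=
        congrArg (fun k => k ≫ quotMap₁ g) (q_quotMap₁ f).symm)
  map₂_id {X Y} f := by
    refine (cell_ext_q q_fullSurj rfl rfl fun i A => (quotMap₂_app (T := T) (𝟙 f) A).trans ?_).trans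
      ((Category.id_comp _).trans (Category.comp_id _))
    rw [map₂_id']
    refine (congrArg Arrow.mk ((T.q Y i).map_id ((T.map f i).obj A))).trans ?_
    exact congrArg (fun x => Arrow.mk (𝟙 x)) (obj_congr (q_quotMap₁ f) A).symm
  map₂_comp {X Y f g h} θ κ := by
    refine (cell_ext_q q_fullSurj rfl rfl fun i A => (quotMap₂_app (T := T) (θ ≫ κ) A).trans ?_).trans
      ((Category.id_comp _).trans (Category.comp_id _))
    refine Eq.trans ?_ (arrow_mk_comp_congr (quotMap₂_app (T := T) θ A).symm
      (quotMap₂_app (T := T) κ A).symm)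
    rw [map₂_comp']
    exact congrArg Arrow.mk ((T.q Y i).map_comp _ _)
  map₂_whiskerLeft f _ _ θ := cell_ext_q q_fullSurj _ _ fun i A => by
    refine (quotMap₂_app (T := T) _ A).trans ?_
    refine Eq.trans ?_ (arrow_app_congr (quotMap₂ (T := T) θ) (obj_congr (q_quotMap₁ f) A)).symm
    exact (quotMap₂_app (T := T) θ ((T.map f i).obj A)).symm
  map₂_whiskerRight θ h := cell_ext_q q_fullSurj _ _ fun i A => by
    refine (quotMap₂_app (T := T) _ A).trans ?_
    refine Eq.trans ?_ (arrow_mk_map_congr (quotMap₁ h i) (quotMap₂_app (T := T) θ A)).symm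
    exact (arrow_congr (q_quotMap₁ h) ((T.map₂ θ i).app A)).symm
  η X := T.η X ≫ T.q X
  μ := quotμ
  η_nat {X Y} f :=
    calc f ≫ T.η Y ≫ T.q Y = T.η X ≫ T.map f ≫ T.q Y :=
          congrArg (fun k => k ≫ T.q Y) (T.twoMonad.η_nat f)
      _ = T.η X ≫ T.q X ≫ quotMap₁ f := by rw [q_quotMap₁]
  η_nat₂ {X Y f g} θ := CatOver.cell_ext _ _ fun i x =>
    (quotMap₂_app (T := T) θ ((T.η X i).obj x)).symm
  μ_nat f := quotμ_nat f
  μ_nat₂ {X Y f g} θ := cell_ext_q qq_fullSurj _ _ fun i A => by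
    refine (arrow_mk_map_congr (quotμ Y i) (qq_quotMap₂ θ A)).trans ?_
    refine (arrow_congr qq_quotμ ((T.map₂ (T.map₂ θ) i).app A)).trans ?_
    refine Eq.trans ?_ (arrow_app_congr (quotMap₂ (T := T) θ) (obj_congr qq_quotμ A)).symm
    refine Eq.trans ?_ (quotMap₂_app (T := T) θ ((T.μ X i).obj A)).symm
    exact arrow_mk_map_congr (T.q Y i) (μ_nat₂' θ A)
  left_unit X := quot_left_unit X
  right_unit X := quot_right_unit X
  assoc X := quot_assoc X

/-- The projection `T ⟶ T/Σ`. -/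
def quotHom (T : Operad I) : TwoMonad.Hom T.twoMonad T.quotMonad where
  app := T.q
  nat f := (q_quotMap₁ f).symm
  nat₂ θ := CatOver.cell_ext _ _ fun _ A => (quotMap₂_app θ A).symm
  unit _ := rfl
  mul _ := qq_quotμ.symm

/-- The universal property of `T/Σ` among 2-monads: every morphism of 2-monads out of `T` which
sends permutative maps to identities factors uniquely through `T/Σ`. -/
theorem existsUnique_quotHom (T : Operad I) (S : TwoMonad (CatOver I))
    (p : TwoMonad.Hom T.twoMonad S) (hp : ∀ X : CatOver I, Killing (T := T) (p.app X)) :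
    ∃! r : TwoMonad.Hom T.quotMonad S, ∀ X, T.q X ≫ r.app X = p.app X := by
  obtain ⟨P, pn, pn₂, pu, pm⟩ := p
  change ∀ X, T.obj X ⟶ S.obj X at P
  replace hp : ∀ X, Killing (T := T) (P X) := hp
  obtain ⟨R, hq⟩ : ∃ R : ∀ X, T.quotObj X ⟶ S.obj X, ∀ X, T.q X ≫ R X = P X :=
    ⟨fun X => lift (hp X), fun X => q_lift (hp X)⟩
  have hn : ∀ {X Y : CatOver I} (f : X ⟶ Y), T.map f ≫ P Y = P X ≫ S.map f :=
    fun f => pn f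
  have hm : ∀ X : CatOver I, T.μ X ≫ P X = T.map (P X) ≫ P (S.obj X) ≫ S.μ X :=
    fun X => pm X
  have nat : ∀ {X Y : CatOver I} (f : X ⟶ Y),
      quotMap₁ f ≫ R Y = R X ≫ S.map f := fun {X Y} f => by
    refine q_fullSurj.cancel (?_ : T.q X ≫ _ = T.q X ≫ _)
    calc T.q X ≫ quotMap₁ f ≫ R Y = (T.q X ≫ quotMap₁ f) ≫ R Y := rfl
      _ = T.map f ≫ T.q Y ≫ R Y := by rw [q_quotMap₁]; rfl
      _ = P X ≫ S.map f := by rw [hq, hn]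
      _ = T.q X ≫ R X ≫ S.map f := by rw [← hq]; rfl
  refine ⟨⟨R, nat, fun {X Y f g} θ => ?_, fun X => ?_, fun X => ?_⟩, hq, ?_⟩
  · refine cell_ext_q q_fullSurj _ _ fun i A => ?_
    refine (arrow_mk_map_congr (R Y i) (quotMap₂_app θ A)).trans ?_
    refine (arrow_congr (hq Y) _).trans ?_
    refine Eq.trans ?_ (arrow_app_congr (S.map₂ θ) (obj_congr (hq X) A)).symm
    refine (congrArg (fun κ => Arrow.mk ((κ i).app A)) (pn₂ θ)).trans ?_
    exact arrow_conj (P X ◁ S.map₂ θ) _ _ i A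
  · exact (congrArg (fun k => T.η X ≫ k) (hq X)).trans (pu X)
  · refine qq_fullSurj.cancel (?_ : T.qq X ≫ _ = T.qq X ≫ _)
    calc T.qq X ≫ quotμ X ≫ R X = (T.qq X ≫ quotμ X) ≫ R X := rfl
      _ = T.μ X ≫ T.q X ≫ R X := by rw [qq_quotμ]; rfl
      _ = T.map (P X) ≫ P (S.obj X) ≫ S.μ X := by rw [hq, hm]
      _ = T.map (T.q X ≫ R X) ≫ (T.q _ ≫ R (S.obj X)) ≫ S.μ X := by
          rw [hq, hq]
      _ = T.map (T.q X) ≫ (T.map (R X) ≫ T.q _) ≫ R (S.obj X) ≫ S.μ X := by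
          rw [tmap_comp]; rfl
      _ = T.qq X ≫ quotMap₁ (R X) ≫ R (S.obj X) ≫ S.μ X := by
          rw [← q_quotMap₁]; rfl
  · rintro ⟨r, _, _, _, _⟩ hr
    obtain rfl : r = R := funext fun X =>
      q_fullSurj.cancel ((hr X).trans (hq X).symm)
    rfl

end

end Operad

/-! ## Lax morphisms of operads into `Cat` -/

namespace CatOver

variable (H : CatOver I)

/-- Permutation of the factors: `(x_j)_j ↦ (x_{ρ j})_j`. -/
abbrev perm {m n : ℕ} (s : Fin n → I) (ρ : Fin m ≃ Fin n) :
    (∀ j, H.fib (s j)) ⥤ ∀ j, H.fib (s (ρ j)) :=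
  Pi.comap (fun j => H.fib (s j)) ρ

/-- The isomorphism of `H_i` with a one-fold product. -/
def single (i : I) : H.fib i ⥤ ∀ _ : Fin 1, H.fib i where
  obj x := fun _ => x
  map f := fun _ => f

/-- The isomorphism of an iterated product with a product: `((x_{jk})_k)_j ↦ (x_{jk})_{jk}`. -/
def join {n : ℕ} {m : Fin n → ℕ} (t : ∀ j, Fin (m j) → I) :
    (∀ j k, H.fib (t j k)) ⥤ ∀ l, H.fib (concat t l) where
  obj x := fun l => x (dec l).1 (dec l).2
  map f := fun l => f (dec l).1 (dec l).2

end CatOver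

/-- The labelled operation `(α, x)`. -/
abbrev LOp.mk' {T : Collection I} {H : CatOver I} {n : ℕ} {s : Fin n → I} {i : I} (α : T.Arr s i)
    (x : ∀ j, H.fib (s j)) : LOp T H i :=
  ⟨⟨n, s, α⟩, x⟩

lemma LOp.comp_act {T : Operad I} {H : CatOver I} {n n' : ℕ} {s : Fin n → I} {i : I}
    (α : T.Arr s i) {m : Fin n → ℕ} {t : ∀ j, Fin (m j) → I} (β : ∀ j, T.Arr (t j) (s j))
    (ρ : Fin n' ≃ Fin n) {m' : Fin n' → ℕ} (τ : ∀ j, Fin (m' j) ≃ Fin (m (ρ j)))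
    (x : ∀ j k, H.fib (t j k)) :
    LOp.mk' (T.comp (T.act α ρ) fun j => T.act (β (ρ j)) (τ j))
        ((H.join fun j k => t (ρ j) (τ j k)).obj fun j k => x (ρ j) (τ j k)) =
      LOp.mk' (T.act (T.comp α β) (blockPerm ρ τ))
        ((H.perm (concat t) (blockPerm ρ τ)).obj ((H.join t).obj x)) :=
  LOp.ext' (T.comp_act α β ρ τ) fun l l' h => by
    obtain rfl := Fin.ext h
    exact (congrArg (fun p : Σ j, Fin (m j) => (⟨t p.1 p.2, x p.1 p.2⟩ : Σ i, H.fib i))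
      (Operad.dec_blockPerm ρ τ l)).symm

/-- The structure of a lax morphism of operads `T ⟶ Cat` on the family of categories `H`:
products `H_α`, symmetries `ξ_{α,ρ}`, units `ν_i` and substitutions `σ_{α,(β_j)_j}`.  In the axioms,
`IsId` and equations between `Arrow.mk`s express equations of morphisms whose sources, or targets,
are equal by the axioms of the operad `T`. -/
structure LaxOpMor (T : Operad I) (H : CatOver I) where
  prod : ∀ {n : ℕ} {s : Fin n → I} {i : I} (_ : T.Arr s i), (∀ j, H.fib (s j)) ⥤ H.fib i
  sym : ∀ {m n : ℕ} {s : Fin n → I} {i : I} (α : T.Arr s i) (ρ : Fin m ≃ Fin n),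
    H.perm s ρ ⋙ prod (T.act α ρ) ⟶ prod α
  unit : ∀ i : I, 𝟭 (H.fib i) ⟶ H.single i ⋙ prod (T.one i)
  sub : ∀ {n : ℕ} {s : Fin n → I} {i : I} (α : T.Arr s i) {m : Fin n → ℕ}
    {t : ∀ j, Fin (m j) → I} (β : ∀ j, T.Arr (t j) (s j)),
    Functor.pi (fun j => prod (β j)) ⋙ prod α ⟶ H.join t ⋙ prod (T.comp α β)
  sym_refl : ∀ {n : ℕ} {s : Fin n → I} {i : I} (α : T.Arr s i) (x : ∀ j, H.fib (s j)),
    IsId ((sym α (Equiv.refl _)).app x)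
  sym_trans : ∀ {l m n : ℕ} {s : Fin n → I} {i : I} (α : T.Arr s i) (ρ₁ : Fin m ≃ Fin n)
    (ρ₂ : Fin l ≃ Fin m) (x : ∀ j, H.fib (s j)),
    Arrow.mk ((sym α (ρ₂.trans ρ₁)).app x) =
      Arrow.mk ((sym (T.act α ρ₁) ρ₂).app ((H.perm s ρ₁).obj x) ≫ (sym α ρ₁).app x)
  sub_unit : ∀ {n : ℕ} {s : Fin n → I} {i : I} (α : T.Arr s i) (x : ∀ j, H.fib (s j)),
    IsId ((prod α).map (fun j => (unit (s j)).app (x j)) ≫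
      (sub α fun j => T.one (s j)).app fun j _ => x j)
  unit_sub : ∀ {n : ℕ} {s : Fin n → I} {i : I} (α : T.Arr s i) (x : ∀ j, H.fib (s j)),
    IsId ((unit i).app ((prod α).obj x) ≫ (sub (T.one i) fun _ => α).app fun _ => x)
  sym_sub : ∀ {n n' : ℕ} {s : Fin n → I} {i : I} (α : T.Arr s i) {m : Fin n → ℕ}
    {t : ∀ j, Fin (m j) → I} (β : ∀ j, T.Arr (t j) (s j)) (ρ : Fin n' ≃ Fin n)
    {m' : Fin n' → ℕ} (τ : ∀ j, Fin (m' j) ≃ Fin (m (ρ j))) (x : ∀ j k, H.fib (t j k)),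
    (sub (T.act α ρ) fun j => T.act (β (ρ j)) (τ j)).app (fun j k => x (ρ j) (τ j k)) ≫
        eqToHom (congrArg (fun A : LOp T.toCollection H i => (prod A.op.arr).obj A.lab)
          (LOp.comp_act α β ρ τ x)) ≫
        (sym (T.comp α β) (blockPerm ρ τ)).app ((H.join t).obj x) =
      (prod (T.act α ρ)).map (fun j => (sym (β (ρ j)) (τ j)).app (x (ρ j))) ≫
        (sym α ρ).app (fun j => (prod (β j)).obj (x j)) ≫ (sub α β).app x
  sub_sub : ∀ {n : ℕ} {s : Fin n → I} {i : I} (α : T.Arr s i) {m : Fin n → ℕ}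
    {t : ∀ j, Fin (m j) → I} (β : ∀ j, T.Arr (t j) (s j)) {p : ∀ j, Fin (m j) → ℕ}
    {r : ∀ j k, Fin (p j k) → I} (γ : ∀ j k, T.Arr (r j k) (t j k))
    (x : ∀ j k l, H.fib (r j k l)),
    Arrow.mk ((prod α).map (fun j => (sub (β j) (γ j)).app (x j)) ≫
        (sub α fun j => T.comp (β j) (γ j)).app fun j => (H.join (r j)).obj (x j)) =
      Arrow.mk ((sub α β).app (fun j k => (prod (γ j k)).obj (x j k)) ≫
        (sub (T.comp α β) fun l => γ (dec l).1 (dec l).2).app fun l => x (dec l).1 (dec l).2)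

/-- A lax morphism is commutative when its symmetries are identities. -/
def LaxOpMor.IsCommutative {T : Operad I} {H : CatOver I} (M : LaxOpMor T H) : Prop :=
  ∀ {m n : ℕ} {s : Fin n → I} {i : I} (α : T.Arr s i) (ρ : Fin m ≃ Fin n),
    ∃ h : H.perm s ρ ⋙ M.prod (T.act α ρ) = M.prod α, M.sym α ρ = eqToHom h

section naturality

variable {T : Operad I} {H K : CatOver I}

/-- The structure of a lax-natural transformation on a family of functors `f_i : H_i ⟶ K_i`:
natural transformations `K_α (∏_j f_{i_j}) ⟶ f_i H_α` compatible with symmetries, units and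
substitutions. -/
@[ext]
structure LaxNat (M : LaxOpMor T H) (N : LaxOpMor T K) (f : H ⟶ K) where
  cell : ∀ {n : ℕ} {s : Fin n → I} {i : I} (α : T.Arr s i),
    Functor.pi (fun j => f (s j)) ⋙ N.prod α ⟶ M.prod α ⋙ f i
  sym : ∀ {m n : ℕ} {s : Fin n → I} {i : I} (α : T.Arr s i) (ρ : Fin m ≃ Fin n)
    (x : ∀ j, H.fib (s j)),
    (cell (T.act α ρ)).app ((H.perm s ρ).obj x) ≫ (f i).map ((M.sym α ρ).app x) =
      (N.sym α ρ).app (fun j => (f (s j)).obj (x j)) ≫ (cell α).app x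
  unit : ∀ (i : I) (x : H.fib i),
    (N.unit i).app ((f i).obj x) ≫ (cell (T.one i)).app (fun _ => x) =
      (f i).map ((M.unit i).app x)
  sub : ∀ {n : ℕ} {s : Fin n → I} {i : I} (α : T.Arr s i) {m : Fin n → ℕ}
    {t : ∀ j, Fin (m j) → I} (β : ∀ j, T.Arr (t j) (s j)) (x : ∀ j k, H.fib (t j k)),
    (N.sub α β).app (fun j k => (f (t j k)).obj (x j k)) ≫
        (cell (T.comp α β)).app ((H.join t).obj x) =
      (N.prod α).map (fun j => (cell (β j)).app (x j)) ≫
        (cell α).app (fun j => (M.prod (β j)).obj (x j)) ≫ (f i).map ((M.sub α β).app x)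

/-- The structure of a colax-natural transformation: natural transformations
`f_i H_α ⟶ K_α (∏_j f_{i_j})` compatible with symmetries, units and substitutions. -/
@[ext]
structure ColaxNat (M : LaxOpMor T H) (N : LaxOpMor T K) (f : H ⟶ K) where
  cell : ∀ {n : ℕ} {s : Fin n → I} {i : I} (α : T.Arr s i),
    M.prod α ⋙ f i ⟶ Functor.pi (fun j => f (s j)) ⋙ N.prod α
  sym : ∀ {m n : ℕ} {s : Fin n → I} {i : I} (α : T.Arr s i) (ρ : Fin m ≃ Fin n)
    (x : ∀ j, H.fib (s j)),
    (cell (T.act α ρ)).app ((H.perm s ρ).obj x) ≫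
        (N.sym α ρ).app (fun j => (f (s j)).obj (x j)) =
      (f i).map ((M.sym α ρ).app x) ≫ (cell α).app x
  unit : ∀ (i : I) (x : H.fib i),
    (f i).map ((M.unit i).app x) ≫ (cell (T.one i)).app (fun _ => x) =
      (N.unit i).app ((f i).obj x)
  sub : ∀ {n : ℕ} {s : Fin n → I} {i : I} (α : T.Arr s i) {m : Fin n → ℕ}
    {t : ∀ j, Fin (m j) → I} (β : ∀ j, T.Arr (t j) (s j)) (x : ∀ j k, H.fib (t j k)),
    (f i).map ((M.sub α β).app x) ≫ (cell (T.comp α β)).app ((H.join t).obj x) =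
      (cell α).app (fun j => (M.prod (β j)).obj (x j)) ≫
        (N.prod α).map (fun j => (cell (β j)).app (x j)) ≫
        (N.sub α β).app (fun j k => (f (t j k)).obj (x j k))

variable (M : LaxOpMor T H) (N : LaxOpMor T K)

/-- A pseudo-natural transformation: a lax-natural one with invertible cells. -/
def PseudoNat (f : H ⟶ K) :=
  {φ : LaxNat M N f // ∀ {n : ℕ} {s : Fin n → I} {i : I} (α : T.Arr s i), IsIso (φ.cell α)}

/-- A natural transformation: a lax-natural one whose cells are identities. -/
def StrictNat (f : H ⟶ K) :=
  {φ : LaxNat M N f // ∀ {n : ℕ} {s : Fin n → I} {i : I} (α : T.Arr s i),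
    ∃ h : Functor.pi (fun j => f (s j)) ⋙ N.prod α = M.prod α ⋙ f i, φ.cell α = eqToHom h}

variable {M N}

/-- The family of natural transformations `θ_i : f_i ⟶ g_i` is a modification between lax-natural
transformations. -/
def IsModification {f g : H ⟶ K} (φ : LaxNat M N f) (γ : LaxNat M N g) (θ : f ⟶ g) : Prop :=
  ∀ {n : ℕ} {s : Fin n → I} {i : I} (α : T.Arr s i) (x : ∀ j, H.fib (s j)),
    (φ.cell α).app x ≫ (θ i).app ((M.prod α).obj x) =
      (N.prod α).map (fun j => (θ (s j)).app (x j)) ≫ (γ.cell α).app x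

/-- The family of natural transformations `θ_i : f_i ⟶ g_i` is a modification between
colax-natural transformations. -/
def IsColaxModification {f g : H ⟶ K} (φ : ColaxNat M N f) (γ : ColaxNat M N g) (θ : f ⟶ g) :
    Prop :=
  ∀ {n : ℕ} {s : Fin n → I} {i : I} (α : T.Arr s i) (x : ∀ j, H.fib (s j)),
    (φ.cell α).app x ≫ (N.prod α).map (fun j => (θ (s j)).app (x j)) =
      (θ i).app ((M.prod α).obj x) ≫ (γ.cell α).app x

end naturality

/-! ## Comparison of operad morphisms into `Cat` with algebras of `T/Σ` -/

section comparison

variable {T : Operad I} {H K : CatOver I}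

/-- The functor `x ↦ (α, x)`, onto the levelwise maps. -/
def LOp.ins (H : CatOver I) {n : ℕ} {s : Fin n → I} {i : I} (α : T.Arr s i) :
    (∀ j, H.fib (s j)) ⥤ LOp T.toCollection H i where
  obj x := LOp.mk' α x
  map f := LOp.lev ⟨n, s, α⟩ f
  map_id x := LOp.Hom.ext' (fun _ => rfl) fun _ => rfl
  map_comp f g := LOp.Hom.ext' (fun _ => rfl) fun _ => rfl

/-- A lax `T/Σ`-algebra structure and the structure of a lax morphism `T ⟶ Cat`, on the same family
of categories, correspond to each other when the action takes the class of `(α, x)` to `H_α(x)`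
(functorially in `x`), the unit of the algebra has the components of `ν`, and its multiplication
cell has the components of `σ`. -/
structure Corresponds (𝒜 : TwoMonad.LaxAlg T.quotMonad H) (M : LaxOpMor T H) : Prop where
  act : ∀ {n : ℕ} {s : Fin n → I} {i : I} (α : T.Arr s i),
    LOp.ins H α ⋙ T.q H i ⋙ 𝒜.act i = M.prod α
  unit : ∀ (i : I) (x : H.fib i),
    Arrow.mk ((𝒜.unit i).app x) = Arrow.mk ((M.unit i).app x)
  mul : ∀ {n : ℕ} {s : Fin n → I} {i : I} (α : T.Arr s i) {m : Fin n → ℕ}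
    {t : ∀ j, Fin (m j) → I} (β : ∀ j, T.Arr (t j) (s j)) (x : ∀ j k, H.fib (t j k)),
    Arrow.mk ((𝒜.mul i).app ((T.qq H i).obj (LOp.mk' α fun j => LOp.mk' (β j) (x j)))) =
      Arrow.mk ((M.sub α β).app x)

variable {M : LaxOpMor T H} {N : LaxOpMor T K} {𝒜 : TwoMonad.LaxAlg T.quotMonad H}
  {ℬ : TwoMonad.LaxAlg T.quotMonad K} {f : H ⟶ K}

/-- The cell of a lax morphism of algebras has the components of the cells of a lax-natural
transformation. -/
def SameCells (φ : TwoMonad.LaxMor 𝒜 ℬ f) (ψ : LaxNat M N f) : Prop :=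
  ∀ {n : ℕ} {s : Fin n → I} {i : I} (α : T.Arr s i) (x : ∀ j, H.fib (s j)),
    Arrow.mk ((φ.cell i).app ((T.q H i).obj (LOp.mk' α x))) = Arrow.mk ((ψ.cell α).app x)

/-- The cell of a colax morphism of algebras has the components of the cells of a colax-natural
transformation. -/
def SameColaxCells (φ : TwoMonad.ColaxMor 𝒜 ℬ f) (ψ : ColaxNat M N f) : Prop :=
  ∀ {n : ℕ} {s : Fin n → I} {i : I} (α : T.Arr s i) (x : ∀ j, H.fib (s j)),
    Arrow.mk ((φ.cell i).app ((T.q H i).obj (LOp.mk' α x))) = Arrow.mk ((ψ.cell α).app x)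

end comparison

end operads

/-! ### Arrows compared up to equality of their endpoints. -/

section arrows

universe v₁ u₁

variable {C : Type u₁} [Category.{v₁} C]

/-! The projection `q : TH ⟶ (T/Σ)H` is fibrewise full and surjective on objects, and so are the
projections `qq` and `qqq` from `TTH` and `TTTH` to the iterates of `T/Σ`. Consequently a 2-cell out
of `(T/Σ)H` is the same thing as a 2-cell over `TH` between the restricted 1-cells, and an equation
between such 2-cells can be tested at the classes of labelled operations `(α, x)`.

Every morphism of `TH` is a levelwise one, coming from a product `∏_j H_{i_j}`, followed by a
permutative one (`LOp.exists_lev_permutative`). A functor on `TH` that sends permutative morphisms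
to identities is therefore given by functors `H_α` on the products with `H_{αρ} c_ρ = H_α`. This is
what commutativity provides, and it yields `IsCommutative.eval`, whose descent along `q` is the
action. Likewise a 2-cell between 1-cells out of `(T/Σ)H` is a family of transformations on the
products whose components at `(αρ, x_ρ)` and `(α, x)` agree (`Operad.existsUnique_cell`,
`Operad.family_sym`).

For (0), the unit is `ν`, and the multiplication is `σ` on `TTH`, descended along `qq`
(`IsCommutative.existsUnique_mul`). Its naturality splits into naturality of `σ` for levelwise
morphisms and equivariance for morphisms that only permute. At labelled operations the algebra laws
are the unit and associativity laws of `(ν, σ)`.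

For (1), the symmetry axiom of a lax-natural transformation, with all symmetries identities, is the
descent condition on its family of cells (`lax_sym_iff`). The unit and substitution axioms are the
components of the two morphism laws (`lax_unit_iff`, `lax_mul_iff`), and the colax case is parallel.
Invertibility and identity of cells, and the condition in (2), are again tested on components.

Sources and targets often agree only propositionally. Equations are therefore handled as equalities
of `Arrow.mk`, and inserted `eqToHom`s are discarded through `IsId`. -/

lemma IsId.arrow_comp_comp {x y y' z a b c : C} {e : y ⟶ y'} (he : IsId e) {f : x ⟶ y}
    {g : y' ⟶ z} {f' : a ⟶ b} {g' : b ⟶ c} (hf : Arrow.mk f = Arrow.mk f')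
    (hg : Arrow.mk g = Arrow.mk g') : Arrow.mk (f ≫ e ≫ g) = Arrow.mk (f' ≫ g') := by
  obtain ⟨rfl, rfl⟩ := he
  rw [eqToHom_refl, Category.id_comp]
  exact arrow_mk_comp_congr hf hg

lemma arrow_mk_tgt {x y x' y' : C} {f : x ⟶ y} {g : x' ⟶ y'} (h : Arrow.mk f = Arrow.mk g) :
    y = y' :=
  congrArg Comma.right h

lemma arrow_mk_src {x y x' y' : C} {f : x ⟶ y} {g : x' ⟶ y'} (h : Arrow.mk f = Arrow.mk g) :
    x = x' :=
  congrArg Comma.left h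

/-- For naturality squares along permutative morphisms: both functors send these to identities, so
the square commutes once the two components coincide as arrows. -/
lemma IsId.square {x y z t : C} {f : x ⟶ y} {g : z ⟶ t} (hf : IsId f) (hg : IsId g) {a : x ⟶ z}
    {b : y ⟶ t} (h : Arrow.mk a = Arrow.mk b) : f ≫ b = a ≫ g :=
  arrow_mk_inj ((hf.arrow_comp b).trans (h.symm.trans (hg.arrow_comp' a).symm))

lemma isIso_congr {x y x' y' : C} {f : x ⟶ y} {g : x' ⟶ y'} (h : Arrow.mk f = Arrow.mk g) :
    IsIso f ↔ IsIso g := by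
  obtain ⟨h₁, h₂, rfl⟩ := (Arrow.mk_eq_mk_iff _ _).1 h
  subst h₁ h₂
  simp

lemma isId_congr {x y x' y' : C} {f : x ⟶ y} {g : x' ⟶ y'} (h : Arrow.mk f = Arrow.mk g) :
    IsId f ↔ IsId g :=
  ⟨fun hf => hf.congr h, fun hg => hg.congr h.symm⟩

/-- Used to pass between a coherence law and an axiom whose endpoints agree with those of the law
only propositionally. -/
lemma eq_congr {x y z t : C} {f g : x ⟶ y} {f' g' : z ⟶ t}
    (h : Arrow.mk f = Arrow.mk f') (h' : Arrow.mk g = Arrow.mk g') : f = g ↔ f' = g' := by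
  constructor
  · rintro rfl
    exact arrow_mk_inj (h.symm.trans h')
  · rintro rfl
    exact arrow_mk_inj (h.trans h'.symm)

universe v₂ u₂

variable {D : Type u₂} [Category.{v₂} D]

lemma arrow_natTrans_app {F G F' G' : C ⥤ D} {θ : F ⟶ G} {κ : F' ⟶ G'}
    (h : Arrow.mk θ = Arrow.mk κ) (x : C) : Arrow.mk (θ.app x) = Arrow.mk (κ.app x) := by
  obtain ⟨h₁, h₂, rfl⟩ := (Arrow.mk_eq_mk_iff _ _).1 h
  subst h₁ h₂
  simp

lemma arrow_app_obj {F G : C ⥤ D} (θ : F ⟶ G) {x y : C} (h : x = y) :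
    Arrow.mk (θ.app x) = Arrow.mk (θ.app y) := by
  subst h
  rfl

lemma functor_obj_congr {F G : C ⥤ D} (h : F = G) (x : C) : F.obj x = G.obj x := by
  subst h
  rfl

lemma functor_map_congr {F G : C ⥤ D} (h : F = G) {x y : C} (f : x ⟶ y) :
    Arrow.mk (F.map f) = Arrow.mk (G.map f) := by
  subst h
  rfl

/-- Identity components force `F = G`, because naturality then makes the functors agree on
morphisms. Strictness can thus be tested componentwise. -/
lemma natTrans_eq_eqToHom_iff {F G : C ⥤ D} (θ : F ⟶ G) :
    (∃ h : F = G, θ = eqToHom h) ↔ ∀ x, IsId (θ.app x) := by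
  constructor
  · rintro ⟨rfl, rfl⟩ x
    exact isId_refl _
  · intro h
    have e : F = G := Arrow.functor_ext fun x y f => by
      refine ((h y).arrow_comp' (F.map f)).symm.trans ?_
      rw [θ.naturality]
      exact (h x).arrow_comp _
    subst e
    refine ⟨rfl, ?_⟩
    ext x
    exact (h x).eq (isId_refl _)

end arrows

/-! ### Componentwise criteria for 2-cells, and morphisms of the total category. -/

section operads

variable {I : Type u}

namespace CatOver

variable {X Y Z : CatOver I}

lemma cell_eq_iff {f g : X ⟶ Y} {θ κ : f ⟶ g} : θ = κ ↔ ∀ i x, (θ i).app x = (κ i).app x := by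
  constructor
  · rintro rfl _ _
    rfl
  · intro h
    funext i
    ext x
    exact h i x

lemma cell_eq_eqToHom_iff {f g : X ⟶ Y} (θ : f ⟶ g) :
    (∃ h : f = g, θ = eqToHom h) ↔ ∀ i x, IsId ((θ i).app x) := by
  constructor
  · rintro ⟨rfl, rfl⟩ i x
    exact isId_refl _
  · intro h
    choose e he using fun i => (natTrans_eq_eqToHom_iff (θ i)).2 (h i)
    obtain rfl : f = g := funext e
    exact ⟨rfl, funext he⟩

lemma isId_eqToHom_app {f g : X ⟶ Y} (h : f = g) (i : I) (x : X.fib i) :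
    IsId ((eqToHom h i).app x) :=
  (cell_eq_eqToHom_iff (eqToHom h)).1 ⟨h, rfl⟩ i x

lemma isIso_cell_iff {f g : X ⟶ Y} (θ : f ⟶ g) : IsIso θ ↔ ∀ i x, IsIso ((θ i).app x) := by
  constructor
  · intro h i x
    refine ⟨(inv θ i).app x, ?_, ?_⟩
    · exact congrArg (fun κ : f ⟶ f => (κ i).app x) (IsIso.hom_inv_id θ)
    · exact congrArg (fun κ : g ⟶ g => (κ i).app x) (IsIso.inv_hom_id θ)
  · intro h
    have h' : ∀ i, IsIso (θ i) := fun i => (NatTrans.isIso_iff_isIso_app _).2 (h i)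
    exact ⟨fun i => inv (θ i), funext fun i => IsIso.hom_inv_id (θ i),
      funext fun i => IsIso.inv_hom_id (θ i)⟩

/-- The inclusion of a fibre into the total category, on morphisms. -/
abbrev incl {i : I} {x y : X.fib i} (f : x ⟶ y) :
    (⟨i, x⟩ : Σ i, X.fib i) ⟶ (⟨i, y⟩ : Σ i, X.fib i) := Sigma.SigmaHom.mk f

/-- The target of a morphism of the total category, in the fibre of its source. -/
def sigTgt : ∀ {a b : Σ i, X.fib i}, (a ⟶ b) → X.fib a.1
  | _, ⟨_, y⟩, .mk _ => y

/-- A morphism of the total category, as a morphism in the fibre of its source. -/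
def sigMap : ∀ {a b : Σ i, X.fib i} (g : a ⟶ b), a.2 ⟶ sigTgt g
  | _, _, .mk f => f

lemma arrow_sigMap : ∀ {a b : Σ i, X.fib i} (g : a ⟶ b),
    Arrow.mk (incl (sigMap g)) = Arrow.mk g
  | _, _, .mk _ => rfl

/-- For a fixed colour, the inclusion of the fibre in the total category is injective on objects and
morphisms. Labels are given as morphisms of the total category, and this brings their comparison
back to the fibre. -/
lemma arrow_sigma_mk_inj {i : I} {x y x' y' : X.fib i} {f : x ⟶ y} {g : x' ⟶ y'}
    (h : Arrow.mk (incl f) = Arrow.mk (incl g)) : Arrow.mk f = Arrow.mk g := by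
  have h₁ := arrow_mk_src h
  have h₂ := arrow_mk_tgt h
  simp only [Sigma.mk.injEq, heq_eq_eq, true_and] at h₁ h₂
  subst h₁ h₂
  have := arrow_mk_inj h
  injection this with _ _ _ this
  subst this
  rfl

lemma arrow_pi {J : Type} {s : J → I} {x y x' y' : ∀ j, X.fib (s j)} {f : x ⟶ y} {g : x' ⟶ y'}
    (h : ∀ j, Arrow.mk (f j) = Arrow.mk (g j)) : Arrow.mk f = Arrow.mk g := by
  obtain rfl : x = x' := funext fun j => arrow_mk_src (h j)
  obtain rfl : y = y' := funext fun j => arrow_mk_tgt (h j)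
  obtain rfl : f = g := funext fun j => arrow_mk_inj (h j)
  rfl

lemma isId_pi {J : Type} {s : J → I} {x y : ∀ j, X.fib (s j)} {f : x ⟶ y}
    (h : ∀ j, IsId (f j)) : IsId f := by
  choose e he using h
  obtain rfl : x = y := funext e
  exact ⟨rfl, funext he⟩

end CatOver

/-! ### Levelwise and permutative morphisms of `TX`. -/

namespace LOp

variable {T : Collection I} {X : CatOver I} {i : I}

/-- Every morphism is a levelwise morphism followed by a permutative one. -/
lemma exists_lev_permutative {A B : LOp T X i} (f : A ⟶ B) :
    ∃ (z : ∀ j, X.fib (A.op.src j)) (w : ∀ j, A.lab j ⟶ z j) (π : (⟨A.op, z⟩ : LOp T X i) ⟶ B),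
      permutative T X i π ∧ f = lev A.op w ≫ π ∧
        ∀ j, Arrow.mk (CatOver.incl (w j)) = Arrow.mk (f.map j) := by
  have e : ∀ j, (⟨A.op.src j, CatOver.sigTgt (f.map j)⟩ : Σ i, X.fib i) = B.pt (f.perm j) :=
    fun j => arrow_mk_tgt (CatOver.arrow_sigMap (f.map j))
  -- A label morphism stays in one fibre, so it can be performed before reindexing. The middle
  -- labels are its targets read over the colours of `A`, and `π` keeps the permutation with
  -- transports as its only labels.
  refine ⟨fun j => CatOver.sigTgt (f.map j), fun j => CatOver.sigMap (f.map j),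
    ⟨f.perm, f.op_eq, fun j => eqToHom (e j)⟩, fun j => isId_eqToHom (e j), ?_,
    fun j => CatOver.arrow_sigMap _⟩
  refine Hom.ext' (fun _ => rfl) fun j => ?_
  exact (CatOver.arrow_sigMap (f.map j)).symm.trans
    ((isId_eqToHom (e j)).arrow_comp' (Sigma.SigmaHom.mk (CatOver.sigMap (f.map j)))).symm

/-- Identity labels determine the source from the target and the permutation. Invariance under an
arbitrary permutative morphism thereby reduces to the pairs `(αρ, x_ρ)`, `(α, x)` that occur in the
axioms. -/
lemma eq_of_permutative {A B : LOp T X i} {π : A ⟶ B} (h : permutative T X i π) :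
    A = ⟨B.op.act π.perm, fun j => B.lab (π.perm j)⟩ :=
  ext' π.op_eq fun j j' hj => by
    obtain rfl : Fin.cast (congrArg Collection.Op.n π.op_eq) j = j' := Fin.ext hj
    exact (h j).choose

/-- The permutative morphism `(αρ, (x_{ρ j})_j) ⟶ (α, x)`. -/
def permHom {m n : ℕ} {s : Fin n → I} (α : T.Arr s i) (ρ : Fin m ≃ Fin n)
    (x : ∀ j, X.fib (s j)) :
    LOp.mk' (T.act α ρ) (fun j => x (ρ j)) ⟶ LOp.mk' α x :=
  ⟨ρ, rfl, fun _ => 𝟙 _⟩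

lemma permHom_permutative {m n : ℕ} {s : Fin n → I} (α : T.Arr s i) (ρ : Fin m ≃ Fin n)
    (x : ∀ j, X.fib (s j)) : permutative T X i (permHom α ρ x) := fun _ => isId_refl _

end LOp

/-! ### 2-cells out of `(T/Σ)H` as families of cells on products. -/

namespace Operad

variable {T : Operad I} {H K : CatOver I}

lemma q_obj_eq {i : I} {A B : (T.obj H).fib i} {π : A ⟶ B}
    (h : LOp.permutative T.toCollection H i π) : (T.q H i).obj A = (T.q H i).obj B :=
  (q_isId h).choose

section families

variable {F G : T.quotObj H ⟶ K}
  {P Q : ∀ {n : ℕ} {s : Fin n → I} {i : I} (_ : T.Arr s i), (∀ j, H.fib (s j)) ⥤ K.fib i}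

/-- A 2-cell out of `(T/Σ) H` with prescribed components. -/
lemma existsUnique_cell
    (hF : ∀ {n : ℕ} {s : Fin n → I} {i : I} (α : T.Arr s i), LOp.ins H α ⋙ T.q H i ⋙ F i = P α)
    (hG : ∀ {n : ℕ} {s : Fin n → I} {i : I} (α : T.Arr s i), LOp.ins H α ⋙ T.q H i ⋙ G i = Q α)
    (d : ∀ {n : ℕ} {s : Fin n → I} {i : I} (α : T.Arr s i), P α ⟶ Q α)
    (hd : ∀ {m n : ℕ} {s : Fin n → I} {i : I} (α : T.Arr s i) (ρ : Fin m ≃ Fin n)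
      (x : ∀ j, H.fib (s j)),
      Arrow.mk ((d (T.act α ρ)).app ((H.perm s ρ).obj x)) = Arrow.mk ((d α).app x)) :
    ∃! c : F ⟶ G, ∀ {n : ℕ} {s : Fin n → I} {i : I} (α : T.Arr s i) (x : ∀ j, H.fib (s j)),
      Arrow.mk ((c i).app ((T.q H i).obj (LOp.mk' α x))) = Arrow.mk ((d α).app x) := by
  have eF : ∀ {i : I} (A : (T.obj H).fib i), (F i).obj ((T.q H i).obj A) =
    (P A.op.arr).obj A.lab := fun A => functor_obj_congr (hF A.op.arr) A.lab
  have eG : ∀ {i : I} (A : (T.obj H).fib i), (G i).obj ((T.q H i).obj A) =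
    (Q A.op.arr).obj A.lab := fun A => functor_obj_congr (hG A.op.arr) A.lab
  let c : ∀ {i : I} (A : (T.obj H).fib i),
      (F i).obj ((T.q H i).obj A) ⟶ (G i).obj ((T.q H i).obj A) := fun A =>
    eqToHom (eF A) ≫ (d A.op.arr).app A.lab ≫ eqToHom (eG A).symm
  have hc : ∀ {i : I} (A : (T.obj H).fib i), Arrow.mk (c A) = Arrow.mk ((d A.op.arr).app A.lab) :=
    fun A => ((isId_eqToHom _).arrow_comp _).trans ((isId_eqToHom _).arrow_comp' _)
  -- The hypothesis `hd` enters here, after the source of `π` has been written as a reindexing of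
  -- its target.
  have hperm : ∀ {i : I} {A B : (T.obj H).fib i} (π : A ⟶ B),
      LOp.permutative T.toCollection H i π → Arrow.mk (c A) = Arrow.mk (c B) := by
    intro i A B π hπ
    refine Eq.trans ?_ ((hd B.op.arr π.perm B.lab).trans (hc B).symm)
    exact (congrArg (fun A : LOp T.toCollection H i => Arrow.mk (c A))
      (LOp.eq_of_permutative hπ)).trans (hc _)
  have nat : ∀ {i : I} {A B : (T.obj H).fib i} (f : A ⟶ B),
      (F i).map ((T.q H i).map f) ≫ c B = c A ≫ (G i).map ((T.q H i).map f) := by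
    intro i A B f
    obtain ⟨z, k, π, hπ, rfl, -⟩ := LOp.exists_lev_permutative f
    -- On the permutative factor both functors give identities, so the square reduces to `hperm`.
    have h1 := ((q_isId hπ).map (F i)).square ((q_isId hπ).map (G i)) (hperm π hπ)
    -- The levelwise factor is the image of `k` under `ins`, where `F` and `G` restrict to `P` and
    -- `Q`; the square is naturality of `d`.
    have h2 : (F i).map ((T.q H i).map (LOp.lev A.op k)) ≫ c ⟨A.op, z⟩ =
        c A ≫ (G i).map ((T.q H i).map (LOp.lev A.op k)) := by
      refine arrow_mk_inj ?_
      refine (arrow_mk_comp_congr (functor_map_congr (hF A.op.arr) k) (hc _)).trans ?_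
      refine (congrArg Arrow.mk ((d A.op.arr).naturality k)).trans ?_
      exact (arrow_mk_comp_congr (hc A) (functor_map_congr (hG A.op.arr) k)).symm
    simp only [Functor.map_comp, Category.assoc]
    rw [h1, ← Category.assoc, h2, Category.assoc]
  -- Naturality over `TH` is all that `desc₂` needs. When two objects have the same class, fullness
  -- lifts the identity between the classes to a morphism, and naturality along it makes the two
  -- components agree.
  refine ⟨fun i => (q_fullSurj i).desc₂ ⟨fun A => c A, fun A B f => nat f⟩, fun α x => ?_, ?_⟩
  · exact (congrArg Arrow.mk ((q_fullSurj _).desc₂_app _ _)).trans (hc _)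
  · intro c' hc'
    refine CatOver.cell_eq_iff.2 fun i y => ?_
    obtain ⟨A, rfl⟩ := (q_fullSurj i).surj y
    refine arrow_mk_inj ((hc' A.op.arr A.lab).trans ?_)
    exact ((congrArg Arrow.mk ((q_fullSurj _).desc₂_app _ _)).trans (hc A)).symm

/-- The restrictions of a 2-cell out of `(T/Σ) H` to the products. -/
lemma exists_family
    (hF : ∀ {n : ℕ} {s : Fin n → I} {i : I} (α : T.Arr s i), LOp.ins H α ⋙ T.q H i ⋙ F i = P α)
    (hG : ∀ {n : ℕ} {s : Fin n → I} {i : I} (α : T.Arr s i), LOp.ins H α ⋙ T.q H i ⋙ G i = Q α)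
    (c : F ⟶ G) :
    ∃ d : ∀ {n : ℕ} {s : Fin n → I} {i : I} (α : T.Arr s i), P α ⟶ Q α,
      ∀ {n : ℕ} {s : Fin n → I} {i : I} (α : T.Arr s i) (x : ∀ j, H.fib (s j)),
        Arrow.mk ((c i).app ((T.q H i).obj (LOp.mk' α x))) = Arrow.mk ((d α).app x) := by
  refine ⟨fun {n s i} α => eqToHom (hF α).symm ≫ Functor.whiskerLeft (LOp.ins H α ⋙ T.q H i) (c i) ≫
    eqToHom (hG α), fun {n s i} α x => ?_⟩
  refine arrow_natTrans_app (θ := Functor.whiskerLeft (LOp.ins H α ⋙ T.q H i) (c i)) ?_ x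
  exact (((isId_eqToHom _).arrow_comp _).trans ((isId_eqToHom _).arrow_comp' _)).symm

/-- The labelled operations `(αρ, x_ρ)` and `(α, x)` are joined by a permutative morphism, so they
have the same class and a cell on the quotient cannot separate them. -/
lemma family_sym {c : F ⟶ G}
    {d : ∀ {n : ℕ} {s : Fin n → I} {i : I} (α : T.Arr s i), P α ⟶ Q α}
    (h : ∀ {n : ℕ} {s : Fin n → I} {i : I} (α : T.Arr s i) (x : ∀ j, H.fib (s j)),
        Arrow.mk ((c i).app ((T.q H i).obj (LOp.mk' α x))) = Arrow.mk ((d α).app x))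
    {m n : ℕ} {s : Fin n → I} {i : I} (α : T.Arr s i) (ρ : Fin m ≃ Fin n)
    (x : ∀ j, H.fib (s j)) :
    Arrow.mk ((d (T.act α ρ)).app ((H.perm s ρ).obj x)) = Arrow.mk ((d α).app x) := by
  refine (h (T.act α ρ) _).symm.trans (Eq.trans ?_ (h α x))
  exact arrow_app_obj (c i) (q_obj_eq (LOp.permHom_permutative α ρ x))

end families

end Operad

/-! ### The functor `TH ⟶ H` of a commutative lax morphism. -/

namespace CatOver

variable {X : CatOver I}

/-- Gives a morphism of the total category a source that equals its own only propositionally, so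
that it can be composed inside a fibre. -/
lemma exists_fibre_map {i : I} {z : X.fib i} {a b : Σ i, X.fib i} (g : a ⟶ b)
    (h : (⟨i, z⟩ : Σ i, X.fib i) = a) :
    ∃ (z' : X.fib i) (k : z ⟶ z'), Arrow.mk (incl k) = Arrow.mk g := by
  subst h
  exact ⟨sigTgt g, sigMap g, arrow_sigMap g⟩

end CatOver

namespace LaxOpMor

variable {T : Operad I} {H : CatOver I} {M : LaxOpMor T H}

lemma IsCommutative.perm_prod (hM : M.IsCommutative) {m n : ℕ} {s : Fin n → I} {i : I}
    (α : T.Arr s i) (ρ : Fin m ≃ Fin n) : H.perm s ρ ⋙ M.prod (T.act α ρ) = M.prod α :=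
  (hM α ρ).choose

lemma IsCommutative.isId_sym (hM : M.IsCommutative) {m n : ℕ} {s : Fin n → I} {i : I}
    (α : T.Arr s i) (ρ : Fin m ≃ Fin n) (x : ∀ j, H.fib (s j)) : IsId ((M.sym α ρ).app x) :=
  (natTrans_eq_eqToHom_iff _).1 (hM α ρ) x

/-- Once `α` is replaced by `bρ`, this is the equality of functors `H_{bρ} c_ρ = H_b` applied to
`l`. The colours on the two sides agree only through `h`, which is why labels are compared in the
total category. -/
lemma IsCommutative.prod_map_congr (hM : M.IsCommutative) {n : ℕ} {s : Fin n → I} {i : I}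
    {α : T.Arr s i} {b : T.Op i} {ρ : Fin n ≃ Fin b.n} (h : (⟨n, s, α⟩ : T.Op i) = b.act ρ)
    {x x' : ∀ j, H.fib (s j)}
    {y y' : ∀ k, H.fib (b.src k)} {k : ∀ j, x j ⟶ x' j} {l : ∀ j, y j ⟶ y' j}
    (hk : ∀ j, Arrow.mk (CatOver.incl (k j)) = Arrow.mk (CatOver.incl (l (ρ j)))) :
    Arrow.mk ((M.prod α).map k) = Arrow.mk ((M.prod b.arr).map l) := by
  obtain ⟨-, h₁, h₂⟩ := Collection.Op.mk.inj h
  obtain rfl := eq_of_heq h₁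
  obtain rfl := eq_of_heq h₂
  refine Eq.trans ?_ (functor_map_congr (hM.perm_prod b.arr ρ) l)
  exact arrow_mk_map_congr _ (CatOver.arrow_pi fun j => CatOver.arrow_sigma_mk_inj (hk j))

/-- Obtained from `prod_map_congr` for identity morphisms, by taking sources. -/
lemma IsCommutative.prod_obj_congr (hM : M.IsCommutative) {n : ℕ} {s : Fin n → I} {i : I}
    {α : T.Arr s i} {b : T.Op i} {ρ : Fin n ≃ Fin b.n} (h : (⟨n, s, α⟩ : T.Op i) = b.act ρ)
    {x : ∀ j, H.fib (s j)}
    {y : ∀ k, H.fib (b.src k)}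
    (hx : ∀ j, (⟨_, x j⟩ : Σ i, H.fib i) = ⟨_, y (ρ j)⟩) :
    (M.prod α).obj x = (M.prod b.arr).obj y := by
  refine arrow_mk_src (hM.prod_map_congr h (k := fun j => 𝟙 (x j)) (l := fun j => 𝟙 (y j))
    fun j => ?_)
  exact congrArg (fun p : Σ i, H.fib i => Arrow.mk (𝟙 p)) (hx j)

/-- The functor `TH ⟶ H`, `(α, x) ↦ H_α(x)`, on morphisms. -/
def IsCommutative.evalMap (hM : M.IsCommutative) {i : I} {A B : (T.obj H).fib i} (f : A ⟶ B) :
    (M.prod A.op.arr).obj A.lab ⟶ (M.prod B.op.arr).obj B.lab :=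
  (M.prod A.op.arr).map (fun j => CatOver.sigMap (f.map j)) ≫
    eqToHom (hM.prod_obj_congr f.op_eq fun j => arrow_mk_tgt (CatOver.arrow_sigMap (f.map j)))

/-- The representatives chosen in `evalMap` do not matter: any fibrewise family with the right
arrows computes the value. Later computations with `eval` go through this freedom of choice. -/
lemma IsCommutative.arrow_evalMap (hM : M.IsCommutative) {i : I} {A B : (T.obj H).fib i}
    (f : A ⟶ B) {z z' : ∀ j, H.fib (A.op.src j)} (k : ∀ j, z j ⟶ z' j)
    (hk : ∀ j, Arrow.mk (CatOver.incl (k j)) = Arrow.mk (f.map j)) :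
    Arrow.mk (hM.evalMap f) = Arrow.mk ((M.prod A.op.arr).map k) := by
  refine ((isId_eqToHom _).arrow_comp' _).trans ?_
  refine arrow_mk_map_congr _ (CatOver.arrow_pi fun j => CatOver.arrow_sigma_mk_inj ?_)
  exact (CatOver.arrow_sigMap (f.map j)).trans (hk j).symm

/-- The functor `TH ⟶ H`, `(α, x) ↦ H_α(x)`, induced by a commutative lax morphism. -/
def IsCommutative.eval (hM : M.IsCommutative) : T.obj H ⟶ H := fun i =>
  { obj := fun A => (M.prod A.op.arr).obj A.lab
    map := fun f => hM.evalMap f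
    map_id := fun A => arrow_mk_inj <| by
      refine (hM.arrow_evalMap (𝟙 A) (fun j => 𝟙 (A.lab j)) fun j => rfl).trans ?_
      exact congrArg Arrow.mk ((M.prod A.op.arr).map_id A.lab)
    map_comp := fun {A B C} f g => arrow_mk_inj <| by
      -- The label of `g` at `f.perm j` starts where the label of `f` at `j` ends only up to
      -- transport; `l j` is the same arrow with a source that permits composition in the fibre.
      choose z' l hl using fun j => CatOver.exists_fibre_map (g.map (f.perm j))
        (arrow_mk_tgt (CatOver.arrow_sigMap (f.map j)))
      refine (hM.arrow_evalMap (f ≫ g) (fun j => CatOver.sigMap (f.map j) ≫ l j) fun j => ?_).trans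
        ?_
      · exact arrow_mk_comp_congr (f := CatOver.incl (CatOver.sigMap (f.map j)))
          (g := CatOver.incl (l j)) (CatOver.arrow_sigMap (f.map j)) (hl j)
      · refine (congrArg Arrow.mk ((M.prod A.op.arr).map_comp
          (fun j => CatOver.sigMap (f.map j)) l)).trans ?_
        refine arrow_mk_comp_congr (hM.arrow_evalMap f _ fun j => CatOver.arrow_sigMap _).symm ?_
        refine Eq.trans ?_ (hM.arrow_evalMap g (fun j => CatOver.sigMap (g.map j))
          fun j => CatOver.arrow_sigMap _).symm
        -- The morphisms `l` are indexed by positions of `A` and the labels of `g` by positions of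
        -- `B`; commutativity identifies the two evaluations.
        exact hM.prod_map_congr f.op_eq fun j => (hl j).trans (CatOver.arrow_sigMap _).symm }

/-- With identity labels, evaluation applies `H_α` to an identity, and the remaining factor of
`evalMap` is a transport. -/
lemma IsCommutative.killing_eval (hM : M.IsCommutative) : Operad.Killing (T := T) hM.eval := by
  intro i A B f hf
  obtain ⟨z, k, π, hπ, rfl, hk⟩ := LOp.exists_lev_permutative f
  have hk' : ∀ j, Arrow.mk (k j) = Arrow.mk (𝟙 (A.lab j)) := by
    intro j
    refine CatOver.arrow_sigma_mk_inj ((hk j).trans ?_)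
    exact (hf j).arrow_eq (isId_refl (A.pt j)) rfl
  have := (hM.arrow_evalMap _ k hk).trans (arrow_mk_map_congr _ (CatOver.arrow_pi hk'))
  exact (isId_congr this).2 ((isId_refl A.lab).map (M.prod A.op.arr))

lemma IsCommutative.ins_eval (hM : M.IsCommutative) {n : ℕ} {s : Fin n → I} {i : I}
    (α : T.Arr s i) : LOp.ins H α ⋙ hM.eval i = M.prod α :=
  Arrow.functor_ext fun _ _ k => hM.arrow_evalMap (LOp.lev ⟨n, s, α⟩ k) k fun _ => rfl

/-- A functor killing permutative maps is determined by its restrictions to the products. -/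
lemma IsCommutative.eq_eval (hM : M.IsCommutative) {g : T.obj H ⟶ H} (hg : Operad.Killing (T := T) g)
    (h : ∀ {n : ℕ} {s : Fin n → I} {i : I} (α : T.Arr s i), LOp.ins H α ⋙ g i = M.prod α) :
    g = hM.eval := by
  refine CatOver.one_cell_ext fun i A B f => ?_
  obtain ⟨z, k, π, hπ, rfl, hk⟩ := LOp.exists_lev_permutative f
  refine Eq.trans ?_ (hM.arrow_evalMap _ k hk).symm
  rw [Functor.map_comp]
  -- The permutative factor disappears because `g` kills it; the levelwise one lies in the image of
  -- `ins`, where `g` is prescribed.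
  refine ((hg hπ).arrow_comp' _).trans ?_
  exact functor_map_congr (h A.op.arr) k

end LaxOpMor

section

variable {T : Operad I} {H : CatOver I} {M : LaxOpMor T H}

/-- The condition on the action in `Corresponds` concerns levelwise morphisms only, but `q` kills
the permutative ones, so the whole restriction to `TH` is forced. Since `q` can be cancelled, the
action is unique. -/
lemma Corresponds.q_act {𝒜 : TwoMonad.LaxAlg T.quotMonad H} (h : Corresponds 𝒜 M)
    (hM : M.IsCommutative) : T.q H ≫ 𝒜.act = hM.eval :=
  hM.eq_eval (fun hk => (Operad.q_isId hk).map (𝒜.act _)) fun α => h.act α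

end

/-! ### Morphisms of `TTH` and the multiplication cell. -/

namespace LOp

variable {T : Operad I} {H : CatOver I}

/-- The form of `eq_of_permutative` needed for the inner level of an object of `TTH`, whose label
morphisms lie in a total category. -/
lemma eq_of_isId_smap : ∀ {a b : Σ i, (T.obj H).fib i} (g : a ⟶ b),
    (∀ k, IsId (LOp.smap g k)) →
      a = ⟨b.1, ⟨b.2.op.act (LOp.sperm g), fun k => b.2.lab (LOp.sperm g k)⟩⟩
  | _, _, .mk _, h => congrArg (Sigma.mk _) (eq_of_permutative h)

lemma isId_tot_of_isId_smap {X : CatOver I} {p : T.obj H ⟶ X} (hp : Operad.Killing (T := T) p) :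
    ∀ {a b : Σ i, (T.obj H).fib i} (g : a ⟶ b), (∀ k, IsId (LOp.smap g k)) →
      IsId ((tot p).map g)
  | _, _, .mk _, h => isId_sigma_mk (hp h)

/-- Every morphism of `TTH` is a levelwise morphism followed by one with identity labels. -/
lemma exists_lev_lev {i : I} {A B : (T.obj (T.obj H)).fib i} (f : A ⟶ B) :
    ∃ (z : ∀ j k, H.fib ((A.lab j).op.src k)) (w : ∀ j k, (A.lab j).lab k ⟶ z j k)
      (g : (⟨A.op, fun j => ⟨(A.lab j).op, z j⟩⟩ : LOp T.toCollection (T.obj H) i) ⟶ B),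
      (∀ j k, IsId (LOp.smap (g.map j) k)) ∧
        f = lev (X := T.obj H) A.op (fun j => lev (A.lab j).op (w j)) ≫ g := by
  obtain ⟨y, v, π, hπ, rfl, -⟩ := exists_lev_permutative f
  choose z w ϖ hϖ hv _ using fun j => exists_lev_permutative (v j)
  obtain rfl : v = fun j => lev (A.lab j).op (w j) ≫ ϖ j := funext hv
  -- The inner permutative factors are absorbed into the second morphism. It need not be permutative
  -- over `TH`; only its innermost labels, in `H`, are identities.
  refine ⟨z, w, lev (X := T.obj H) A.op ϖ ≫ π, fun j k => ?_, Hom.ext' (fun _ => rfl) fun j => ?_⟩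
  · exact isId_smap_congr ((hπ j).arrow_comp' (CatOver.incl (X := T.obj H) (ϖ j))).symm (hϖ j) k
  · exact congrArg Arrow.mk (Category.assoc (CatOver.incl (X := T.obj H) (lev (A.lab j).op (w j)))
      (CatOver.incl (X := T.obj H) (ϖ j)) (π.map j))

end LOp

namespace LaxOpMor

variable {T : Operad I} {H : CatOver I} {M : LaxOpMor T H}

/-- When the symmetries are identities, every factor of the equivariance axiom other than the two
substitutions drops out. -/
lemma IsCommutative.arrow_sub (hM : M.IsCommutative) {n n' : ℕ} {s : Fin n → I} {i : I}
    (α : T.Arr s i) {m : Fin n → ℕ} {t : ∀ j, Fin (m j) → I} (β : ∀ j, T.Arr (t j) (s j))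
    (ρ : Fin n' ≃ Fin n) {m' : Fin n' → ℕ} (τ : ∀ j, Fin (m' j) ≃ Fin (m (ρ j)))
    (x : ∀ j k, H.fib (t j k)) :
    Arrow.mk ((M.sub (T.act α ρ) fun j => T.act (β (ρ j)) (τ j)).app fun j k => x (ρ j) (τ j k)) =
      Arrow.mk ((M.sub α β).app x) := by
  have h := M.sym_sub α β ρ τ x
  have h1 : IsId ((M.prod (T.act α ρ)).map (fun j => (M.sym (β (ρ j)) (τ j)).app (x (ρ j)))) :=
    IsId.map (CatOver.isId_pi fun j => hM.isId_sym (β (ρ j)) (τ j) (x (ρ j))) _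
  refine Eq.trans (Eq.symm ?_) ((congrArg Arrow.mk h).trans ?_)
  · exact ((isId_eqToHom _).comp (hM.isId_sym _ _ _)).arrow_comp' _
  · exact (h1.arrow_comp _).trans ((hM.isId_sym _ _ _).arrow_comp _)

section mul

variable {a : T.quotObj H ⟶ H}

lemma IsCommutative.qq_quotMap₁_act (hM : M.IsCommutative) (ha : T.q H ≫ a = hM.eval) :
    T.qq H ≫ Operad.quotMap₁ a = T.map hM.eval ≫ T.q H := by
  rw [← ha, Operad.tmap_comp]
  exact congrArg (fun k => T.map (T.q H) ≫ k) (Operad.q_quotMap₁ a)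

/-- Together with the next lemma, this shows that restriction along `qq` turns the source and target
of the multiplication cell into 1-cells on `TTH` between which `σ` is directly defined. -/
lemma IsCommutative.qq_map_act (hM : M.IsCommutative) (ha : T.q H ≫ a = hM.eval) :
    T.qq H ≫ Operad.quotMap₁ a ≫ a = T.map hM.eval ≫ hM.eval :=
  (congrArg (fun k => k ≫ a) (hM.qq_quotMap₁_act ha)).trans
    (congrArg (fun k => T.map hM.eval ≫ k) ha)

lemma IsCommutative.qq_quotμ_act (hM : M.IsCommutative) (ha : T.q H ≫ a = hM.eval) :
    T.qq H ≫ Operad.quotμ H ≫ a = T.μ H ≫ hM.eval := by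
  rw [← ha]
  exact congrArg (fun k => k ≫ a) Operad.qq_quotμ

/-- The multiplication cell of the algebra of a commutative lax morphism. -/
lemma IsCommutative.existsUnique_mul (hM : M.IsCommutative) (ha : T.q H ≫ a = hM.eval) :
    ∃! c : Operad.quotMap₁ a ≫ a ⟶ Operad.quotμ H ≫ a,
      ∀ {n : ℕ} {s : Fin n → I} {i : I} (α : T.Arr s i) {m : Fin n → ℕ}
        {t : ∀ j, Fin (m j) → I} (β : ∀ j, T.Arr (t j) (s j)) (x : ∀ j k, H.fib (t j k)),
        Arrow.mk ((c i).app ((T.qq H i).obj (LOp.mk' α fun j => LOp.mk' (β j) (x j)))) =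
          Arrow.mk ((M.sub α β).app x) := by
  let σ : ∀ {i : I} (A : (T.obj (T.obj H)).fib i),
      (hM.eval i).obj ((T.map hM.eval i).obj A) ⟶ (hM.eval i).obj ((T.μ H i).obj A) := fun A =>
    (M.sub A.op.arr fun j => (A.lab j).op.arr).app fun j k => (A.lab j).lab k
  have hσ : ∀ {i : I} {A B : (T.obj (T.obj H)).fib i} (g : A ⟶ B),
      (∀ j k, IsId (LOp.smap (g.map j) k)) → Arrow.mk (σ A) = Arrow.mk (σ B) := by
    intro i A B g hg
    -- The object `A` is `B` reindexed at both levels, which is the situation of the equivariance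
    -- axiom.
    have hA : A = LOp.mk' (T.act B.op.arr g.perm) fun j =>
        LOp.mk' (T.act (B.lab (g.perm j)).op.arr (LOp.sperm (g.map j)))
          fun k => (B.lab (g.perm j)).lab (LOp.sperm (g.map j) k) :=
      LOp.ext' g.op_eq fun j j' hj => by
        obtain rfl : Fin.cast (congrArg Collection.Op.n g.op_eq) j = j' := Fin.ext hj
        exact LOp.eq_of_isId_smap (g.map j) (hg j)
    refine (congrArg (fun A : (T.obj (T.obj H)).fib i => Arrow.mk (σ A)) hA).trans ?_
    exact hM.arrow_sub B.op.arr (fun j => (B.lab j).op.arr) g.perm (fun j => LOp.sperm (g.map j))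
      fun j k => (B.lab j).lab k
  have nat : ∀ {i : I} {A B : (T.obj (T.obj H)).fib i} (f : A ⟶ B),
      (hM.eval i).map ((T.map hM.eval i).map f) ≫ σ B =
        σ A ≫ (hM.eval i).map ((T.μ H i).map f) := by
    intro i A B f
    obtain ⟨z, w, g, hg, rfl⟩ := LOp.exists_lev_lev f
    -- The second factor only permutes, so both functors send it to an identity and equivariance, in
    -- the form `hσ`, is enough.
    have h1 := IsId.square (f := (hM.eval i).map ((T.map hM.eval i).map g))
      (g := (hM.eval i).map ((T.μ H i).map g))
      (hM.killing_eval fun j => LOp.isId_tot_of_isId_smap hM.killing_eval (g.map j) (hg j))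
      (hM.killing_eval fun l => (hg _ _).congr (T.μMap_map g l).symm) (hσ g hg)
    obtain ⟨l, hl⟩ : ∃ l, l =
      LOp.lev (X := T.obj H) A.op fun j => LOp.lev (A.lab j).op (w j) := ⟨_, rfl⟩
    have h2 : (hM.eval i).map ((T.map hM.eval i).map l) ≫ σ _ =
        σ A ≫ (hM.eval i).map ((T.μ H i).map l) := by
      subst hl
      refine arrow_mk_inj ?_
      refine (arrow_mk_comp_congr (hM.arrow_evalMap
        ((T.map hM.eval i).map (LOp.lev (X := T.obj H) A.op fun j => LOp.lev (A.lab j).op (w j)))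
        (fun j => (M.prod (A.lab j).op.arr).map (w j)) fun j => ?_) rfl).trans ?_
      · exact (arrow_mk_map_congr (Sigma.incl (C := H.fib) (A.op.src j))
          (hM.arrow_evalMap (LOp.lev (A.lab j).op (w j)) (w j) fun _ => rfl)).symm
      -- The family `w` is one morphism of the iterated product, so a single naturality square of
      -- `σ` covers all labels at once.
      refine (congrArg Arrow.mk ((M.sub A.op.arr fun j => (A.lab j).op.arr).naturality w)).trans ?_
      refine arrow_mk_comp_congr rfl (hM.arrow_evalMap ((T.μ H i).map
        (LOp.lev (X := T.obj H) A.op fun j => LOp.lev (A.lab j).op (w j)))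
        (fun l : Fin (∑ j, (A.lab j).op.n) => w (dec l).1 (dec l).2) fun l => ?_).symm
      exact (T.μMap_map
        (LOp.lev (X := T.obj H) A.op fun j => LOp.lev (A.lab j).op (w j)) l).symm
    rw [← hl]
    simp only [Functor.map_comp, Category.assoc]
    rw [h1, ← Category.assoc, h2, Category.assoc]
  let θ : T.map hM.eval ≫ hM.eval ⟶ T.μ H ≫ hM.eval := fun i =>
    ⟨fun A => σ A, fun A B f => nat f⟩
  let c : T.qq H ≫ Operad.quotMap₁ a ≫ a ⟶ T.qq H ≫ Operad.quotμ H ≫ a :=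
    eqToHom (hM.qq_map_act ha) ≫ θ ≫ eqToHom (hM.qq_quotμ_act ha).symm
  have hc : ∀ i A, Arrow.mk ((c i).app A) = Arrow.mk (σ A) := fun i A =>
    Operad.arrow_conj θ _ _ i A
  -- As `qq` is full and surjective on objects, naturality over `TTH` suffices for the descent.
  -- Surjectivity also gives uniqueness, since every object of the target is the class of some `A`.
  refine ⟨fun i => (Operad.qq_fullSurj i).desc₂ (c i), fun α m t β x => ?_, ?_⟩
  · exact (congrArg Arrow.mk ((Operad.qq_fullSurj _).desc₂_app _ _)).trans (hc _ _)
  · intro c' hc'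
    refine CatOver.cell_eq_iff.2 fun i y => ?_
    obtain ⟨A, rfl⟩ := (Operad.qq_fullSurj i).surj y
    refine arrow_mk_inj ((hc' A.op.arr (fun j => (A.lab j).op.arr)
      fun j k => (A.lab j).lab k).trans ?_)
    exact ((congrArg Arrow.mk ((Operad.qq_fullSurj _).desc₂_app _ _)).trans (hc _ A)).symm

end mul

end LaxOpMor

/-! ### Threefold composites and the algebra laws. -/

namespace Operad

variable {T : Operad I} {X Y : CatOver I}

variable (T) in
/-- The projection `TTTX ⟶ (T/Σ)(T/Σ)(T/Σ)X`. -/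
noncomputable def qqq (X : CatOver I) :
    T.obj (T.obj (T.obj X)) ⟶ T.quotObj (T.quotObj (T.quotObj X)) :=
  T.map (T.map (T.q X)) ≫ T.qq (T.quotObj X)

lemma qqq_fullSurj : CatOver.FullSurj (T.qqq X) :=
  ((q_fullSurj.map T.toCollection).map T.toCollection).comp qq_fullSurj

/-- Functoriality of `T` collects the two inner quotients under `T` and leaves the outermost one
last, where `q_quotMap₁` applies. -/
lemma qqq_eq : T.qqq X = T.map (T.qq X) ≫ T.q (T.quotObj (T.quotObj X)) := by
  rw [qq, tmap_comp]
  rfl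

/-- This lemma and the three that follow compute over `TTTX` the 1-cells with which the
associativity law whiskers its cells. -/
lemma qqq_quotμ : T.qqq X ≫ quotμ (T.quotObj X) = T.μ (T.obj X) ≫ T.qq X :=
  calc T.qqq X ≫ quotμ (T.quotObj X)
      = T.map (T.map (T.q X)) ≫ T.qq _ ≫ quotμ _ := rfl
    _ = (T.map (T.map (T.q X)) ≫ T.μ _) ≫ T.q _ := by rw [qq_quotμ]; rfl
    _ = T.μ (T.obj X) ≫ T.qq X := by rw [μ_nat']; rfl

lemma qqq_quotMap₁ {f : T.quotObj (T.quotObj X) ⟶ Y} :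
    T.qqq X ≫ quotMap₁ f = T.map (T.qq X ≫ f) ≫ T.q Y := by
  rw [qqq_eq, tmap_comp]
  exact congrArg (fun k => T.map (T.qq X) ≫ k) (q_quotMap₁ f)

lemma qqq_quotMap₁_quotμ : T.qqq X ≫ quotMap₁ (quotμ X) = T.map (T.μ X) ≫ T.qq X := by
  rw [qqq_quotMap₁, qq_quotμ, tmap_comp]
  rfl

lemma qqq_quotMap₁_quotMap₁ {f : T.quotObj X ⟶ Y} :
    T.qqq X ≫ quotMap₁ (quotMap₁ f) = T.map (T.map (T.q X ≫ f)) ≫ T.qq Y := by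
  have h : T.qq X ≫ quotMap₁ f = T.map (T.q X ≫ f) ≫ T.q Y := by
    rw [tmap_comp]
    exact congrArg (fun k => T.map (T.q X) ≫ k) (q_quotMap₁ f)
  rw [qqq_quotMap₁, h, tmap_comp]
  rfl

end Operad

namespace LaxOpMor

variable {T : Operad I} {H : CatOver I} {M : LaxOpMor T H}

/-- The image under the action of a levelwise map between classes of labelled operations. -/
lemma IsCommutative.arrow_act_quotMap₂ (hM : M.IsCommutative) {a : T.quotObj H ⟶ H}
    (ha : T.q H ≫ a = hM.eval) {X : CatOver I} {f g : X ⟶ H} (θ : f ⟶ g) {i : I}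
    (A : (T.obj X).fib i) {z z' : ∀ j, H.fib (A.op.src j)} (k : ∀ j, z j ⟶ z' j)
    (hk : ∀ j, Arrow.mk ((θ _).app (A.lab j)) = Arrow.mk (k j)) :
    Arrow.mk ((a i).map ((Operad.quotMap₂ (T := T) θ i).app ((T.q X i).obj A))) =
      Arrow.mk ((M.prod A.op.arr).map k) := by
  refine (arrow_mk_map_congr (a i) (Operad.quotMap₂_app (T := T) θ A)).trans ?_
  refine (Operad.arrow_congr ha ((T.map₂ θ i).app A)).trans ?_
  exact hM.arrow_evalMap ((T.map₂ θ i).app A) k fun j =>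
    (arrow_mk_map_congr (Sigma.incl (C := H.fib) (A.op.src j)) (hk j)).symm

section laws

variable (hM : M.IsCommutative) {a : T.quotMonad.obj H ⟶ H} (ha : T.q H ≫ a = hM.eval)
  {ν : 𝟙 H ⟶ T.quotMonad.η H ≫ a}
  (hν : ∀ (i : I) (x : H.fib i), Arrow.mk ((ν i).app x) = Arrow.mk ((M.unit i).app x))
  {σ : T.quotMonad.map a ≫ a ⟶ T.quotMonad.μ H ≫ a}
  (hσ : ∀ {n : ℕ} {s : Fin n → I} {i : I} (α : T.Arr s i) {m : Fin n → ℕ}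
    {t : ∀ j, Fin (m j) → I} (β : ∀ j, T.Arr (t j) (s j)) (x : ∀ j k, H.fib (t j k)),
    Arrow.mk ((σ i).app ((T.qq H i).obj (LOp.mk' α fun j => LOp.mk' (β j) (x j)))) =
      Arrow.mk ((M.sub α β).app x))

/-- The algebra of a commutative lax morphism, given its action, unit and multiplication. -/
def IsCommutative.algOfCells : TwoMonad.LaxAlg T.quotMonad H where
  act := a
  unit := ν
  mul := σ
  unit_mul := by
    -- The right-hand side of a unit law is the `eqToHom` of a specific equation. By proof
    -- irrelevance it is enough that the left-hand side has identity components.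
    refine ((CatOver.cell_eq_eqToHom_iff _).2 fun i y => ?_).choose_spec
    obtain ⟨A, rfl⟩ := (Operad.q_fullSurj i).surj y
    refine (M.unit_sub A.op.arr A.lab).congr (Eq.symm ?_)
    refine (CatOver.isId_eqToHom_app _ i _).arrow_comp_comp ?_ ?_
    · exact (arrow_app_obj (ν i) (Operad.obj_congr ha A)).trans (hν i _)
    · exact hσ (T.one i) (fun _ => A.op.arr) fun _ => A.lab
  map_unit_mul := by
    refine ((CatOver.cell_eq_eqToHom_iff _).2 fun i y => ?_).choose_spec
    obtain ⟨A, rfl⟩ := (Operad.q_fullSurj i).surj y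
    refine (M.sub_unit A.op.arr A.lab).congr (Eq.symm ?_)
    refine (CatOver.isId_eqToHom_app _ i _).arrow_comp_comp ?_ ?_
    · exact hM.arrow_act_quotMap₂ ha ν A _ fun j => hν _ _
    · refine Eq.trans ?_ (hσ A.op.arr (fun j => T.one _) fun j _ => A.lab j)
      refine arrow_app_obj (σ i) ?_
      exact Operad.obj_congr (Operad.q_quotMap₁ (T.η H ≫ T.q H)) A
  mul_mul := by
    refine CatOver.cell_eq_iff.2 fun i y => ?_
    obtain ⟨A, rfl⟩ := (Operad.qqq_fullSurj i).surj y
    refine arrow_mk_inj ?_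
    -- At the class of a threefold labelled operation the law is the associativity of `σ`. What
    -- remains is to match the four substitution factors and discard the inserted identities.
    have h := M.sub_sub A.op.arr (fun j => (A.lab j).op.arr)
      (fun j k => ((A.lab j).lab k).op.arr) fun j k => ((A.lab j).lab k).lab
    refine Eq.trans ?_ (h.symm.trans (Eq.symm ?_))
    · refine (CatOver.isId_eqToHom_app _ i _).arrow_comp_comp ?_ ?_
      · refine Eq.trans ?_ (hσ A.op.arr (fun j => (A.lab j).op.arr) fun j k =>
          (M.prod ((A.lab j).lab k).op.arr).obj ((A.lab j).lab k).lab)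
        refine arrow_app_obj (σ i) ?_
        refine (Operad.obj_congr Operad.qqq_quotMap₁_quotMap₁ A).trans ?_
        rw [ha]
        rfl
      · refine Eq.trans ?_ (hσ (T.comp A.op.arr fun j => (A.lab j).op.arr)
          (fun l => ((A.lab (dec l).1).lab (dec l).2).op.arr)
          fun l => ((A.lab (dec l).1).lab (dec l).2).lab)
        exact arrow_app_obj (σ i) (Operad.obj_congr Operad.qqq_quotμ A)
    · refine ((CatOver.isId_eqToHom_app _ i _).arrow_comp _).trans ?_
      refine (CatOver.isId_eqToHom_app _ i _).arrow_comp_comp ?_ ?_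
      -- The cell `(T/Σ)σ` followed by the action becomes `H_α` applied to the inner substitutions.
      · refine Eq.trans ?_ (hM.arrow_act_quotMap₂ ha σ ((T.map (T.qq H) i).obj A)
          (fun j => (M.sub (A.lab j).op.arr fun k => ((A.lab j).lab k).op.arr).app
            fun k => ((A.lab j).lab k).lab) fun j => hσ _ _ _)
        refine arrow_mk_map_congr (a i) ?_
        exact arrow_app_obj _ (Operad.obj_congr Operad.qqq_eq A)
      · refine ((CatOver.isId_eqToHom_app _ i _).arrow_comp' _).trans ?_
        refine Eq.trans ?_ (hσ A.op.arr
          (fun j => T.comp (A.lab j).op.arr fun k => ((A.lab j).lab k).op.arr)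
          fun j => (H.join fun k => ((A.lab j).lab k).op.src).obj fun k => ((A.lab j).lab k).lab)
        exact arrow_app_obj (σ i) (Operad.obj_congr Operad.qqq_quotMap₁_quotμ A)

end laws

/-- The three data are forced one after the other: the action by `q_act`, the unit by its
components, and the multiplication by the uniqueness in `existsUnique_mul`. The laws are
propositions and add no choice. -/
theorem IsCommutative.existsUnique_alg (hM : M.IsCommutative) :
    ∃! 𝒜 : TwoMonad.LaxAlg T.quotMonad H, Corresponds 𝒜 M := by
  obtain ⟨a, ha⟩ : ∃ a : T.quotObj H ⟶ H, T.q H ≫ a = hM.eval :=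
    ⟨_, Operad.q_lift hM.killing_eval⟩
  have hη : ∀ i, H.single i ⋙ M.prod (T.one i) = (T.η H ≫ T.q H ≫ a) i := fun i => by
    rw [ha, ← hM.ins_eval]
    exact Arrow.functor_ext fun x y f => rfl
  -- The unit transformations live on `H` itself, so nothing has to descend; only their codomain is
  -- rewritten by `hη`.
  let ν : 𝟙 H ⟶ (T.η H ≫ T.q H) ≫ a := fun i => M.unit i ≫ eqToHom (hη i)
  have hν : ∀ (i : I) (x : H.fib i), Arrow.mk ((ν i).app x) = Arrow.mk ((M.unit i).app x) :=
    fun i x => arrow_natTrans_app ((isId_eqToHom (hη i)).arrow_comp' (M.unit i)) x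
  obtain ⟨σ, hσ, hσ'⟩ := hM.existsUnique_mul ha
  refine ⟨hM.algOfCells ha hν hσ, ⟨fun α => ?_, hν, hσ⟩, ?_⟩
  · rw [← hM.ins_eval, ← ha]
    rfl
  · rintro 𝒜 h𝒜
    have hq := h𝒜.q_act hM
    obtain ⟨a', ν', σ', _, _, _⟩ := 𝒜
    obtain rfl : a' = a := Operad.q_fullSurj.cancel (hq.trans ha.symm)
    obtain rfl : ν' = ν := CatOver.cell_eq_iff.2 fun i x =>
      arrow_mk_inj ((h𝒜.unit i x).trans (hν i x).symm)
    obtain rfl : σ' = σ := hσ' _ h𝒜.mul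
    rfl

end LaxOpMor

end operads

/-! ### Lax and colax morphisms compared with lax- and colax-natural transformations. -/

lemma arrow_eq_iff {C : Type*} [Category* C] {x y : C} {f g : x ⟶ y} {p p' : Arrow C}
    (h : Arrow.mk f = p) (h' : Arrow.mk g = p') : f = g ↔ p = p' := by
  subst h h'
  exact ⟨fun e => congrArg Arrow.mk e, arrow_mk_inj⟩

/-- Having the same cells is a relation between two kinds of structure; a relation uniquely solvable
from either side is the graph of a bijection. -/
lemma exists_equiv_of_existsUnique {α β : Sort*} {R : α → β → Prop} (h : ∀ a, ∃! b, R a b)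
    (h' : ∀ b, ∃! a, R a b) : ∃ e : α ≃ β, ∀ a, R a (e a) := by
  choose F hF hF' using h
  choose G hG hG' using h'
  exact ⟨⟨F, G, fun a => (hG' _ _ (hF a)).symm, fun b => (hF' _ _ (hG b)).symm⟩, hF⟩

section operads

variable {I : Type u} {T : Operad I} {H K : CatOver I} {M : LaxOpMor T H} {N : LaxOpMor T K}
  {𝒜 : TwoMonad.LaxAlg T.quotMonad H} {ℬ : TwoMonad.LaxAlg T.quotMonad K} {f g : H ⟶ K}

/-- This and the next lemma identify the two ends of a morphism cell on products, as
`existsUnique_cell` and `exists_family` require. -/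
lemma Corresponds.ins_act_comp (h𝒜 : Corresponds 𝒜 M) (f : H ⟶ K) {n : ℕ} {s : Fin n → I} {i : I}
    (α : T.Arr s i) : LOp.ins H α ⋙ T.q H i ⋙ (𝒜.act ≫ f) i = M.prod α ⋙ f i :=
  congrArg (fun F => F ⋙ f i) (h𝒜.act α)

lemma Corresponds.ins_map_comp_act (hℬ : Corresponds ℬ N) (f : H ⟶ K) {n : ℕ} {s : Fin n → I}
    {i : I} (α : T.Arr s i) : LOp.ins H α ⋙ T.q H i ⋙ (Operad.quotMap₁ f ≫ ℬ.act) i =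
      Functor.pi (fun j => f (s j)) ⋙ N.prod α := by
  rw [← hℬ.act α]
  have h : T.q H ≫ Operad.quotMap₁ f ≫ ℬ.act = T.map f ≫ T.q K ≫ ℬ.act :=
    congrArg (fun k => k ≫ ℬ.act) (Operad.q_quotMap₁ f)
  exact (congrArg (fun k : T.obj H ⟶ K => LOp.ins H α ⋙ k i) h).trans
    (Arrow.functor_ext fun _ _ _ => rfl)

/-- The component of the pasting of a 2-cell with an action, at the class of a family. -/
lemma Corresponds.arrow_act_map₂ (hN : N.IsCommutative) (hℬ : Corresponds ℬ N) {X : CatOver I}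
    {f g : X ⟶ K} (θ : f ⟶ g) {i : I} (A : (T.obj X).fib i) {z z' : ∀ j, K.fib (A.op.src j)}
    (k : ∀ j, z j ⟶ z' j) (hk : ∀ j, Arrow.mk ((θ _).app (A.lab j)) = Arrow.mk (k j)) :
    Arrow.mk ((ℬ.act i).map ((T.quotMonad.map₂ θ i).app ((T.q X i).obj A))) =
      Arrow.mk ((N.prod A.op.arr).map k) :=
  hN.arrow_act_quotMap₂ (hℬ.q_act hN) θ A k hk

lemma Corresponds.arrow_mul_map_map (hℬ : Corresponds ℬ N) (f : H ⟶ K) {i : I}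
    (A : (T.obj (T.obj H)).fib i) :
    Arrow.mk ((ℬ.mul i).app
        ((T.quotMonad.map (T.quotMonad.map f) i).obj ((T.qq H i).obj A))) =
      Arrow.mk ((N.sub A.op.arr fun j => (A.lab j).op.arr).app
        fun j k => (f _).obj ((A.lab j).lab k)) :=
  (arrow_app_obj (ℬ.mul i) (Operad.obj_congr (Operad.qq_quotMap₁ f) A)).trans
    (hℬ.mul A.op.arr (fun j => (A.lab j).op.arr) fun j k => (f _).obj ((A.lab j).lab k))

/-- This and `μ_qq` find the classes at which the multiplication law evaluates a morphism cell: the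
outer operation on evaluated inner terms, and the composite operation. -/
lemma Corresponds.map_act_qq (hM : M.IsCommutative) (h𝒜 : Corresponds 𝒜 M) {i : I}
    (A : (T.obj (T.obj H)).fib i) :
    (T.quotMonad.map 𝒜.act i).obj ((T.qq H i).obj A) =
      (T.q H i).obj (LOp.mk' A.op.arr fun j => (M.prod (A.lab j).op.arr).obj (A.lab j).lab) :=
  Operad.obj_congr (hM.qq_quotMap₁_act (h𝒜.q_act hM)) A

lemma μ_qq {i : I} (A : (T.obj (T.obj H)).fib i) :
    (T.quotMonad.μ H i).obj ((T.qq H i).obj A) = (T.q H i).obj ((T.μ H i).obj A) :=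
  Operad.obj_congr Operad.qq_quotμ A

section laws

variable (hM : M.IsCommutative) (hN : N.IsCommutative) (h𝒜 : Corresponds 𝒜 M)
  (hℬ : Corresponds ℬ N)

section lax

variable {c : T.quotMonad.map f ≫ ℬ.act ⟶ 𝒜.act ≫ f}
  {d : ∀ {n : ℕ} {s : Fin n → I} {i : I} (α : T.Arr s i),
    Functor.pi (fun j => f (s j)) ⋙ N.prod α ⟶ M.prod α ⋙ f i}
  (h : ∀ {n : ℕ} {s : Fin n → I} {i : I} (α : T.Arr s i) (x : ∀ j, H.fib (s j)),
    Arrow.mk ((c i).app ((T.q H i).obj (LOp.mk' α x))) = Arrow.mk ((d α).app x))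

include h𝒜 hℬ h

/-- The components of this law are indexed by objects of `H`, so no passage to classes is needed and
only the identity 2-cells have to be removed. -/
lemma lax_unit_iff :
    (f ◁ ℬ.unit ≫ eqToHom (T.quotMonad.η_nat_comp_eq f ℬ.act) ≫ T.quotMonad.η H ◁ c =
      eqToHom ((Bicategory.Strict.comp_id f).trans (Bicategory.Strict.id_comp f).symm) ≫
        𝒜.unit ▷ f ≫ eqToHom (Bicategory.Strict.assoc _ _ _)) ↔
    ∀ (i : I) (x : H.fib i),
      (N.unit i).app ((f i).obj x) ≫ (d (T.one i)).app (fun _ => x) =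
        (f i).map ((M.unit i).app x) := by
  refine CatOver.cell_eq_iff.trans (forall_congr' fun i => forall_congr' fun x => ?_)
  refine eq_congr ?_ ?_
  · exact (CatOver.isId_eqToHom_app _ i x).arrow_comp_comp (hℬ.unit i _) (h (T.one i) _)
  · refine ((CatOver.isId_eqToHom_app _ i x).arrow_comp _).trans ?_
    refine ((CatOver.isId_eqToHom_app _ i x).arrow_comp' _).trans ?_
    exact arrow_mk_map_congr (f i) (h𝒜.unit i x)

include hM hN

/-- Both sides are 2-cells out of `(T/Σ)(T/Σ)H`, hence determined at classes of two-level labelled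
operations, where the law is the substitution axiom. -/
lemma lax_mul_iff :
    (T.quotMonad.map (T.quotMonad.map f) ◁ ℬ.mul ≫
        eqToHom (T.quotMonad.μ_nat_comp_eq f ℬ.act) ≫ T.quotMonad.μ H ◁ c =
      eqToHom (T.quotMonad.map_comp_comp_eq (T.quotMonad.map f) ℬ.act ℬ.act).symm ≫
        T.quotMonad.map₂ c ▷ ℬ.act ≫
        eqToHom (T.quotMonad.map_comp_comp_eq 𝒜.act f ℬ.act) ≫ T.quotMonad.map 𝒜.act ◁ c ≫
        eqToHom (Bicategory.Strict.assoc _ _ _).symm ≫ 𝒜.mul ▷ f ≫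
        eqToHom (Bicategory.Strict.assoc _ _ _)) ↔
    ∀ {n : ℕ} {s : Fin n → I} {i : I} (α : T.Arr s i) {m : Fin n → ℕ}
      {t : ∀ j, Fin (m j) → I} (β : ∀ j, T.Arr (t j) (s j)) (x : ∀ j k, H.fib (t j k)),
      (N.sub α β).app (fun j k => (f (t j k)).obj (x j k)) ≫
          (d (T.comp α β)).app ((H.join t).obj x) =
        (N.prod α).map (fun j => (d (β j)).app (x j)) ≫
          (d α).app (fun j => (M.prod (β j)).obj (x j)) ≫ (f i).map ((M.sub α β).app x) := by
  -- At the class of `A` each side of the law is stripped of its identity factors. The two sides of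
  -- the equivalence are left to unification: they are the component of the law and the
  -- corresponding substitution equation.
  have key : ∀ {i : I} (A : (T.obj (T.obj H)).fib i), _ ↔ _ := fun {i} A => eq_congr
    ((CatOver.isId_eqToHom_app (T.quotMonad.μ_nat_comp_eq f ℬ.act) i
      ((T.qq H i).obj A)).arrow_comp_comp (hℬ.arrow_mul_map_map f A)
      ((arrow_app_obj (c i) (μ_qq A)).trans (h _ _)))
    (((CatOver.isId_eqToHom_app
      (T.quotMonad.map_comp_comp_eq (T.quotMonad.map f) ℬ.act ℬ.act).symm i
        ((T.qq H i).obj A)).arrow_comp _).trans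
    ((CatOver.isId_eqToHom_app (T.quotMonad.map_comp_comp_eq 𝒜.act f ℬ.act) i
      ((T.qq H i).obj A)).arrow_comp_comp
        (hℬ.arrow_act_map₂ hN c ((T.map (T.q H) i).obj A)
          (fun j => (d (A.lab j).op.arr).app (A.lab j).lab) fun j => h _ _)
        ((CatOver.isId_eqToHom_app (Bicategory.Strict.assoc _ _ _).symm i
          ((T.qq H i).obj A)).arrow_comp_comp
          ((arrow_app_obj (c i) (h𝒜.map_act_qq hM A)).trans (h _ _))
          (((CatOver.isId_eqToHom_app (Bicategory.Strict.assoc _ _ _) i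
            ((T.qq H i).obj A)).arrow_comp' _).trans
          (arrow_mk_map_congr (f i) (h𝒜.mul A.op.arr (fun j => (A.lab j).op.arr)
            fun j k => (A.lab j).lab k))))))
  refine CatOver.cell_eq_iff.trans ⟨fun H' n s i α m t β x => ?_, fun H' i y => ?_⟩
  · exact (key (LOp.mk' α fun j => LOp.mk' (β j) (x j))).1 (H' _ _)
  · obtain ⟨A, rfl⟩ := (Operad.qq_fullSurj i).surj y
    exact (key A).2 (H' _ _ _)

end lax

section colax

variable {c : 𝒜.act ≫ f ⟶ T.quotMonad.map f ≫ ℬ.act}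
  {d : ∀ {n : ℕ} {s : Fin n → I} {i : I} (α : T.Arr s i),
    M.prod α ⋙ f i ⟶ Functor.pi (fun j => f (s j)) ⋙ N.prod α}
  (h : ∀ {n : ℕ} {s : Fin n → I} {i : I} (α : T.Arr s i) (x : ∀ j, H.fib (s j)),
    Arrow.mk ((c i).app ((T.q H i).obj (LOp.mk' α x))) = Arrow.mk ((d α).app x))

include h𝒜 hℬ h

lemma colax_unit_iff :
    (f ◁ ℬ.unit =
      eqToHom ((Bicategory.Strict.comp_id f).trans (Bicategory.Strict.id_comp f).symm) ≫
        𝒜.unit ▷ f ≫ eqToHom (Bicategory.Strict.assoc _ _ _) ≫ T.quotMonad.η H ◁ c ≫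
        eqToHom (T.quotMonad.η_nat_comp_eq f ℬ.act).symm) ↔
    ∀ (i : I) (x : H.fib i),
      (f i).map ((M.unit i).app x) ≫ (d (T.one i)).app (fun _ => x) =
        (N.unit i).app ((f i).obj x) := by
  refine CatOver.cell_eq_iff.trans (forall_congr' fun i => forall_congr' fun x => ?_)
  -- The algebra law and the axiom for transformations are written with their sides exchanged.
  refine Iff.trans (eq_congr (hℬ.unit i _) ?_) eq_comm
  refine ((CatOver.isId_eqToHom_app _ i x).arrow_comp _).trans ?_
  refine (CatOver.isId_eqToHom_app _ i x).arrow_comp_comp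
    (arrow_mk_map_congr (f i) (h𝒜.unit i x)) ?_
  exact ((CatOver.isId_eqToHom_app _ i x).arrow_comp' _).trans (h (T.one i) _)

include hM hN

/-- The reduction is that of the lax case; reversing the cell only changes the order of the factors.
-/
lemma colax_mul_iff :
    (eqToHom (Bicategory.Strict.assoc _ _ _).symm ≫ 𝒜.mul ▷ f ≫
        eqToHom (Bicategory.Strict.assoc _ _ _) ≫ T.quotMonad.μ H ◁ c =
      T.quotMonad.map 𝒜.act ◁ c ≫ eqToHom (T.quotMonad.map_comp_comp_eq 𝒜.act f ℬ.act).symm ≫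
        T.quotMonad.map₂ c ▷ ℬ.act ≫
        eqToHom (T.quotMonad.map_comp_comp_eq (T.quotMonad.map f) ℬ.act ℬ.act) ≫
        T.quotMonad.map (T.quotMonad.map f) ◁ ℬ.mul ≫
        eqToHom (T.quotMonad.μ_nat_comp_eq f ℬ.act)) ↔
    ∀ {n : ℕ} {s : Fin n → I} {i : I} (α : T.Arr s i) {m : Fin n → ℕ}
      {t : ∀ j, Fin (m j) → I} (β : ∀ j, T.Arr (t j) (s j)) (x : ∀ j k, H.fib (t j k)),
      (f i).map ((M.sub α β).app x) ≫ (d (T.comp α β)).app ((H.join t).obj x) =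
        (d α).app (fun j => (M.prod (β j)).obj (x j)) ≫
          (N.prod α).map (fun j => (d (β j)).app (x j)) ≫
          (N.sub α β).app (fun j k => (f (t j k)).obj (x j k)) := by
  have key : ∀ {i : I} (A : (T.obj (T.obj H)).fib i), _ ↔ _ := fun {i} A => eq_congr
    (((CatOver.isId_eqToHom_app (Bicategory.Strict.assoc _ _ _).symm i
        ((T.qq H i).obj A)).arrow_comp _).trans
      ((CatOver.isId_eqToHom_app (Bicategory.Strict.assoc _ _ _) i
        ((T.qq H i).obj A)).arrow_comp_comp
        (arrow_mk_map_congr (f i) (h𝒜.mul A.op.arr (fun j => (A.lab j).op.arr)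
            fun j k => (A.lab j).lab k))
        ((arrow_app_obj (c i) (μ_qq A)).trans (h _ _))))
    ((CatOver.isId_eqToHom_app (T.quotMonad.map_comp_comp_eq 𝒜.act f ℬ.act).symm i
      ((T.qq H i).obj A)).arrow_comp_comp
      ((arrow_app_obj (c i) (h𝒜.map_act_qq hM A)).trans (h _ _))
      ((CatOver.isId_eqToHom_app
        (T.quotMonad.map_comp_comp_eq (T.quotMonad.map f) ℬ.act ℬ.act) i
          ((T.qq H i).obj A)).arrow_comp_comp
        (hℬ.arrow_act_map₂ hN c ((T.map (T.q H) i).obj A)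
          (fun j => (d (A.lab j).op.arr).app (A.lab j).lab) fun j => h _ _)
        (((CatOver.isId_eqToHom_app (T.quotMonad.μ_nat_comp_eq f ℬ.act) i
          ((T.qq H i).obj A)).arrow_comp' _).trans (hℬ.arrow_mul_map_map f A))))
  refine CatOver.cell_eq_iff.trans ⟨fun H' n s i α m t β x => ?_, fun H' i y => ?_⟩
  · exact (key (LOp.mk' α fun j => LOp.mk' (β j) (x j))).1 (H' _ _)
  · obtain ⟨A, rfl⟩ := (Operad.qq_fullSurj i).surj y
    exact (key A).2 (H' _ _ _)

end colax

section sym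

include hM hN

/-- Commutativity of `M` and `N` removes both symmetries from the axiom. What is left is the
condition under which a family of cells descends to the quotient. -/
lemma lax_sym_iff {d : ∀ {n : ℕ} {s : Fin n → I} {i : I} (α : T.Arr s i),
      Functor.pi (fun j => f (s j)) ⋙ N.prod α ⟶ M.prod α ⋙ f i}
    {m n : ℕ} {s : Fin n → I} {i : I} (α : T.Arr s i) (ρ : Fin m ≃ Fin n)
    (x : ∀ j, H.fib (s j)) :
    ((d (T.act α ρ)).app ((H.perm s ρ).obj x) ≫ (f i).map ((M.sym α ρ).app x) =
      (N.sym α ρ).app (fun j => (f (s j)).obj (x j)) ≫ (d α).app x) ↔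
    Arrow.mk ((d (T.act α ρ)).app ((H.perm s ρ).obj x)) = Arrow.mk ((d α).app x) :=
  arrow_eq_iff (((hM.isId_sym α ρ x).map (f i)).arrow_comp' _)
    ((hN.isId_sym α ρ fun j => (f (s j)).obj (x j)).arrow_comp _)

lemma colax_sym_iff {d : ∀ {n : ℕ} {s : Fin n → I} {i : I} (α : T.Arr s i),
      M.prod α ⋙ f i ⟶ Functor.pi (fun j => f (s j)) ⋙ N.prod α}
    {m n : ℕ} {s : Fin n → I} {i : I} (α : T.Arr s i) (ρ : Fin m ≃ Fin n)
    (x : ∀ j, H.fib (s j)) :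
    ((d (T.act α ρ)).app ((H.perm s ρ).obj x) ≫
        (N.sym α ρ).app (fun j => (f (s j)).obj (x j)) =
      (f i).map ((M.sym α ρ).app x) ≫ (d α).app x) ↔
    Arrow.mk ((d (T.act α ρ)).app ((H.perm s ρ).obj x)) = Arrow.mk ((d α).app x) :=
  arrow_eq_iff ((hN.isId_sym α ρ fun j => (f (s j)).obj (x j)).arrow_comp' _)
    (((hM.isId_sym α ρ x).map (f i)).arrow_comp _)

end sym

include hM hN h𝒜 hℬ

/-- Cells correspond through `exists_family` and `existsUnique_cell`. The symmetry axiom is the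
descent condition, automatic for a cell that already lives on the quotient, and the two remaining
axioms match the two algebra laws. -/
theorem exists_laxMor_equiv (f : H ⟶ K) :
    ∃ e : TwoMonad.LaxMor 𝒜 ℬ f ≃ LaxNat M N f, ∀ φ, SameCells φ (e φ) := by
  refine exists_equiv_of_existsUnique (fun φ => ?_) fun ψ => ?_
  · obtain ⟨d, hd⟩ := Operad.exists_family (fun α => hℬ.ins_map_comp_act f α)
      (fun α => h𝒜.ins_act_comp f α) φ.cell
    refine ⟨⟨d, fun α ρ x => (lax_sym_iff hM hN α ρ x).2 (Operad.family_sym hd α ρ x),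
      (lax_unit_iff h𝒜 hℬ hd).1 φ.unit_cell, (lax_mul_iff hM hN h𝒜 hℬ hd).1 φ.mul_cell⟩,
      hd, fun ψ hψ => ?_⟩
    refine LaxNat.ext ?_
    funext n s i α
    ext x
    exact arrow_mk_inj ((hψ α x).symm.trans (hd α x))
  · obtain ⟨c, hc, hc'⟩ := Operad.existsUnique_cell (fun α => hℬ.ins_map_comp_act f α)
      (fun α => h𝒜.ins_act_comp f α) ψ.cell
      fun α ρ x => (lax_sym_iff hM hN α ρ x).1 (ψ.sym α ρ x)
    exact ⟨⟨c, (lax_unit_iff h𝒜 hℬ hc).2 ψ.unit, (lax_mul_iff hM hN h𝒜 hℬ hc).2 ψ.sub⟩,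
      hc, fun φ hφ => TwoMonad.LaxMor.ext (hc' _ hφ)⟩

theorem exists_colaxMor_equiv (f : H ⟶ K) :
    ∃ e : TwoMonad.ColaxMor 𝒜 ℬ f ≃ ColaxNat M N f, ∀ φ, SameColaxCells φ (e φ) := by
  refine exists_equiv_of_existsUnique (fun φ => ?_) fun ψ => ?_
  · obtain ⟨d, hd⟩ := Operad.exists_family (fun α => h𝒜.ins_act_comp f α)
      (fun α => hℬ.ins_map_comp_act f α) φ.cell
    refine ⟨⟨d, fun α ρ x => (colax_sym_iff hM hN α ρ x).2 (Operad.family_sym hd α ρ x),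
      (colax_unit_iff h𝒜 hℬ hd).1 φ.unit_cell, (colax_mul_iff hM hN h𝒜 hℬ hd).1 φ.mul_cell⟩,
      hd, fun ψ hψ => ?_⟩
    refine ColaxNat.ext ?_
    funext n s i α
    ext x
    exact arrow_mk_inj ((hψ α x).symm.trans (hd α x))
  · obtain ⟨c, hc, hc'⟩ := Operad.existsUnique_cell (fun α => h𝒜.ins_act_comp f α)
      (fun α => hℬ.ins_map_comp_act f α) ψ.cell
      fun α ρ x => (colax_sym_iff hM hN α ρ x).1 (ψ.sym α ρ x)
    exact ⟨⟨c, (colax_unit_iff h𝒜 hℬ hc).2 ψ.unit, (colax_mul_iff hM hN h𝒜 hℬ hc).2 ψ.sub⟩,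
      hc, fun φ hφ => TwoMonad.ColaxMor.ext (hc' _ hφ)⟩

/-! ### Pseudo and strict morphisms, and modifications. -/

omit hM hN h𝒜 hℬ

/-- Invertibility is a condition on components, and every object of `(T/Σ)H` is the class of a
labelled operation, so both sides test the same arrows. -/
lemma SameCells.isIso_iff {φ : TwoMonad.LaxMor 𝒜 ℬ f} {ψ : LaxNat M N f} (h : SameCells φ ψ) :
    IsIso φ.cell ↔
      ∀ {n : ℕ} {s : Fin n → I} {i : I} (α : T.Arr s i), IsIso (ψ.cell α) := by
  refine (CatOver.isIso_cell_iff φ.cell).trans ⟨fun H' n s i α => ?_, fun H' i y => ?_⟩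
  · exact (NatTrans.isIso_iff_isIso_app _).2 fun x => (isIso_congr (h α x)).1 (H' _ _)
  · obtain ⟨A, rfl⟩ := (Operad.q_fullSurj i).surj y
    exact (isIso_congr (h A.op.arr A.lab)).2 ((NatTrans.isIso_iff_isIso_app _).1 (H' _) _)

lemma SameCells.isId_iff {φ : TwoMonad.LaxMor 𝒜 ℬ f} {ψ : LaxNat M N f} (h : SameCells φ ψ) :
    (∃ h : T.quotMonad.map f ≫ ℬ.act = 𝒜.act ≫ f, φ.cell = eqToHom h) ↔
      ∀ {n : ℕ} {s : Fin n → I} {i : I} (α : T.Arr s i),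
        ∃ h : Functor.pi (fun j => f (s j)) ⋙ N.prod α = M.prod α ⋙ f i,
          ψ.cell α = eqToHom h := by
  refine (CatOver.cell_eq_eqToHom_iff φ.cell).trans ⟨fun H' n s i α => ?_, fun H' i y => ?_⟩
  · exact (natTrans_eq_eqToHom_iff _).2 fun x => (isId_congr (h α x)).1 (H' _ _)
  · obtain ⟨A, rfl⟩ := (Operad.q_fullSurj i).surj y
    exact (isId_congr (h A.op.arr A.lab)).2 ((natTrans_eq_eqToHom_iff _).1 (H' _) _)

include hN h𝒜 hℬ

/-- Both conditions are families of equations between components. The action sends the class of `(α,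
x)` to `H_α(x)`, and surjectivity of `q` on objects makes the equations at such classes sufficient.
-/
theorem isModification_iff_isAlgTwoCell {φ : TwoMonad.LaxMor 𝒜 ℬ f} {γ : TwoMonad.LaxMor 𝒜 ℬ g}
    {ψ : LaxNat M N f} {χ : LaxNat M N g} (h : SameCells φ ψ) (h' : SameCells γ χ) (θ : f ⟶ g) :
    IsModification ψ χ θ ↔ TwoMonad.IsAlgTwoCell φ γ θ := by
  have key : ∀ {i : I} (A : (T.obj H).fib i), _ ↔ _ := fun {i} A => eq_congr
    (arrow_mk_comp_congr (h A.op.arr A.lab)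
      (arrow_app_obj (θ i) (functor_obj_congr (h𝒜.act A.op.arr) A.lab)))
    (arrow_mk_comp_congr (hℬ.arrow_act_map₂ hN θ A (fun j => (θ _).app (A.lab j)) fun _ => rfl)
      (h' A.op.arr A.lab))
  refine Iff.symm (CatOver.cell_eq_iff.trans ⟨fun H' n s i α x => ?_, fun H' i y => ?_⟩)
  · exact (key (LOp.mk' α x)).1 (H' _ _)
  · obtain ⟨A, rfl⟩ := (Operad.q_fullSurj i).surj y
    exact (key A).2 (H' _ _)

theorem isColaxModification_iff_isColaxAlgTwoCell {φ : TwoMonad.ColaxMor 𝒜 ℬ f}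
    {γ : TwoMonad.ColaxMor 𝒜 ℬ g} {ψ : ColaxNat M N f} {χ : ColaxNat M N g}
    (h : SameColaxCells φ ψ) (h' : SameColaxCells γ χ) (θ : f ⟶ g) :
    IsColaxModification ψ χ θ ↔ TwoMonad.IsColaxAlgTwoCell φ γ θ := by
  have key : ∀ {i : I} (A : (T.obj H).fib i), _ ↔ _ := fun {i} A => eq_congr
    (arrow_mk_comp_congr (h A.op.arr A.lab)
      (hℬ.arrow_act_map₂ hN θ A (fun j => (θ _).app (A.lab j)) fun _ => rfl))
    (arrow_mk_comp_congr
      (arrow_app_obj (θ i) (functor_obj_congr (h𝒜.act A.op.arr) A.lab)) (h' A.op.arr A.lab))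
  refine Iff.symm (CatOver.cell_eq_iff.trans ⟨fun H' n s i α x => ?_, fun H' i y => ?_⟩)
  · exact (key (LOp.mk' α x)).1 (H' _ _)
  · obtain ⟨A, rfl⟩ := (Operad.q_fullSurj i).surj y
    exact (key A).2 (H' _ _)

end laws

end operads

theorem mainTheorem7 {I : Type u} (T : Operad I) {H K : CatOver I}
    (M : LaxOpMor T H) (N : LaxOpMor T K) (hM : M.IsCommutative) (hN : N.IsCommutative) :
    (∃! 𝒜 : TwoMonad.LaxAlg T.quotMonad H, Corresponds 𝒜 M) ∧
    (∃! ℬ : TwoMonad.LaxAlg T.quotMonad K, Corresponds ℬ N) ∧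
    ∀ (𝒜 : TwoMonad.LaxAlg T.quotMonad H) (ℬ : TwoMonad.LaxAlg T.quotMonad K),
      Corresponds 𝒜 M → Corresponds ℬ N →
      (∀ f : H ⟶ K,
        (∃ e : TwoMonad.LaxMor 𝒜 ℬ f ≃ LaxNat M N f, ∀ φ, SameCells φ (e φ)) ∧
        (∃ e : TwoMonad.ColaxMor 𝒜 ℬ f ≃ ColaxNat M N f, ∀ φ, SameColaxCells φ (e φ)) ∧
        (∃ e : TwoMonad.PseudoMor 𝒜 ℬ f ≃ PseudoNat M N f, ∀ φ, SameCells φ.1 (e φ).1) ∧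
        (∃ e : TwoMonad.StrictMor 𝒜 ℬ f ≃ StrictNat M N f, ∀ φ, SameCells φ.1 (e φ).1)) ∧
      (∀ (f g : H ⟶ K) (φ : TwoMonad.LaxMor 𝒜 ℬ f) (γ : TwoMonad.LaxMor 𝒜 ℬ g)
        (ψ : LaxNat M N f) (χ : LaxNat M N g), SameCells φ ψ → SameCells γ χ →
        ∀ θ : f ⟶ g, IsModification ψ χ θ ↔ TwoMonad.IsAlgTwoCell φ γ θ) ∧
      (∀ (f g : H ⟶ K) (φ : TwoMonad.ColaxMor 𝒜 ℬ f) (γ : TwoMonad.ColaxMor 𝒜 ℬ g)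
        (ψ : ColaxNat M N f) (χ : ColaxNat M N g), SameColaxCells φ ψ → SameColaxCells γ χ →
        ∀ θ : f ⟶ g, IsColaxModification ψ χ θ ↔ TwoMonad.IsColaxAlgTwoCell φ γ θ) := by
  refine ⟨hM.existsUnique_alg, hN.existsUnique_alg, fun 𝒜 ℬ h𝒜 hℬ => ⟨fun f => ?_,
    fun f g φ γ ψ χ h h' θ => isModification_iff_isAlgTwoCell hN h𝒜 hℬ h h' θ,
    fun f g φ γ ψ χ h h' θ => isColaxModification_iff_isColaxAlgTwoCell hN h𝒜 hℬ h h' θ⟩⟩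
  obtain ⟨e, he⟩ := exists_laxMor_equiv hM hN h𝒜 hℬ f
  exact ⟨⟨e, he⟩, exists_colaxMor_equiv hM hN h𝒜 hℬ f,
    -- The pseudo and strict bijections are restrictions of the lax one to subtypes that it matches.
    ⟨e.subtypeEquiv fun φ => SameCells.isIso_iff (he φ), fun φ => he φ.1⟩,
    ⟨e.subtypeEquiv fun φ => SameCells.isId_iff (he φ), fun φ => he φ.1⟩⟩
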